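/- All graphs are finite and simple, subgraphs are induced and identified with their vertex sets, and paths are induced paths; $P^*$ denotes the interior of a path $P$. $N(X)$ is the set of vertices outside $X$ with a neighbour in $X$, $N(v)$ is the set of neighbours of $v$, and $N[v]=N(v)\cup\{v\}$. A graph contains $H$ if it has an induced subgraph isomorphic to $H$, and is $H$-free otherwise. A hole is an induced cycle of length at least four. A theta consists of two non-adjacent vertices $a,b$ and three paths from $a$ to $b$ of length at least two whose interiors are pairwise disjoint and anticomplete. A pyramid consists of a vertex $a$, a triangle $b_1b_2b_3$ and paths $P_i$ from $a$ to $b_i$ ($i=1,2,3$) of length at least one, at most one of them of length exactly one, such that for $i\ne j$ the sets $P_i\setminus\{a\}$, $P_j\setminus\{a\}$ are disjoint and $b_ib_j$ is the only edge between them. A prism consists of two triangles $a_1a_2a_3$, $b_1b_2b_3$ and pairwise disjoint paths $P_i$ from $a_i$ to $b_i$ of length at least one such that for $i\ne j$ the only edges between $P_i$ and $P_j$ are $a_ia_j$ and $b_ib_j$. A pinched prism consists of a hole $H$ of length at least six and a vertex $c\notin H$ such that $N(c)\cap H$ induces a two-edge matching. For $t\ge 1$, $\mathcal C_t$ is the class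 of graphs containing no theta, pyramid, prism, pinched prism, or $K_t$. The cube is the graph formed by a hole $a_1\cdots a_6$ and two non-adjacent vertices $b_1,b_2$ with $N(b_1)=\{a_1,a_3,a_5\}$ and $N(b_2)=\{a_2,a_4,a_6\}$. A wheel in $G$ is a pair $(W,v)$ where $W$ is a hole of length at least five, $v\notin W$ has at least three neighbours in $W$, and there are at least two long sectors, a long sector being a path $P$ of $W$ with $P^*\neq\emptyset$, both ends adjacent to $v$, and no vertex of $P^*$ adjacent to $v$. $\mathrm{Hub}(G)$ is the set of vertices $v$ for which some wheel $(W,v)$ exists in $G$, and $\deg_X(v)=|N(v)\cap X|$. $R(t,3)$ is the least integer such that every graph on at least that many vertices has a clique of size $t$ or a stable set of size $3$. A vertex $v$ of $G$ is unbalanced if some component of $G\setminus N[v]$ has more than $|V(G)|/2$ vertices; that component (which is then unique) is $B(v)$, and $C(v)=\{v\}\cup N(B(v))$, $A(v)=V(G)\setminus(B(v)\cup C(v))$. Unbalanced $u,v$ are star twins if $B(u)=B(v)$, $C(u)\setminus\{u\}=C(v)\setminus\{v\}$ and $A(u)\cup\{u\}=A(v)\cup\{v\}$. Given a stable set $S$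 of unbalanced vertices and a total order $\mathcal O$ on $S$, write $x\le_A y$ (for $x,y\in S$) if $x=y$, or $x,y$ are star twins and $x$ precedes $y$ in $\mathcal O$, or $x,y$ are not star twins and $y\in A(x)$. Let $\mathrm{Core}(S)$ be the set of $\le_A$-minimal elements of $S$, and let $\beta(S)=\bigcap_{v\in \mathrm{Core}(S)}(B(v)\cup C(v))$ (equal to $V(G)$ if $S=\emptyset$). **Theorem.** Let $t\ge 1$, let $G\in\mathcal C_t$, let $S$ be a stable set of unbalanced vertices of $G$, and fix a total order $\mathcal O$ on $S$. Then: 1. for every $v\in\mathrm{Core}(S)$, $C(v)\subseteq\beta(S)$; 2. for every $v\in\mathrm{Core}(S)$, $\deg_{\beta(S)}(v)<R(t,3)+\deg_{\mathrm{Hub}(G)}(v)$; 3. for every component $D$ of $G\setminus\beta(S)$ there is $v\in\mathrm{Core}(S)$ with $D\subseteq A(v)$; moreover, $N(D)\subseteq C(v)$ for every $v\in\mathrm{Core}(S)$ with $D\subseteq A(v)$; 4. if $G$ is cube-free, then no vertex of $S$ is a hub of the graph induced by $\beta(S)$, i.e. $S\cap\mathrm{Hub}(\beta(S))=\emptyset$.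 -/

import Mathlib

namespace CentralBag

variable {V : Type*}

/-! ### Neighbourhoods and components

Induced subgraphs are identified with their vertex sets. -/

/-- `N(X)`: the vertices outside `X` with at least one neighbor in `X`. -/
def nbhd (G : SimpleGraph V) (X : Set V) : Set V :=
  {w | w ∉ X ∧ ∃ x ∈ X, G.Adj x w}

/-- `N[v]`: the vertex `v` together with its neighbors. -/
def closedNbhd (G : SimpleGraph V) (v : V) : Set V :=
  insert v (G.neighborSet v)

/-- `X` is anticomplete to `Y`: no edge has one end in `X` and the other in `Y`. -/
def Anticomplete (G : SimpleGraph V) (X Y : Set V) : Prop :=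
  ∀ x ∈ X, ∀ y ∈ Y, ¬ G.Adj x y

/-- `deg_X(v) = |N(v) ∩ X|`. -/
noncomputable def degIn (G : SimpleGraph V) (X : Set V) (v : V) : ℕ :=
  (G.neighborSet v ∩ X).ncard

/-- `D` is (the vertex set of) a connected component of `G \ X`. -/
def IsComponentOfDiff (G : SimpleGraph V) (X D : Set V) : Prop :=
  ∃ c : (G.induce Xᶜ).ConnectedComponent, D = Subtype.val '' c.supp

/-! ### Induced paths, holes, and the excluded configurations -/

/-- `P` is the vertex set of a path of length `k` in `G` (always meaning an induced path)
from `a` to `b`. -/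
def IsPathFromTo (G : SimpleGraph V) (P : Set V) (a b : V) (k : ℕ) : Prop :=
  ∃ f : SimpleGraph.pathGraph (k + 1) ↪g G,
    Set.range f = P ∧ f 0 = a ∧ f (Fin.last k) = b

/-- `W` is the vertex set of a hole of length `n` in `G`: an induced cycle with `n ≥ 4`
vertices. -/
def IsHole (G : SimpleGraph V) (W : Set V) (n : ℕ) : Prop :=
  4 ≤ n ∧ ∃ f : SimpleGraph.cycleGraph n ↪g G, Set.range f = W

/-- `G` contains a theta (as an induced subgraph): two non-adjacent vertices `a`, `b` and three
paths from `a` to `b` of length at least two whose interiors are pairwise disjoint and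
anticomplete to each other. -/
def ContainsTheta (G : SimpleGraph V) : Prop :=
  ∃ (a b : V) (P : Fin 3 → Set V) (k : Fin 3 → ℕ),
    a ≠ b ∧ ¬ G.Adj a b ∧
    (∀ i, 2 ≤ k i ∧ IsPathFromTo G (P i) a b (k i)) ∧
    ∀ i j, i ≠ j → Disjoint (P i \ {a, b}) (P j \ {a, b}) ∧
      Anticomplete G (P i \ {a, b}) (P j \ {a, b})

/-- `G` contains a pyramid (as an induced subgraph): an apex `a`, a triangle `b 0, b 1, b 2` and
three paths `P i` from `a` to `b i` of length at least one, at most one of them of length exactly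
one, such that for `i ≠ j` the sets `P i \ {a}` and `P j \ {a}` are disjoint and `b i b j` is the
only edge between them. -/
def ContainsPyramid (G : SimpleGraph V) : Prop :=
  ∃ (a : V) (b : Fin 3 → V) (P : Fin 3 → Set V) (k : Fin 3 → ℕ),
    (∀ i j, i ≠ j → G.Adj (b i) (b j)) ∧
    (∀ i, 1 ≤ k i ∧ IsPathFromTo G (P i) a (b i) (k i)) ∧
    (∀ i j, k i = 1 → k j = 1 → i = j) ∧
    ∀ i j, i ≠ j → Disjoint (P i \ {a}) (P j \ {a}) ∧
      ∀ x ∈ P i \ {a}, ∀ y ∈ P j \ {a}, G.Adj x y → x = b i ∧ y = b j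

/-- `G` contains a prism (as an induced subgraph): triangles `a 0, a 1, a 2` and `b 0, b 1, b 2`
and three pairwise disjoint paths `P i` from `a i` to `b i` of length at least one, such that for
`i ≠ j` the only edges between `P i` and `P j` are `a i a j` and `b i b j`. -/
def ContainsPrism (G : SimpleGraph V) : Prop :=
  ∃ (a b : Fin 3 → V) (P : Fin 3 → Set V) (k : Fin 3 → ℕ),
    (∀ i j, i ≠ j → G.Adj (a i) (a j)) ∧
    (∀ i j, i ≠ j → G.Adj (b i) (b j)) ∧
    (∀ i, 1 ≤ k i ∧ IsPathFromTo G (P i) (a i) (b i) (k i)) ∧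
    ∀ i j, i ≠ j → Disjoint (P i) (P j) ∧
      ∀ x ∈ P i, ∀ y ∈ P j, G.Adj x y → (x = a i ∧ y = a j) ∨ (x = b i ∧ y = b j)

/-- `G` contains a pinched prism (as an induced subgraph): a hole `H` of length at least six and a
vertex `c` outside `H` whose neighbors in `H` are four distinct vertices `x, y, z, w` such that
`xy` and `zw` are the only edges among them. -/
def ContainsPinchedPrism (G : SimpleGraph V) : Prop :=
  ∃ (H : Set V) (n : ℕ) (c : V), IsHole G H n ∧ 6 ≤ n ∧ c ∉ H ∧
    ∃ x y z w : V, G.neighborSet c ∩ H = {x, y, z, w} ∧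
      Disjoint ({x, y} : Set V) {z, w} ∧
      G.Adj x y ∧ G.Adj z w ∧ Anticomplete G {x, y} {z, w}

/-- The class `𝒞_t` of (theta, pyramid, generalized prism, `K_t`)-free graphs, where a generalized
prism is a prism or a pinched prism. -/
structure InClassC (t : ℕ) (G : SimpleGraph V) : Prop where
  theta_free : ¬ ContainsTheta G
  pyramid_free : ¬ ContainsPyramid G
  prism_free : ¬ ContainsPrism G
  pinchedPrism_free : ¬ ContainsPinchedPrism G
  clique_free : G.CliqueFree t

/-- The cube: a hole on six vertices `inl 0, …, inl 5` and two further non-adjacent vertices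
`inr 0`, `inr 1`, the first adjacent to the hole vertices of even index and the second to those of
odd index. -/
def cubeGraph : SimpleGraph (Fin 6 ⊕ Fin 2) :=
  SimpleGraph.fromRel fun p q =>
    match p, q with
    | Sum.inl i, Sum.inl j => (SimpleGraph.cycleGraph 6).Adj i j
    | Sum.inr b, Sum.inl i => i.val % 2 = b.val
    | _, _ => False

/-- `G` has no induced subgraph isomorphic to the cube. -/
def CubeFree (G : SimpleGraph V) : Prop :=
  ¬ SimpleGraph.IsIndContained cubeGraph G

/-! ### Wheels and hubs -/

/-- `P` is a long sector of `(W, v)`: a path of `W` with nonempty interior (that is, of length at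
least two), both of whose ends are adjacent to `v`, and such that `v` is anticomplete to the
interior of the path. -/
def IsLongSector (G : SimpleGraph V) (W : Set V) (v : V) (P : Set V) : Prop :=
  P ⊆ W ∧ ∃ (a b : V) (k : ℕ), 2 ≤ k ∧ IsPathFromTo G P a b k ∧
    G.Adj v a ∧ G.Adj v b ∧ ∀ x ∈ P \ {a, b}, ¬ G.Adj v x

/-- `(W, v)` is a wheel: `W` is a hole of length at least five, `v ∉ W` has at least three
neighbors in `W`, and `(W, v)` has at least two long sectors. -/
def IsWheel (G : SimpleGraph V) (W : Set V) (v : V) : Prop :=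
  (∃ n, 5 ≤ n ∧ IsHole G W n) ∧ v ∉ W ∧ 3 ≤ degIn G W v ∧
    ∃ P Q : Set V, P ≠ Q ∧ IsLongSector G W v P ∧ IsLongSector G W v Q

/-- The set of hubs of `G`, i.e. of vertices `v` for which there is a wheel `(W, v)` in `G`. -/
def Hub (G : SimpleGraph V) : Set V :=
  {v | ∃ W, IsWheel G W v}

/-- The hubs of the induced subgraph `G[X]`, as a set of vertices of `G`. -/
def HubOn (G : SimpleGraph V) (X : Set V) : Set V :=
  Subtype.val '' Hub (G.induce X)

/-! ### Ramsey numbers -/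

/-- `R(t, s)`: the least `N` such that every graph on at least `N` vertices has a clique of size
`t` or a stable set of size `s`. -/
noncomputable def ramsey (t s : ℕ) : ℕ :=
  sInf {N | ∀ n, N ≤ n → ∀ H : SimpleGraph (Fin n),
    (∃ K : Finset (Fin n), H.IsNClique t K) ∨ (∃ K : Finset (Fin n), H.IsNIndepSet s K)}

/-! ### Canonical star separations -/

/-- `v` is unbalanced: it is not the case that every component of `G \ N[v]` has at most half of
the vertices of `G`. -/
def Unbalanced (G : SimpleGraph V) (v : V) : Prop :=
  ¬ ∀ D, IsComponentOfDiff G (closedNbhd G v) D → (D.ncard : ℚ) ≤ (Nat.card V : ℚ) / 2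

/-- `B(v)`: the component of `G \ N[v]` with more than half of the vertices of `G` (for `v`
unbalanced there is exactly one, see `sideB_eq`; it is written as a union to avoid a choice). -/
def sideB (G : SimpleGraph V) (v : V) : Set V :=
  ⋃₀ {D | IsComponentOfDiff G (closedNbhd G v) D ∧ (Nat.card V : ℚ) / 2 < (D.ncard : ℚ)}

/-- `C(v) = {v} ∪ N(B(v))`. -/
def sideC (G : SimpleGraph V) (v : V) : Set V :=
  {v} ∪ nbhd G (sideB G v)

/-- `A(v) = V(G) \ (B(v) ∪ C(v))`. -/
def sideA (G : SimpleGraph V) (v : V) : Set V :=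
  (sideB G v ∪ sideC G v)ᶜ

/-- If `D` is a component of `G \ N[v]` with more than half of the vertices, then `B(v) = D`. -/
theorem sideB_eq [Finite V] (G : SimpleGraph V) (v : V) (D : Set V)
    (hD : IsComponentOfDiff G (closedNbhd G v) D)
    (hc : (Nat.card V : ℚ) / 2 < (D.ncard : ℚ)) : sideB G v = D := by
  have key : ∀ E, IsComponentOfDiff G (closedNbhd G v) E →
      (Nat.card V : ℚ) / 2 < (E.ncard : ℚ) → E = D := by
    rintro E ⟨c, rfl⟩ hE
    obtain ⟨d, rfl⟩ := hD
    by_contra hne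
    have hcd : c ≠ d := fun h => hne (by rw [h])
    have hdis : Disjoint (Subtype.val '' c.supp) (Subtype.val '' d.supp) := by
      rw [Set.disjoint_image_iff Subtype.val_injective]
      exact SimpleGraph.pairwise_disjoint_supp_connectedComponent _ hcd
    have h1 := Set.ncard_union_eq hdis (Set.toFinite _) (Set.toFinite _)
    have h2 : (Subtype.val '' c.supp ∪ Subtype.val '' d.supp).ncard ≤ Nat.card V := by
      rw [← Set.ncard_univ]
      exact Set.ncard_le_ncard (Set.subset_univ _) (Set.toFinite _)
    rw [h1] at h2
    have h3 : (((Subtype.val '' c.supp).ncard + (Subtype.val '' d.supp).ncard : ℕ) : ℚ)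
        ≤ (Nat.card V : ℚ) := by exact_mod_cast h2
    push_cast at h3
    linarith
  apply Set.Subset.antisymm
  · rintro x ⟨E, ⟨hE, hE'⟩, hx⟩
    rwa [← key E hE hE']
  · intro x hx
    exact ⟨D, ⟨hD, hc⟩, hx⟩

/-- `u` and `v` are star twins. -/
def StarTwins (G : SimpleGraph V) (u v : V) : Prop :=
  sideB G u = sideB G v ∧ sideC G u \ {u} = sideC G v \ {v} ∧
    sideA G u ∪ {u} = sideA G v ∪ {v}

/-- The relation `x ≤_A y` on `S`, where `O` is the fixed total ordering of `S`. -/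
def leA (G : SimpleGraph V) (S : Set V) (O : LinearOrder S) (x y : S) : Prop :=
  x = y ∨ (StarTwins G x y ∧ O.lt x y) ∨ (¬ StarTwins G x y ∧ (y : V) ∈ sideA G x)

/-- `Core(S)`: the `≤_A`-minimal elements of `S`. -/
def core (G : SimpleGraph V) (S : Set V) (O : LinearOrder S) : Set V :=
  {v | ∃ hv : v ∈ S, ∀ u : S, leA G S O u ⟨v, hv⟩ → u = ⟨v, hv⟩}

/-- The central bag `β(S)`: the intersection of the sets `B(v) ∪ C(v)` over `v ∈ Core(S)`. -/
def centralBag (G : SimpleGraph V) (S : Set V) (O : LinearOrder S) : Set V :=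
  ⋂ v ∈ core G S O, (sideB G v ∪ sideC G v)

end CentralBag

/-! For an unbalanced v the set B(v) is connected, has more than half of the vertices and is
anticomplete to A(v); a vertex of C(v) other than v is a neighbour of v that sees B(v). Any two such
sets B meet, so v ∈ A(u) forces B(u) ⊆ B(v), and star twins are exactly the pairs with equal B.
Hence ≤_A behaves as an order, every vertex of S outside the core lies in A(u) for some core vertex
u, and distinct core vertices lie in each other's B (`mem_sideB_of_mem_core`): minimality excludes
A, and stability of S excludes C. So the separations of core vertices do not cross, which gives
statements 1 and 3.

Statement 2: the neighbours of a core vertex v in the central bag all see B(v). Of three pairwise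
non-adjacent ones, one is a hub (`mem_hub_of_three`). The non-hubs among them therefore contain no
stable triple and no clique of size t, so there are fewer than R(t,3) of them.

Statement 4: a vertex of S outside the core is not in the bag at all. If v is in the core, the hole
of a wheel with hub v in the bag lies in B(v) together with the neighbours of v that see B(v), and
its non-neighbours of v occur in at least two separate gaps (`SplitHole`). Take such a hole with as
few neighbours of v as possible. Minimality enters through `MinSplitHole.exists_sees_arc`: a
connected part of B(v) off the hole through which the hole could be rerouted, keeping a given arc
but losing a neighbour of v, must see the interior of that arc. If there are three arcs, a shortest
path hitting two of them hits all three and is a single vertex p (`MinSplitHole.exists_hits_three`);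
the absence of thetas and pyramids then forces a hole of length six seen alternately by p and v, a
cube. If there are only two arcs, the rest of the hole consists of two sides made of neighbours of
v. A side with an interior is excluded by following a path in B(v) from that side to the arcs
(`MinSplitHole.false_of_long_side`). If each side is a vertex or an edge, v and the hole form a
theta, a pyramid or a pinched prism. -/

namespace CentralBag

section

variable {V : Type*}

/-! ### Connected vertex sets -/

/-- `S` is nonempty and induces a connected subgraph. -/
def Conn (G : SimpleGraph V) (S : Set V) : Prop :=
  S.Nonempty ∧ ∀ T ⊆ S, T.Nonempty → (∀ x ∈ T, ∀ y ∈ S, G.Adj x y → y ∈ T) → S ⊆ T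

/-- `w` has a neighbour in `X`. -/
def Sees (G : SimpleGraph V) (w : V) (X : Set V) : Prop :=
  ∃ x ∈ X, G.Adj w x

theorem Sees.mono {G : SimpleGraph V} {w : V} {X Y : Set V} (h : Sees G w X) (hXY : X ⊆ Y) :
    Sees G w Y := by
  obtain ⟨x, hx, hwx⟩ := h
  exact ⟨x, hXY hx, hwx⟩

theorem conn_singleton (G : SimpleGraph V) (a : V) : Conn G {a} := by
  refine ⟨⟨a, rfl⟩, ?_⟩
  rintro T hT ⟨x, hx⟩ - y rfl
  rwa [← Set.mem_singleton_iff.1 (hT hx)]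

theorem Conn.union_of_adj {G : SimpleGraph V} {A B : Set V} (hA : Conn G A) (hB : Conn G B)
    {a b : V} (ha : a ∈ A) (hb : b ∈ B) (hab : G.Adj a b) : Conn G (A ∪ B) := by
  refine ⟨⟨a, Or.inl ha⟩, fun T hT hne hcl => ?_⟩
  have key1 : (T ∩ A).Nonempty → A ⊆ T := fun h => fun x hx =>
    (hA.2 (T ∩ A) Set.inter_subset_right h
      (fun x hx y hy hxy => ⟨hcl x hx.1 y (Or.inl hy) hxy, hy⟩) hx).1
  have key2 : (T ∩ B).Nonempty → B ⊆ T := fun h => fun x hx =>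
    (hB.2 (T ∩ B) Set.inter_subset_right h
      (fun x hx y hy hxy => ⟨hcl x hx.1 y (Or.inr hy) hxy, hy⟩) hx).1
  obtain ⟨x, hx⟩ := hne
  rcases hT hx with h | h
  · have h1 := key1 ⟨x, hx, h⟩
    exact Set.union_subset h1 (key2 ⟨b, hcl a (h1 ha) b (Or.inr hb) hab, hb⟩)
  · have h1 := key2 ⟨x, hx, h⟩
    exact Set.union_subset (key1 ⟨a, hcl b (h1 hb) a (Or.inl ha) hab.symm, ha⟩) h1

theorem Conn.insert_of_sees {G : SimpleGraph V} {A : Set V} (hA : Conn G A) {w : V}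
    (h : Sees G w A) : Conn G (insert w A) := by
  obtain ⟨a, ha, hwa⟩ := h
  exact (conn_singleton G w).union_of_adj hA rfl ha hwa

/-- A sequence of vertices in which consecutive vertices are adjacent spans a connected set. -/
theorem conn_image_Icc {G : SimpleGraph V} (u : ℤ → V) {i j : ℤ} (hij : i ≤ j)
    (h : ∀ t, i ≤ t → t < j → G.Adj (u t) (u (t + 1))) : Conn G (u '' Set.Icc i j) := by
  induction j, hij using Int.leInduction with
  | base => simpa using conn_singleton G (u i)
  | succ j hij ih =>
    have h1 : u '' Set.Icc i (j + 1) = u '' Set.Icc i j ∪ {u (j + 1)} := by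
      ext x
      simp only [Set.mem_image, Set.mem_Icc, Set.mem_union, Set.mem_singleton_iff]
      constructor
      · rintro ⟨t, ht, rfl⟩
        rcases eq_or_lt_of_le ht.2 with h | h
        · right; rw [h]
        · left; exact ⟨t, ⟨ht.1, by omega⟩, rfl⟩
      · rintro (⟨t, ht, rfl⟩ | rfl)
        · exact ⟨t, ⟨ht.1, by omega⟩, rfl⟩
        · exact ⟨j + 1, ⟨by omega, le_rfl⟩, rfl⟩
    rw [h1]
    exact (ih fun t h2 h3 => h t h2 (by omega)).union_of_adj (conn_singleton G _)
      ⟨j, ⟨hij, le_rfl⟩, rfl⟩ rfl (h j hij (by omega))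

/-! ### Induced paths -/

/-- `u 0, …, u l` is an induced path of `G`. -/
def IndPath (G : SimpleGraph V) (u : ℕ → V) (l : ℕ) : Prop :=
  ∀ i ≤ l, ∀ j ≤ l, (u i = u j → i = j) ∧ (G.Adj (u i) (u j) ↔ i + 1 = j ∨ j + 1 = i)

theorem IndPath.conn_seg {G : SimpleGraph V} {u : ℕ → V} {l : ℕ} (hu : IndPath G u l) {i j : ℕ}
    (hij : i ≤ j) (hj : j ≤ l) : Conn G (u '' Set.Icc i j) := by
  have h := conn_image_Icc (G := G) (fun t : ℤ => u t.toNat) (i := i) (j := j) (by omega)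
    (fun t h1 h2 => by
      refine (hu _ (by omega) _ (by omega)).2.2 (Or.inl ?_)
      omega)
  convert h using 1
  ext x
  simp only [Set.mem_image, Set.mem_Icc]
  constructor
  · rintro ⟨t, ht, rfl⟩
    exact ⟨t, by omega, by simp⟩
  · rintro ⟨t, ht, rfl⟩
    exact ⟨t.toNat, by omega, rfl⟩

theorem IndPath.shift {G : SimpleGraph V} {u : ℕ → V} {l : ℕ} (hu : IndPath G u l) (i : ℕ)
    {m : ℕ} (hm : i + m ≤ l) : IndPath G (fun t => u (i + t)) m := by
  intro a ha b hb
  have h := hu (i + a) (by omega) (i + b) (by omega)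
  exact ⟨fun h1 => by have := h.1 h1; omega, h.2.trans (by omega)⟩

theorem IndPath.reverse {G : SimpleGraph V} {u : ℕ → V} {l : ℕ} (hu : IndPath G u l) :
    IndPath G (fun t => u (l - t)) l := by
  intro a ha b hb
  have h := hu (l - a) (by omega) (l - b) (by omega)
  exact ⟨fun h1 => by have := h.1 h1; omega, h.2.trans (by omega)⟩

theorem indPath_zero (G : SimpleGraph V) (u : ℕ → V) : IndPath G u 0 := by
  intro a ha b hb
  obtain rfl : a = 0 := by omega
  obtain rfl : b = 0 := by omega
  simp

/-- Concatenation of two induced paths joined by a single edge. -/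
theorem IndPath.append {G : SimpleGraph V} {u w : ℕ → V} {l m : ℕ} (hu : IndPath G u l)
    (hw : IndPath G w m) (hne : ∀ a ≤ l, ∀ b ≤ m, u a ≠ w b)
    (hadj : ∀ a ≤ l, ∀ b ≤ m, (G.Adj (u a) (w b) ↔ a = l ∧ b = 0)) :
    IndPath G (fun t => if t ≤ l then u t else w (t - (l + 1))) (l + 1 + m) := by
  intro a ha b hb
  by_cases h1 : a ≤ l <;> by_cases h2 : b ≤ l
  · simp only [h1, h2, if_true]; exact hu a h1 b h2
  · simp only [h1, h2, if_true, if_false]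
    refine ⟨fun h => absurd h (hne a h1 _ (by omega)), ?_⟩
    rw [hadj a h1 _ (by omega)]; omega
  · simp only [h1, h2, if_true, if_false]
    refine ⟨fun h => absurd h.symm (hne b h2 _ (by omega)), ?_⟩
    rw [G.adj_comm, hadj b h2 _ (by omega)]; omega
  · simp only [h1, h2, if_false]
    have h := hw (a - (l + 1)) (by omega) (b - (l + 1)) (by omega)
    exact ⟨fun h3 => by have := h.1 h3; omega, h.2.trans (by omega)⟩

theorem IndPath.cons {G : SimpleGraph V} {u : ℕ → V} {l : ℕ} (hu : IndPath G u l) {a : V}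
    (hne : ∀ t ≤ l, a ≠ u t) (hadj : ∀ t ≤ l, (G.Adj a (u t) ↔ t = 0)) :
    IndPath G (fun t => if t = 0 then a else u (t - 1)) (l + 1) := by
  have h := (indPath_zero G (fun _ => a)).append hu (fun _ _ b hb => hne b hb)
    (fun i hi b hb => by rw [hadj b hb]; omega)
  simpa [Nat.add_comm] using h

/-- A shortest path in a connected set `Z` between two subsets. -/
theorem Conn.exists_indPath {G : SimpleGraph V} {Z A B : Set V} (hZ : Conn G Z)
    (hA : (Z ∩ A).Nonempty) (hB : (Z ∩ B).Nonempty) :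
    ∃ (u : ℕ → V) (l : ℕ), IndPath G u l ∧ u 0 ∈ A ∧ u l ∈ B ∧ (∀ i ≤ l, u i ∈ Z) ∧
      (∀ i ≤ l, 0 < i → u i ∉ A) ∧ ∀ i < l, u i ∉ B := by
  classical
  let W : V → ℕ → Prop := fun x l => ∃ u : ℕ → V, u 0 ∈ A ∧ u l = x ∧ (∀ i ≤ l, u i ∈ Z) ∧
    ∀ i < l, G.Adj (u i) (u (i + 1))
  -- The vertices reached from `A` by walks inside `Z` are closed under adjacency in `Z`, so they
  -- are all of `Z`.
  have hreach : Z ⊆ {x | x ∈ Z ∧ ∃ l, W x l} := by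
    refine hZ.2 _ (fun x hx => hx.1) ?_ ?_
    · obtain ⟨a, ha, ha'⟩ := hA
      exact ⟨a, ha, 0, fun _ => a, ha', rfl, fun _ _ => ha, fun i hi => absurd hi (by omega)⟩
    · rintro x ⟨hx, l, u, h0, hl, hz, hadj⟩ y hy hxy
      refine ⟨hy, l + 1, fun t => if t ≤ l then u t else y, by simpa using h0, by simp, ?_, ?_⟩
      · intro i hi
        by_cases h : i ≤ l
        · simp only [h, if_true]; exact hz i h
        · simp only [h, if_false]; exact hy
      · intro i hi
        have h : i ≤ l := by omega
        simp only [h, if_true]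
        by_cases h' : i + 1 ≤ l
        · simp only [h', if_true]; exact hadj i (by omega)
        · obtain rfl : i = l := by omega
          simp only [h', if_false]; rwa [hl]
  have hex : ∃ l, ∃ x ∈ B, W x l := by
    obtain ⟨b, hb, hb'⟩ := hB
    obtain ⟨-, l, h⟩ := hreach hb
    exact ⟨l, b, hb', h⟩
  have hmin : ∀ m, m < Nat.find hex → ¬ ∃ x ∈ B, W x m := fun m hm => Nat.find_min hex hm
  obtain ⟨x, hxB, u, h0, hl, hz, hadj⟩ := Nat.find_spec hex
  set l := Nat.find hex with hldef
  -- In a shortest walk from `A` to `B`, a repeated vertex or a chord would allow a shortcut, and so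
  -- would a later vertex in `A` or an earlier one in `B`.
  have hshort : ∀ i j, i < j → j ≤ l → u i ≠ u j := by
    intro i j hij hj h
    refine hmin (l - (j - i)) (by omega) ⟨x, hxB,
      fun t => if t ≤ i then u t else u (t + (j - i)), by simpa using h0, ?_, ?_, ?_⟩
    · dsimp only
      split_ifs with h1
      · have : l = j := by omega
        rw [← hl, this, ← h]; congr 1; omega
      · rw [← hl]; congr 1; omega
    · intro t ht
      dsimp only
      split_ifs with h1
      · exact hz _ (by omega)
      · exact hz _ (by omega)
    · intro t ht
      dsimp only
      split_ifs with h1 h2 h2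
      · exact hadj _ (by omega)
      · obtain rfl : t = i := by omega
        rw [h, show t + 1 + (j - t) = j + 1 by omega]
        exact hadj _ (by omega)
      · omega
      · rw [show t + 1 + (j - i) = t + (j - i) + 1 by omega]
        exact hadj _ (by omega)
  have hchord : ∀ i j, i + 1 < j → j ≤ l → ¬ G.Adj (u i) (u j) := by
    intro i j hij hj h
    refine hmin (l - (j - i - 1)) (by omega) ⟨x, hxB,
      fun t => if t ≤ i then u t else u (t + (j - i - 1)), by simpa using h0, ?_, ?_, ?_⟩
    · dsimp only
      rw [if_neg (by omega), ← hl]; congr 1; omega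
    · intro t ht
      dsimp only
      split_ifs with h1
      · exact hz _ (by omega)
      · exact hz _ (by omega)
    · intro t ht
      dsimp only
      split_ifs with h1 h2 h2
      · exact hadj _ (by omega)
      · obtain rfl : t = i := by omega
        rw [show t + 1 + (j - t - 1) = j by omega]
        exact h
      · omega
      · rw [show t + 1 + (j - i - 1) = t + (j - i - 1) + 1 by omega]
        exact hadj _ (by omega)
  refine ⟨u, l, ?_, h0, hl ▸ hxB, hz, ?_, ?_⟩
  · intro i hi j hj
    constructor
    · intro h
      rcases lt_trichotomy i j with h1 | h1 | h1
      · exact absurd h (hshort i j h1 hj)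
      · exact h1
      · exact absurd h.symm (hshort j i h1 hi)
    · constructor
      · intro h
        by_contra hcon
        rcases lt_trichotomy i j with h1 | h1 | h1
        · exact hchord i j (by omega) hj h
        · subst h1; exact G.loopless.irrefl _ h
        · exact hchord j i (by omega) hi h.symm
      · rintro (h | h)
        · subst h; exact hadj i (by omega)
        · subst h; exact (hadj j (by omega)).symm
  · intro i hi h1 h2
    refine hmin (l - i) (by omega) ⟨x, hxB, fun t => u (i + t), by simpa using h2, ?_, ?_, ?_⟩
    · dsimp only; rw [← hl]; congr 1; omega
    · intro t ht; exact hz _ (by omega)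
    · intro t ht; exact hadj (i + t) (by omega)
  · intro i hi h1
    exact hmin i hi ⟨u i, h1, u, h0, rfl, fun t ht => hz t (by omega),
      fun t ht => hadj t (by omega)⟩

theorem IndPath.isPathFromTo {G : SimpleGraph V} {u : ℕ → V} {l : ℕ} (hu : IndPath G u l) :
    IsPathFromTo G (u '' Set.Icc 0 l) (u 0) (u l) l := by
  refine ⟨⟨⟨fun i => u i.val, ?_⟩, ?_⟩, ?_, ?_, ?_⟩
  · intro i j h
    exact Fin.ext ((hu i (by omega) j (by omega)).1 h)
  · intro i j
    simp only [SimpleGraph.pathGraph_adj]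
    exact (hu i (by omega) j (by omega)).2
  · ext x
    simp only [Set.mem_range, Set.mem_image, Set.mem_Icc]
    constructor
    · rintro ⟨i, rfl⟩; exact ⟨i, by omega, rfl⟩
    · rintro ⟨i, hi, rfl⟩; exact ⟨⟨i, by omega⟩, rfl⟩
  · rfl
  · rfl

theorem IsPathFromTo.exists_indPath {G : SimpleGraph V} {P : Set V} {a b : V} {l : ℕ}
    (h : IsPathFromTo G P a b l) :
    ∃ u : ℕ → V, IndPath G u l ∧ P = u '' Set.Icc 0 l ∧ u 0 = a ∧ u l = b := by
  obtain ⟨f, hP, ha, hb⟩ := h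
  -- Beyond `l` the sequence is constant; only indices up to `l` matter.
  refine ⟨fun t => f ⟨min t l, by omega⟩, ?_, ?_, ?_, ?_⟩
  · intro i hi j hj
    constructor
    · intro h
      have := congrArg Fin.val (f.injective h)
      simp only at this
      omega
    · rw [f.map_adj_iff, SimpleGraph.pathGraph_adj]
      simp only
      omega
  · rw [← hP]
    ext x
    simp only [Set.mem_range, Set.mem_image, Set.mem_Icc]
    constructor
    · rintro ⟨i, rfl⟩
      refine ⟨i, by omega, ?_⟩
      congr 1; ext; simp only; omega
    · rintro ⟨i, hi, rfl⟩; exact ⟨_, rfl⟩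
  · rw [← ha]; congr 1
  · rw [← hb]
    have : (⟨min l l, by omega⟩ : Fin (l + 1)) = Fin.last l := by ext; simp
    exact congrArg f this

end

section

variable {V : Type*}

/-! ### Recognising three-path configurations from connected sets -/

/-- A path from `a` through a connected set `X` to `B`, with all vertices but `a` in `X`. -/
theorem Conn.exists_indPath_from {G : SimpleGraph V} {X B : Set V} {a : V} (hX : Conn G X)
    (ha : a ∉ X) (hs : Sees G a X) (hB : (X ∩ B).Nonempty) :
    ∃ (u : ℕ → V) (l : ℕ), IndPath G u (l + 1) ∧ u 0 = a ∧ u (l + 1) ∈ B ∧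
      (∀ i ≤ l + 1, 0 < i → u i ∈ X) ∧ ∀ i < l + 1, 0 < i → u i ∉ B := by
  obtain ⟨x, hx, hax⟩ := hs
  obtain ⟨u, l, hu, h0, hl, hz, hnA, hnB⟩ :=
    hX.exists_indPath (A := G.neighborSet a) ⟨x, hx, hax⟩ hB
  refine ⟨_, l, hu.cons (a := a) ?_ ?_, by simp, by simpa using hl, ?_, ?_⟩
  · rintro t ht rfl; exact ha (hz t ht)
  · intro t ht
    constructor
    · intro h
      by_contra h0
      exact hnA t ht (by omega) h
    · rintro rfl; exact h0
  · intro i hi h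
    simp only [show i ≠ 0 by omega, if_false]
    exact hz _ (by omega)
  · intro i hi h
    simp only [show i ≠ 0 by omega, if_false]
    exact hnB _ (by omega)

/-- A path from `a` to `b` with interior in a connected set seen by both. -/
theorem Conn.exists_indPath_between {G : SimpleGraph V} {X : Set V} {a b : V} (hX : Conn G X)
    (ha : a ∉ X) (hb : b ∉ X) (hsa : Sees G a X) (hsb : Sees G b X) (hab : a ≠ b)
    (hnadj : ¬ G.Adj a b) :
    ∃ (u : ℕ → V) (l : ℕ), 2 ≤ l ∧ IndPath G u l ∧ u 0 = a ∧ u l = b ∧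
      ∀ i < l, 0 < i → u i ∈ X := by
  obtain ⟨y, hy, hby⟩ := hsb
  obtain ⟨u, l, hu, h0, hl, hz, hnB⟩ :=
    hX.exists_indPath_from (B := G.neighborSet b) ha hsa ⟨y, hy, hby⟩
  refine ⟨_, l + 1 + 1 + 0, by omega, hu.append (w := fun _ => b) (indPath_zero G _) ?_ ?_,
    by simpa using h0, by simp, ?_⟩
  · intro t ht _ _ h
    rcases Nat.eq_zero_or_pos t with h1 | h1
    · subst h1; exact hab (h0 ▸ h)
    · exact hb (h ▸ hz t ht h1)
  · intro t ht s hs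
    constructor
    · intro h
      rcases Nat.eq_zero_or_pos t with h1 | h1
      · subst h1; exact absurd (h0 ▸ h) hnadj
      · by_contra hcon
        exact hnB t (by omega) h1 h.symm
    · rintro ⟨rfl, -⟩; exact G.adj_symm hl
  · intro i hi h
    simp only [show i ≤ l + 1 by omega, if_true]
    exact hz i (by omega) h

/-- Shortest paths through the sets `X i` inherit disjointness and anticompleteness from them. A
three-path configuration can thus be recognised from connected sets, with no explicit paths; the
pyramid and the prism are treated in the same way. -/
theorem containsTheta_of_conn {G : SimpleGraph V} {a b : V} {X : Fin 3 → Set V} (hab : a ≠ b)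
    (hnadj : ¬ G.Adj a b) (hX : ∀ i, Conn G (X i) ∧ a ∉ X i ∧ b ∉ X i ∧ Sees G a (X i) ∧
      Sees G b (X i))
    (hXX : ∀ i j, i < j → Disjoint (X i) (X j) ∧ Anticomplete G (X i) (X j)) :
    ContainsTheta G := by
  choose u l hl hu h0 h1 hin using fun i => (hX i).1.exists_indPath_between (hX i).2.1
    (hX i).2.2.1 (hX i).2.2.2.1 (hX i).2.2.2.2 hab hnadj
  have hsub : ∀ i, u i '' Set.Icc 0 (l i) \ {a, b} ⊆ X i := by
    rintro i x ⟨⟨t, ht, rfl⟩, hx⟩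
    simp only [Set.mem_insert_iff, Set.mem_singleton_iff, not_or] at hx
    refine hin i t (lt_of_le_of_ne ht.2 ?_) (Nat.pos_of_ne_zero ?_)
    · rintro rfl; exact hx.2 (h1 i)
    · rintro rfl; exact hx.1 (h0 i)
  refine ⟨a, b, fun i => u i '' Set.Icc 0 (l i), l, hab, hnadj, fun i => ⟨hl i, ?_⟩, ?_⟩
  · have := (hu i).isPathFromTo
    rwa [h0, h1] at this
  · have key : ∀ i j, i ≠ j → Disjoint (X i) (X j) ∧ Anticomplete G (X i) (X j) := by
      intro i j hij
      rcases lt_or_gt_of_ne hij with h | h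
      · exact hXX i j h
      · exact ⟨(hXX j i h).1.symm, fun x hx y hy hxy => (hXX j i h).2 y hy x hx hxy.symm⟩
    intro i j hij
    exact ⟨(key i j hij).1.mono (hsub i) (hsub j),
      fun x hx y hy => (key i j hij).2 x (hsub i hx) y (hsub j hy)⟩

/-- The length restriction becomes `hone`, because a path of length one from `a` to `b i` is an
edge. -/
theorem containsPyramid_of_conn {G : SimpleGraph V} {a : V} {b : Fin 3 → V} {X : Fin 3 → Set V}
    (hb : ∀ i j, i < j → G.Adj (b i) (b j))
    (hX : ∀ i, Conn G (X i) ∧ a ∉ X i ∧ b i ∈ X i ∧ Sees G a (X i))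
    (hone : ∀ i j, i < j → ¬ (G.Adj a (b i) ∧ G.Adj a (b j)))
    (hXX : ∀ i j, i < j → Disjoint (X i) (X j) ∧
      ∀ x ∈ X i, ∀ y ∈ X j, G.Adj x y → x = b i ∧ y = b j) :
    ContainsPyramid G := by
  choose u l hu h0 h1 hin hnb using fun i => (hX i).1.exists_indPath_from (B := {b i}) (hX i).2.1
    (hX i).2.2.2 ⟨b i, (hX i).2.2.1, rfl⟩
  have hsub : ∀ i, u i '' Set.Icc 0 (l i + 1) \ {a} ⊆ X i := by
    rintro i x ⟨⟨t, ht, rfl⟩, hx⟩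
    refine hin i t ht.2 (Nat.pos_of_ne_zero ?_)
    rintro rfl; exact hx (h0 i)
  have hadj : ∀ i, l i + 1 = 1 → G.Adj a (b i) := by
    intro i hi
    have := (hu i 0 (by omega) (l i + 1) le_rfl).2.2 (Or.inl (by omega))
    rwa [h0, Set.mem_singleton_iff.1 (h1 i)] at this
  refine ⟨a, b, fun i => u i '' Set.Icc 0 (l i + 1), fun i => l i + 1, ?_,
    fun i => ⟨Nat.le_add_left 1 _, ?_⟩, ?_, ?_⟩
  · intro i j hij
    rcases lt_or_gt_of_ne hij with h | h
    · exact hb i j h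
    · exact (hb j i h).symm
  · have := (hu i).isPathFromTo
    rwa [h0, Set.mem_singleton_iff.1 (h1 i)] at this
  · intro i j hi hj
    by_contra hij
    rcases lt_or_gt_of_ne hij with h | h
    · exact hone i j h ⟨hadj i hi, hadj j hj⟩
    · exact hone j i h ⟨hadj j hj, hadj i hi⟩
  · have key : ∀ i j, i ≠ j → Disjoint (X i) (X j) ∧
        ∀ x ∈ X i, ∀ y ∈ X j, G.Adj x y → x = b i ∧ y = b j := by
      intro i j hij
      rcases lt_or_gt_of_ne hij with h | h
      · exact hXX i j h
      · exact ⟨(hXX j i h).1.symm, fun x hx y hy hxy => ((hXX j i h).2 y hy x hx hxy.symm).symm⟩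
    intro i j hij
    exact ⟨(key i j hij).1.mono (hsub i) (hsub j),
      fun x hx y hy => (key i j hij).2 x (hsub i hx) y (hsub j hy)⟩

theorem containsPrism_of_conn {G : SimpleGraph V} {a b : Fin 3 → V} {X : Fin 3 → Set V}
    (ha : ∀ i j, i < j → G.Adj (a i) (a j)) (hb : ∀ i j, i < j → G.Adj (b i) (b j))
    (hX : ∀ i, Conn G (X i) ∧ a i ∈ X i ∧ b i ∈ X i ∧ a i ≠ b i)
    (hXX : ∀ i j, i < j → Disjoint (X i) (X j) ∧
      ∀ x ∈ X i, ∀ y ∈ X j, G.Adj x y → (x = a i ∧ y = a j) ∨ (x = b i ∧ y = b j)) :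
    ContainsPrism G := by
  choose u l hu h0 h1 hin _ _ using fun i => (hX i).1.exists_indPath (A := {a i}) (B := {b i})
    ⟨a i, (hX i).2.1, rfl⟩ ⟨b i, (hX i).2.2.1, rfl⟩
  have hsub : ∀ i, u i '' Set.Icc 0 (l i) ⊆ X i := by
    rintro i x ⟨t, ht, rfl⟩
    exact hin i t ht.2
  refine ⟨a, b, fun i => u i '' Set.Icc 0 (l i), l, ?_, ?_, fun i => ⟨?_, ?_⟩, ?_⟩
  · intro i j hij
    rcases lt_or_gt_of_ne hij with h | h
    · exact ha i j h
    · exact (ha j i h).symm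
  · intro i j hij
    rcases lt_or_gt_of_ne hij with h | h
    · exact hb i j h
    · exact (hb j i h).symm
  · by_contra hl
    refine (hX i).2.2.2 ?_
    rw [← Set.mem_singleton_iff.1 (h0 i), ← Set.mem_singleton_iff.1 (h1 i)]
    congr 1; omega
  · have := (hu i).isPathFromTo
    rwa [Set.mem_singleton_iff.1 (h0 i), Set.mem_singleton_iff.1 (h1 i)] at this
  · have key : ∀ i j, i ≠ j → Disjoint (X i) (X j) ∧
        ∀ x ∈ X i, ∀ y ∈ X j, G.Adj x y → (x = a i ∧ y = a j) ∨ (x = b i ∧ y = b j) := by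
      intro i j hij
      rcases lt_or_gt_of_ne hij with h | h
      · exact hXX i j h
      · exact ⟨(hXX j i h).1.symm, fun x hx y hy hxy =>
          ((hXX j i h).2 y hy x hx hxy.symm).imp And.symm And.symm⟩
    intro i j hij
    exact ⟨(key i j hij).1.mono (hsub i) (hsub j),
      fun x hx y hy => (key i j hij).2 x (hsub i hx) y (hsub j hy)⟩

/-! Unbundled versions for three explicitly given sets. -/

theorem containsTheta_of_three {G : SimpleGraph V} {a b : V} {X Y Z : Set V} (hab : a ≠ b)
    (hnadj : ¬ G.Adj a b)
    (hX : Conn G X ∧ a ∉ X ∧ b ∉ X ∧ Sees G a X ∧ Sees G b X)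
    (hY : Conn G Y ∧ a ∉ Y ∧ b ∉ Y ∧ Sees G a Y ∧ Sees G b Y)
    (hZ : Conn G Z ∧ a ∉ Z ∧ b ∉ Z ∧ Sees G a Z ∧ Sees G b Z)
    (hXY : ∀ x ∈ X, ∀ y ∈ Y, x ≠ y ∧ ¬ G.Adj x y)
    (hXZ : ∀ x ∈ X, ∀ y ∈ Z, x ≠ y ∧ ¬ G.Adj x y)
    (hYZ : ∀ x ∈ Y, ∀ y ∈ Z, x ≠ y ∧ ¬ G.Adj x y) : ContainsTheta G := by
  refine containsTheta_of_conn (X := ![X, Y, Z]) hab hnadj ?_ ?_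
  · intro i; fin_cases i
    exacts [hX, hY, hZ]
  · intro i j hij
    refine ⟨Set.disjoint_left.2 fun x hx hx' => ?_, fun x hx y hy => ?_⟩ <;>
      fin_cases i <;> fin_cases j <;> first | (exact absurd hij (by decide)) | skip
    exacts [(hXY _ hx _ hx').1 rfl, (hXZ _ hx _ hx').1 rfl, (hYZ _ hx _ hx').1 rfl,
      (hXY _ hx _ hy).2, (hXZ _ hx _ hy).2, (hYZ _ hx _ hy).2]

theorem containsPyramid_of_three {G : SimpleGraph V} {a b c d : V} {X Y Z : Set V}
    (hbc : G.Adj b c) (hbd : G.Adj b d) (hcd : G.Adj c d)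
    (hX : Conn G X ∧ a ∉ X ∧ b ∈ X ∧ Sees G a X)
    (hY : Conn G Y ∧ a ∉ Y ∧ c ∈ Y ∧ Sees G a Y)
    (hZ : Conn G Z ∧ a ∉ Z ∧ d ∈ Z ∧ Sees G a Z)
    (h1 : ¬ (G.Adj a b ∧ G.Adj a c)) (h2 : ¬ (G.Adj a b ∧ G.Adj a d))
    (h3 : ¬ (G.Adj a c ∧ G.Adj a d))
    (hXY : ∀ x ∈ X, ∀ y ∈ Y, x ≠ y ∧ (G.Adj x y → x = b ∧ y = c))
    (hXZ : ∀ x ∈ X, ∀ y ∈ Z, x ≠ y ∧ (G.Adj x y → x = b ∧ y = d))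
    (hYZ : ∀ x ∈ Y, ∀ y ∈ Z, x ≠ y ∧ (G.Adj x y → x = c ∧ y = d)) : ContainsPyramid G := by
  refine containsPyramid_of_conn (X := ![X, Y, Z]) (a := a) (b := ![b, c, d]) ?_ ?_ ?_ ?_
  · intro i j hij
    fin_cases i <;> fin_cases j <;> first | (exact absurd hij (by decide)) | skip
    exacts [hbc, hbd, hcd]
  · intro i; fin_cases i
    exacts [hX, hY, hZ]
  · intro i j hij
    fin_cases i <;> fin_cases j <;> first | (exact absurd hij (by decide)) | skip
    exacts [h1, h2, h3]
  · intro i j hij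
    refine ⟨Set.disjoint_left.2 fun x hx hx' => ?_, fun x hx y hy => ?_⟩ <;>
      fin_cases i <;> fin_cases j <;> first | (exact absurd hij (by decide)) | skip
    exacts [(hXY _ hx _ hx').1 rfl, (hXZ _ hx _ hx').1 rfl, (hYZ _ hx _ hx').1 rfl,
      (hXY _ hx _ hy).2, (hXZ _ hx _ hy).2, (hYZ _ hx _ hy).2]

theorem containsPrism_of_three {G : SimpleGraph V} {a a' a'' b b' b'' : V} {X Y Z : Set V}
    (ha1 : G.Adj a a') (ha2 : G.Adj a a'') (ha3 : G.Adj a' a'')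
    (hb1 : G.Adj b b') (hb2 : G.Adj b b'') (hb3 : G.Adj b' b'')
    (hX : Conn G X ∧ a ∈ X ∧ b ∈ X ∧ a ≠ b)
    (hY : Conn G Y ∧ a' ∈ Y ∧ b' ∈ Y ∧ a' ≠ b')
    (hZ : Conn G Z ∧ a'' ∈ Z ∧ b'' ∈ Z ∧ a'' ≠ b'')
    (hXY : ∀ x ∈ X, ∀ y ∈ Y, x ≠ y ∧ (G.Adj x y → (x = a ∧ y = a') ∨ (x = b ∧ y = b')))
    (hXZ : ∀ x ∈ X, ∀ y ∈ Z, x ≠ y ∧ (G.Adj x y → (x = a ∧ y = a'') ∨ (x = b ∧ y = b'')))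
    (hYZ : ∀ x ∈ Y, ∀ y ∈ Z, x ≠ y ∧ (G.Adj x y → (x = a' ∧ y = a'') ∨ (x = b' ∧ y = b''))) :
    ContainsPrism G := by
  refine containsPrism_of_conn (X := ![X, Y, Z]) (a := ![a, a', a'']) (b := ![b, b', b''])
    ?_ ?_ ?_ ?_
  · intro i j hij
    fin_cases i <;> fin_cases j <;> first | (exact absurd hij (by decide)) | skip
    exacts [ha1, ha2, ha3]
  · intro i j hij
    fin_cases i <;> fin_cases j <;> first | (exact absurd hij (by decide)) | skip
    exacts [hb1, hb2, hb3]
  · intro i; fin_cases i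
    exacts [hX, hY, hZ]
  · intro i j hij
    refine ⟨Set.disjoint_left.2 fun x hx hx' => ?_, fun x hx y hy => ?_⟩ <;>
      fin_cases i <;> fin_cases j <;> first | (exact absurd hij (by decide)) | skip
    exacts [(hXY _ hx _ hx').1 rfl, (hXZ _ hx _ hx').1 rfl, (hYZ _ hx _ hx').1 rfl,
      (hXY _ hx _ hy).2, (hXZ _ hx _ hy).2, (hYZ _ hx _ hy).2]

end

section

variable {V : Type*}

/-! ### Attaching a connected set to a hole through a vertex -/

theorem exists_min_max {p : ℕ → Prop} {n : ℕ} (h : ∃ t ≤ n, p t) :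
    ∃ i j, i ≤ j ∧ j ≤ n ∧ p i ∧ p j ∧ ∀ t ≤ n, p t → i ≤ t ∧ t ≤ j := by
  classical
  obtain ⟨t, ht, hpt⟩ := h
  refine ⟨Nat.find ⟨t, hpt⟩, Nat.findGreatest p n, ?_, Nat.findGreatest_le _, Nat.find_spec _,
    Nat.findGreatest_spec ht hpt, fun s hs hps => ⟨Nat.find_min' _ hps,
      Nat.le_findGreatest hs hps⟩⟩
  exact (Nat.find_min' ⟨t, hpt⟩ hpt).trans (Nat.le_findGreatest ht hpt)

/-- The hole `v, g 0, …, g n` together with a connection from `v` to a vertex `q` that avoids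
the neighbourhood of the path `g`: then `q` sees at most one of the vertices of `g`, and only an
end. -/
theorem not_adj_of_connection {G : SimpleGraph V} (hT : ¬ ContainsTheta G)
    (hP : ¬ ContainsPyramid G) {v q : V} {g : ℕ → V} {n : ℕ} {K : Set V} (hg : IndPath G g n)
    (hn : 2 ≤ n) (hvg : ∀ i ≤ n, v ≠ g i) (hv : ∀ i ≤ n, (G.Adj v (g i) ↔ i = 0 ∨ i = n))
    (hK : Conn G K) (hvK : v ∉ K) (hKg : ∀ x ∈ K, ∀ i ≤ n, x ≠ g i ∧ ¬ G.Adj x (g i))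
    (hKv : Sees G v K) (hqK : q ∉ K) (hqs : Sees G q K) (hqv : q ≠ v) (hqnv : ¬ G.Adj q v)
    (hqg : ∀ i ≤ n, q ≠ g i) :
    (∀ i, 0 < i → i < n → ¬ G.Adj q (g i)) ∧ ¬ (G.Adj q (g 0) ∧ G.Adj q (g n)) := by
  by_cases hex : ∃ t ≤ n, G.Adj q (g t)
  swap
  · exact ⟨fun i _ hi h => hex ⟨i, hi.le, h⟩, fun h => hex ⟨0, by omega, h.1⟩⟩
  obtain ⟨i, j, hij, hjn, hi, hj, hmm⟩ := exists_min_max hex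
  by_cases hend : i = j ∧ (i = 0 ∨ i = n)
  · refine ⟨fun t h1 h2 h3 => ?_, fun h => ?_⟩
    · have := hmm t h2.le h3; omega
    · have h1 := hmm 0 (by omega) h.1
      have h2 := hmm n le_rfl h.2
      omega
  exfalso
  have hcX : Conn G (g '' Set.Icc 0 i) := hg.conn_seg (by omega) (by omega)
  have hcY : Conn G (g '' Set.Icc j n) := hg.conn_seg (by omega) (by omega)
  have hv0 : G.Adj v (g 0) := (hv 0 (by omega)).2 (Or.inl rfl)
  have hvn : G.Adj v (g n) := (hv n (by omega)).2 (Or.inr rfl)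
  have hcq : Conn G (insert q K) := hK.insert_of_sees hqs
  -- Here `g i` and `g j` are the first and last neighbours of `q` on `g`. If they are distinct and
  -- non-consecutive, there is a theta from `v` to `q` through the two ends of `g` and through `K`.
  -- If they are consecutive, there is a pyramid with apex `v` and triangle `g i`, `g j`, `q`. If
  -- they coincide, at an interior vertex, there is a theta from `v` to `g i`.
  rcases Nat.lt_trichotomy (i + 1) j with h | h | h
  · refine hT (containsTheta_of_three (a := v) (b := q) (X := g '' Set.Icc 0 i)
      (Y := g '' Set.Icc j n) (Z := K) hqv.symm (fun h => hqnv h.symm)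
      ⟨hcX, ?_, ?_, ⟨_, ⟨0, ⟨le_rfl, by omega⟩, rfl⟩, hv0⟩, ⟨_, ⟨i, ⟨by omega, le_rfl⟩, rfl⟩, hi⟩⟩
      ⟨hcY, ?_, ?_, ⟨_, ⟨n, ⟨by omega, le_rfl⟩, rfl⟩, hvn⟩, ⟨_, ⟨j, ⟨le_rfl, by omega⟩, rfl⟩, hj⟩⟩
      ⟨hK, hvK, hqK, hKv, hqs⟩ ?_ ?_ ?_)
    · rintro ⟨t, ht, h⟩; exact hvg t (by have := ht.2; omega) h.symm
    · rintro ⟨t, ht, h⟩; exact hqg t (by have := ht.2; omega) h.symm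
    · rintro ⟨t, ht, h⟩; exact hvg t ht.2 h.symm
    · rintro ⟨t, ht, h⟩; exact hqg t ht.2 h.symm
    · rintro _ ⟨t, ⟨-, ht⟩, rfl⟩ _ ⟨s, ⟨hs, hs'⟩, rfl⟩
      have := hg t (by omega) s (by omega)
      exact ⟨fun h => by have := this.1 h; omega, fun h => by have := this.2.1 h; omega⟩
    · rintro _ ⟨t, ⟨-, ht⟩, rfl⟩ y hy
      have := hKg y hy t (by omega)
      exact ⟨this.1.symm, fun h => this.2 h.symm⟩
    · rintro _ ⟨t, ⟨-, ht⟩, rfl⟩ y hy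
      have := hKg y hy t (by omega)
      exact ⟨this.1.symm, fun h => this.2 h.symm⟩
  · subst h
    have hcross : ∀ t ≤ n, (t ≤ i ∨ i + 1 ≤ t) → ∀ y ∈ insert q K,
        g t ≠ y ∧ (G.Adj (g t) y → (t = i ∨ t = i + 1) ∧ y = q) := by
      rintro t ht - y (rfl | hy)
      · exact ⟨(hqg t ht).symm, fun h => ⟨by have := hmm t ht h.symm; omega, rfl⟩⟩
      · have := hKg y hy t ht
        exact ⟨this.1.symm, fun h => absurd h.symm this.2⟩
    refine hP (containsPyramid_of_three (a := v) (b := g i) (c := g (i + 1)) (d := q)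
      (X := g '' Set.Icc 0 i) (Y := g '' Set.Icc (i + 1) n) (Z := insert q K)
      ((hg i (by omega) (i + 1) (by omega)).2.2 (Or.inl rfl)) hi.symm hj.symm
      ⟨hcX, ?_, ⟨i, ⟨by omega, le_rfl⟩, rfl⟩, ⟨_, ⟨0, ⟨le_rfl, by omega⟩, rfl⟩, hv0⟩⟩
      ⟨hcY, ?_, ⟨i + 1, ⟨le_rfl, by omega⟩, rfl⟩, ⟨_, ⟨n, ⟨by omega, le_rfl⟩, rfl⟩, hvn⟩⟩
      ⟨hcq, ?_, Set.mem_insert _ _, hKv.mono (Set.subset_insert _ _)⟩ ?_ ?_ ?_ ?_ ?_ ?_)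
    · rintro ⟨t, ht, h⟩; exact hvg t (by have := ht.2; omega) h.symm
    · rintro ⟨t, ht, h⟩; exact hvg t ht.2 h.symm
    · rintro (h | h)
      · exact hqv h.symm
      · exact hvK h
    · rintro ⟨h1, h2⟩
      have h1 := (hv i (by omega)).1 h1
      have h2 := (hv (i + 1) (by omega)).1 h2
      omega
    · exact fun h => hqnv h.2.symm
    · exact fun h => hqnv h.2.symm
    · rintro _ ⟨t, ⟨-, ht⟩, rfl⟩ _ ⟨s, ⟨hs, hs'⟩, rfl⟩
      have := hg t (by omega) s (by omega)
      refine ⟨fun h => by have := this.1 h; omega, fun h => ?_⟩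
      have := this.2.1 h
      constructor <;> congr 1 <;> omega
    · rintro _ ⟨t, ⟨-, ht⟩, rfl⟩ y hy
      have := hcross t (by omega) (by omega) y hy
      refine ⟨this.1, fun h => ?_⟩
      obtain ⟨h1, rfl⟩ := this.2 h
      exact ⟨by congr 1; omega, rfl⟩
    · rintro _ ⟨t, ⟨ht', ht⟩, rfl⟩ y hy
      have := hcross t (by omega) (by omega) y hy
      refine ⟨this.1, fun h => ?_⟩
      obtain ⟨h1, rfl⟩ := this.2 h
      exact ⟨by congr 1; omega, rfl⟩
  · obtain rfl : i = j := by omega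
    have hcross : ∀ t ≤ n, t ≠ i → ∀ y ∈ insert q K, g t ≠ y ∧ ¬ G.Adj (g t) y := by
      rintro t ht hti y (rfl | hy)
      · exact ⟨(hqg t ht).symm, fun h => by have := hmm t ht h.symm; omega⟩
      · have := hKg y hy t ht
        exact ⟨this.1.symm, fun h => this.2 h.symm⟩
    have hadj1 : G.Adj (g i) (g (i - 1)) :=
      (hg i (by omega) (i - 1) (by omega)).2.2 (Or.inr (by omega))
    have hadj2 : G.Adj (g i) (g (i + 1)) :=
      (hg i (by omega) (i + 1) (by omega)).2.2 (Or.inl (by omega))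
    refine hT (containsTheta_of_three (a := v) (b := g i) (X := g '' Set.Icc 0 (i - 1))
      (Y := g '' Set.Icc (i + 1) n) (Z := insert q K) (hvg i hjn)
      (fun h => by have := (hv i hjn).1 h; omega)
      ⟨hg.conn_seg (by omega) (by omega), ?_, ?_, ⟨_, ⟨0, ⟨le_rfl, by omega⟩, rfl⟩, hv0⟩,
        ⟨_, ⟨i - 1, ⟨by omega, le_rfl⟩, rfl⟩, hadj1⟩⟩
      ⟨hg.conn_seg (by omega) (by omega), ?_, ?_, ⟨_, ⟨n, ⟨by omega, le_rfl⟩, rfl⟩, hvn⟩,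
        ⟨_, ⟨i + 1, ⟨le_rfl, by omega⟩, rfl⟩, hadj2⟩⟩
      ⟨hcq, ?_, ?_, hKv.mono (Set.subset_insert _ _), ⟨q, Set.mem_insert _ _, hi.symm⟩⟩ ?_ ?_ ?_)
    · rintro ⟨t, ht, h⟩; exact hvg t (by have := ht.2; omega) h.symm
    · rintro ⟨t, ht, h⟩
      have := (hg t (by have := ht.2; omega) i hjn).1 h
      have := ht.2; omega
    · rintro ⟨t, ht, h⟩; exact hvg t ht.2 h.symm
    · rintro ⟨t, ht, h⟩
      have := (hg t ht.2 i hjn).1 h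
      have := ht.1; omega
    · rintro (h | h)
      · exact hqv h.symm
      · exact hvK h
    · rintro (h | h)
      · exact hqg i hjn h.symm
      · exact (hKg _ h i hjn).1 rfl
    · rintro _ ⟨t, ⟨-, ht⟩, rfl⟩ _ ⟨s, ⟨hs, hs'⟩, rfl⟩
      have := hg t (by omega) s (by omega)
      exact ⟨fun h => by have := this.1 h; omega, fun h => by have := this.2.1 h; omega⟩
    · rintro _ ⟨t, ⟨-, ht⟩, rfl⟩ y hy
      exact hcross t (by omega) (by omega) y hy
    · rintro _ ⟨t, ⟨ht', ht⟩, rfl⟩ y hy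
      exact hcross t (by omega) (by omega) y hy

/-- The hole `v, g 0, …, g n` together with a connection `K` to a vertex `q` that starts in a
common neighbour `s` of `v` and `g 0`: then `q` sees no vertex of `g` unless it sees `g 0`. -/
theorem not_adj_of_edge_connection {G : SimpleGraph V} (hP : ¬ ContainsPyramid G)
    (hR : ¬ ContainsPrism G) {v q s : V} {g : ℕ → V} {n : ℕ} {K : Set V} (hg : IndPath G g n)
    (hn : 2 ≤ n) (hvg : ∀ i ≤ n, v ≠ g i) (hv : ∀ i ≤ n, (G.Adj v (g i) ↔ i = 0 ∨ i = n))
    (hK : Conn G K) (hvK : v ∉ K) (hsK : s ∈ K) (hsv : G.Adj v s) (hs0 : G.Adj (g 0) s)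
    (hKg : ∀ x ∈ K, ∀ i ≤ n, x ≠ g i ∧ (G.Adj x (g i) → x = s ∧ i = 0))
    (hKv : ∀ x ∈ K, G.Adj v x → x = s) (hqK : q ∉ K) (hqs : Sees G q K) (hqv : q ≠ v)
    (hqnv : ¬ G.Adj q v) (hqg : ∀ i ≤ n, q ≠ g i) (hq0 : ¬ G.Adj q (g 0)) :
    ∀ i ≤ n, ¬ G.Adj q (g i) := by
  by_contra! hex
  obtain ⟨i, j, hij, hjn, hi, hj, hmm⟩ := exists_min_max hex
  have hi0 : i ≠ 0 := by rintro rfl; exact hq0 hi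
  have hv0 : G.Adj v (g 0) := (hv 0 (by omega)).2 (Or.inl rfl)
  have hvn : G.Adj v (g n) := (hv n (by omega)).2 (Or.inr rfl)
  have hcq : Conn G (insert q K) := hK.insert_of_sees hqs
  have hcvY : ∀ t ≤ n, Conn G (insert v (g '' Set.Icc t n)) := fun t ht =>
    (hg.conn_seg ht le_rfl).insert_of_sees ⟨_, ⟨n, ⟨ht, le_rfl⟩, rfl⟩, hvn⟩
  have hvX : ∀ t ≤ n, ∀ r ≤ n, t < r → r ≠ t + 1 → ∀ x ∈ g '' Set.Icc 0 t,
      ∀ y ∈ insert v (g '' Set.Icc r n), x ≠ y ∧ (G.Adj x y → x = g 0 ∧ y = v) := by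
    rintro t ht r hr htr htr' _ ⟨a, ⟨-, ha⟩, rfl⟩ y (rfl | ⟨b, ⟨hb, hb'⟩, rfl⟩)
    · refine ⟨(hvg a (by omega)).symm, fun h => ⟨?_, rfl⟩⟩
      have := (hv a (by omega)).1 h.symm
      congr 1; omega
    · have := hg a (by omega) b (by omega)
      exact ⟨fun h => by have := this.1 h; omega, fun h => by have := this.2.1 h; omega⟩
  -- The triangle `g 0`, `v`, `s` is always present. With first and last neighbours `g i` and `g j`
  -- of `q`, it is the base of a pyramid with apex `q` if they are far apart, it forms a prism with
  -- the triangle `g i`, `g j`, `q` if they are consecutive, and it is the base of a pyramid with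
  -- apex `g i` if they coincide.
  rcases Nat.lt_trichotomy (i + 1) j with h | h | h
  · refine hP (containsPyramid_of_three (a := q) (b := g 0) (c := v) (d := s)
      (X := g '' Set.Icc 0 i) (Y := insert v (g '' Set.Icc j n)) (Z := K) hv0.symm hs0 hsv
      ⟨hg.conn_seg (by omega) (by omega), ?_, ⟨0, ⟨le_rfl, by omega⟩, rfl⟩,
        ⟨_, ⟨i, ⟨by omega, le_rfl⟩, rfl⟩, hi⟩⟩
      ⟨hcvY j hjn, ?_, Set.mem_insert _ _, ⟨_, Or.inr ⟨j, ⟨le_rfl, by omega⟩, rfl⟩, hj⟩⟩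
      ⟨hK, hqK, hsK, hqs⟩ (fun h => hq0 h.1) (fun h => hq0 h.1) (fun h => hqnv h.1) ?_ ?_ ?_)
    · rintro ⟨t, ht, h⟩; exact hqg t (by have := ht.2; omega) h.symm
    · rintro (h | ⟨t, ht, h⟩)
      · exact hqv h
      · exact hqg t ht.2 h.symm
    · exact hvX i (by omega) j hjn (by omega) (by omega)
    · rintro _ ⟨t, ⟨-, ht⟩, rfl⟩ y hy
      have := hKg y hy t (by omega)
      refine ⟨this.1.symm, fun h => ?_⟩
      obtain ⟨h1, rfl⟩ := this.2 h.symm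
      exact ⟨rfl, h1⟩
    · rintro x (rfl | ⟨t, ⟨ht', ht⟩, rfl⟩) y hy
      · exact ⟨fun h => hvK (h ▸ hy), fun h => ⟨rfl, hKv y hy h⟩⟩
      · have := hKg y hy t (by omega)
        exact ⟨this.1.symm, fun h => by have := (this.2 h.symm).2; omega⟩
  · subst h
    refine hR (containsPrism_of_three (a := g 0) (a' := v) (a'' := s) (b := g i)
      (b' := g (i + 1)) (b'' := q) (X := g '' Set.Icc 0 i)
      (Y := insert v (g '' Set.Icc (i + 1) n)) (Z := insert q K) hv0.symm hs0 hsv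
      ((hg i (by omega) (i + 1) (by omega)).2.2 (Or.inl rfl)) hi.symm hj.symm
      ⟨hg.conn_seg (by omega) (by omega), ⟨0, ⟨le_rfl, by omega⟩, rfl⟩,
        ⟨i, ⟨by omega, le_rfl⟩, rfl⟩, ?_⟩
      ⟨hcvY _ hjn, Set.mem_insert _ _, Or.inr ⟨i + 1, ⟨le_rfl, by omega⟩, rfl⟩, hvg _ hjn⟩
      ⟨hcq, Or.inr hsK, Set.mem_insert _ _, ?_⟩ ?_ ?_ ?_)
    · intro h; exact hi0 ((hg 0 (by omega) i (by omega)).1 h).symm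
    · rintro rfl; exact hqK hsK
    · rintro _ ⟨a, ⟨-, ha⟩, rfl⟩ y (rfl | ⟨b, ⟨hb, hb'⟩, rfl⟩)
      · refine ⟨(hvg a (by omega)).symm, fun h => Or.inl ⟨?_, rfl⟩⟩
        have := (hv a (by omega)).1 h.symm
        congr 1; omega
      · have := hg a (by omega) b (by omega)
        refine ⟨fun h => by have := this.1 h; omega, fun h => Or.inr ?_⟩
        have := this.2.1 h
        constructor <;> congr 1 <;> omega
    · rintro _ ⟨t, ⟨-, ht⟩, rfl⟩ y (rfl | hy)
      · refine ⟨(hqg t (by omega)).symm, fun h => Or.inr ⟨?_, rfl⟩⟩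
        have := hmm t (by omega) h.symm
        congr 1; omega
      · have := hKg y hy t (by omega)
        refine ⟨this.1.symm, fun h => Or.inl ?_⟩
        obtain ⟨h1, rfl⟩ := this.2 h.symm
        exact ⟨rfl, h1⟩
    · rintro x (rfl | ⟨t, ⟨ht', ht⟩, rfl⟩) y (rfl | hy)
      · exact ⟨hqv.symm, fun h => absurd h.symm hqnv⟩
      · exact ⟨fun h => hvK (h ▸ hy), fun h => Or.inl ⟨rfl, hKv y hy h⟩⟩
      · refine ⟨(hqg t (by omega)).symm, fun h => Or.inr ⟨?_, rfl⟩⟩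
        have := hmm t (by omega) h.symm
        congr 1; omega
      · have := hKg y hy t (by omega)
        exact ⟨this.1.symm, fun h => by have := (this.2 h.symm).2; omega⟩
  · obtain rfl : i = j := by omega
    have hadj1 : G.Adj (g i) (g (i - 1)) :=
      (hg i (by omega) (i - 1) (by omega)).2.2 (Or.inr (by omega))
    -- The half-open interval also covers `i = n`, where the path of the pyramid from `g n` to `v`
    -- is a single edge.
    have hY : Conn G (insert v (g '' Set.Ioc i n)) ∧ Sees G (g i) (insert v (g '' Set.Ioc i n)) := by
      rcases Nat.lt_or_ge i n with h1 | h1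
      · have : Set.Ioc i n = Set.Icc (i + 1) n := by ext; simp
        rw [this]
        exact ⟨hcvY _ h1, _, Or.inr ⟨i + 1, ⟨le_rfl, h1⟩, rfl⟩,
          (hg i (by omega) (i + 1) (by omega)).2.2 (Or.inl (by omega))⟩
      · obtain rfl : i = n := by omega
        simp only [Set.Ioc_self, Set.image_empty, insert_empty_eq]
        exact ⟨conn_singleton G v, v, rfl, hvn.symm⟩
    refine hP (containsPyramid_of_three (a := g i) (b := g 0) (c := v) (d := s)
      (X := g '' Set.Icc 0 (i - 1)) (Y := insert v (g '' Set.Ioc i n)) (Z := insert q K)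
      hv0.symm hs0 hsv
      ⟨hg.conn_seg (by omega) (by omega), ?_, ⟨0, ⟨le_rfl, by omega⟩, rfl⟩,
        ⟨_, ⟨i - 1, ⟨by omega, le_rfl⟩, rfl⟩, hadj1⟩⟩
      ⟨hY.1, ?_, Set.mem_insert _ _, hY.2⟩
      ⟨hcq, ?_, Or.inr hsK, ⟨q, Set.mem_insert _ _, hi.symm⟩⟩ ?_ ?_ ?_ ?_ ?_ ?_)
    · rintro ⟨t, ht, h⟩
      have := (hg t (by have := ht.2; omega) i hjn).1 h
      have := ht.2; omega
    · rintro (h | ⟨t, ht, h⟩)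
      · exact hvg i hjn h.symm
      · have := (hg t ht.2 i hjn).1 h
        have := ht.1; omega
    · rintro (h | h)
      · exact hqg i hjn h.symm
      · exact (hKg _ h i hjn).1 rfl
    · rintro ⟨h1, h2⟩
      have h1 := (hg i hjn 0 (by omega)).2.1 h1
      have h2 := (hv i hjn).1 h2.symm
      omega
    · rintro ⟨h1, h2⟩
      exact hi0 ((hKg s hsK i hjn).2 h2.symm).2
    · rintro ⟨h1, h2⟩
      exact hi0 ((hKg s hsK i hjn).2 h2.symm).2
    · rintro _ ⟨a, ⟨-, ha⟩, rfl⟩ y (rfl | ⟨b, ⟨hb, hb'⟩, rfl⟩)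
      · refine ⟨(hvg a (by omega)).symm, fun h => ⟨?_, rfl⟩⟩
        have := (hv a (by omega)).1 h.symm
        congr 1; omega
      · have := hg a (by omega) b (by omega)
        exact ⟨fun h => by have := this.1 h; omega, fun h => by have := this.2.1 h; omega⟩
    · rintro _ ⟨t, ⟨-, ht⟩, rfl⟩ y (rfl | hy)
      · exact ⟨(hqg t (by omega)).symm, fun h => by have := hmm t (by omega) h.symm; omega⟩
      · have := hKg y hy t (by omega)
        refine ⟨this.1.symm, fun h => ?_⟩
        obtain ⟨h1, rfl⟩ := this.2 h.symm
        exact ⟨rfl, h1⟩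
    · rintro x (rfl | ⟨t, ⟨ht', ht⟩, rfl⟩) y (rfl | hy)
      · exact ⟨hqv.symm, fun h => absurd h.symm hqnv⟩
      · exact ⟨fun h => hvK (h ▸ hy), fun h => ⟨rfl, hKv y hy h⟩⟩
      · exact ⟨(hqg t (by omega)).symm, fun h => by have := hmm t (by omega) h.symm; omega⟩
      · have := hKg y hy t (by omega)
        exact ⟨this.1.symm, fun h => by have := (this.2 h.symm).2; omega⟩

end

section

variable {V : Type*}

/-! ### Holes as periodic sequences -/

/-- `c` is an `n`-periodic parametrisation of a hole of length `n`. -/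
def IndCycle (G : SimpleGraph V) (c : ℤ → V) (n : ℤ) : Prop :=
  4 ≤ n ∧ (∀ i j, c i = c j ↔ n ∣ j - i) ∧
    ∀ i j, G.Adj (c i) (c j) ↔ n ∣ j - i - 1 ∨ n ∣ i - j - 1

theorem eq_zero_of_dvd_of_lt {n x : ℤ} (h : n ∣ x) (h1 : -n < x) (h2 : x < n) : x = 0 :=
  Int.eq_zero_of_abs_lt_dvd h (abs_lt.2 ⟨h1, h2⟩)

theorem dvd_emod_sub_iff (n i j k : ℤ) : n ∣ j % n - i % n - k ↔ n ∣ j - i - k := by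
  have h : j - i - k = (j % n - i % n - k) + n * (j / n - i / n) := by
    have h1 := Int.emod_add_mul_ediv j n
    have h2 := Int.emod_add_mul_ediv i n
    linear_combination -h1 + h2
  rw [h]
  exact (Int.dvd_add_left (Dvd.intro _ rfl)).symm

theorem IndCycle.shift {G : SimpleGraph V} {c : ℤ → V} {n : ℤ} (hc : IndCycle G c n) (r : ℤ) :
    IndCycle G (fun t => c (r + t)) n := by
  refine ⟨hc.1, fun i j => ?_, fun i j => ?_⟩
  · rw [hc.2.1]; ring_nf
  · rw [hc.2.2]; ring_nf

theorem IndCycle.neg {G : SimpleGraph V} {c : ℤ → V} {n : ℤ} (hc : IndCycle G c n) :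
    IndCycle G (fun t => c (-t)) n := by
  refine ⟨hc.1, fun i j => ?_, fun i j => ?_⟩
  · rw [hc.2.1, ← dvd_neg]; ring_nf
  · rw [hc.2.2, or_comm]; ring_nf

theorem IndCycle.add_period {G : SimpleGraph V} {c : ℤ → V} {n : ℤ} (hc : IndCycle G c n)
    (i : ℤ) : c (i + n) = c i :=
  (hc.2.1 _ _).2 ⟨-1, by ring⟩

theorem IndCycle.adj_succ {G : SimpleGraph V} {c : ℤ → V} {n : ℤ} (hc : IndCycle G c n)
    (i : ℤ) : G.Adj (c i) (c (i + 1)) :=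
  (hc.2.2 _ _).2 (Or.inl ⟨0, by ring⟩)

theorem IndCycle.eq_of_lt {G : SimpleGraph V} {c : ℤ → V} {n : ℤ} (hc : IndCycle G c n)
    {i j : ℤ} (h : c i = c j) (h1 : i < j + n) (h2 : j < i + n) : i = j := by
  have := eq_zero_of_dvd_of_lt ((hc.2.1 _ _).1 h) (by omega) (by omega)
  omega

/-- For indices less than one period apart, divisibility leaves only consecutive indices and the
wrap-around pair, in either order. This makes later adjacency questions on a hole linear arithmetic.
-/
theorem IndCycle.adj_of_lt {G : SimpleGraph V} {c : ℤ → V} {n : ℤ} (hc : IndCycle G c n)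
    {i j : ℤ} (h : G.Adj (c i) (c j)) (h1 : i < j + n) (h2 : j < i + n) :
    j = i + 1 ∨ i = j + 1 ∨ j + 1 = i + n ∨ i + 1 = j + n := by
  have h4 := hc.1
  rcases (hc.2.2 _ _).1 h with h | h
  · by_cases h3 : j - i - 1 = -n
    · omega
    · have := eq_zero_of_dvd_of_lt h (by omega) (by omega)
      omega
  · by_cases h3 : i - j - 1 = -n
    · omega
    · have := eq_zero_of_dvd_of_lt h (by omega) (by omega)
      omega

theorem IndCycle.exists_rep {G : SimpleGraph V} {c : ℤ → V} {n : ℤ} (hc : IndCycle G c n)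
    (i a : ℤ) : ∃ j, a ≤ j ∧ j < a + n ∧ c j = c i := by
  have h4 := hc.1
  refine ⟨a + (i - a) % n, ?_, ?_, ?_⟩
  · have := Int.emod_nonneg (i - a) (b := n) (by omega); omega
  · have := Int.emod_lt_of_pos (i - a) (b := n) (by omega); omega
  · rw [hc.2.1]
    refine ⟨(i - a) / n, ?_⟩
    have := Int.emod_add_mul_ediv (i - a) n
    linear_combination -this

theorem IndCycle.conn {G : SimpleGraph V} {c : ℤ → V} {n : ℤ} (hc : IndCycle G c n) {i j : ℤ}
    (hij : i ≤ j) : Conn G (c '' Set.Icc i j) :=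
  conn_image_Icc c hij fun t _ _ => hc.adj_succ t

theorem IndCycle.indPath {G : SimpleGraph V} {c : ℤ → V} {n : ℤ} (hc : IndCycle G c n) (i : ℤ)
    {l : ℕ} (hl : (l : ℤ) + 2 ≤ n) : IndPath G (fun t => c (i + t)) l := by
  intro a ha b hb
  constructor
  · intro h
    have := hc.eq_of_lt h (by omega) (by omega)
    omega
  · constructor
    · intro h
      have := hc.adj_of_lt h (by omega) (by omega)
      omega
    · rintro (rfl | rfl)
      · have := hc.adj_succ (i + a)
        push_cast; rwa [← add_assoc]
      · have := hc.adj_succ (i + b)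
        push_cast; rw [← add_assoc]; exact this.symm

/-- By symmetry and reduction modulo `N`, only pairs `a < b` within one period need checking; the
closing edge of the cycle is the pair `0`, `N - 1`. -/
theorem indCycle_of_nat {G : SimpleGraph V} {F : ℕ → V} {N : ℕ} (hN : 4 ≤ N)
    (hne : ∀ a b, a < b → b < N → F a ≠ F b)
    (hadj : ∀ a b, a < b → b < N → (G.Adj (F a) (F b) ↔ b = a + 1 ∨ (a = 0 ∧ b + 1 = N))) :
    IndCycle G (fun t => F (t % N).toNat) N := by
  have hpos : (N : ℤ) ≠ 0 := by omega
  have hmod : ∀ i : ℤ, 0 ≤ i % N ∧ i % N < N := fun i =>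
    ⟨Int.emod_nonneg i hpos, Int.emod_lt_of_pos i (by omega)⟩
  refine ⟨by omega, fun i j => ?_, fun i j => ?_⟩
  · have h1 := hmod i
    have h2 := hmod j
    have h3 := dvd_emod_sub_iff N i j 0
    simp only [sub_zero] at h3
    rw [← h3]
    constructor
    · intro h
      rcases lt_trichotomy (i % N) (j % N) with h4 | h4 | h4
      · exact absurd h (hne _ _ (by omega) (by omega))
      · rw [h4]; simp
      · exact absurd h.symm (hne _ _ (by omega) (by omega))
    · intro h
      have := eq_zero_of_dvd_of_lt h (by omega) (by omega)
      have h5 : i % N = j % N := by omega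
      simp only [h5]
  · have h1 := hmod i
    have h2 := hmod j
    rw [← dvd_emod_sub_iff N i j 1, ← dvd_emod_sub_iff N j i 1]
    have key : ∀ a b : ℤ, 0 ≤ a → a < N → 0 ≤ b → b < N →
        ((N : ℤ) ∣ b - a - 1 ↔ b = a + 1 ∨ (a + 1 = N ∧ b = 0)) := by
      intro a b ha ha' hb hb'
      constructor
      · intro h
        by_cases h5 : b - a - 1 = -N
        · omega
        · have := eq_zero_of_dvd_of_lt h (by omega) (by omega)
          omega
      · rintro (rfl | ⟨h, rfl⟩)
        · simp
        · exact ⟨-1, by omega⟩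
    rw [key _ _ h1.1 h1.2 h2.1 h2.2, key _ _ h2.1 h2.2 h1.1 h1.2]
    rcases lt_trichotomy (i % N) (j % N) with h4 | h4 | h4
    · rw [hadj _ _ (by omega) (by omega)]; omega
    · refine iff_of_false ?_ (by omega)
      simp only [h4]
      exact G.loopless.irrefl _
    · rw [G.adj_comm, hadj _ _ (by omega) (by omega)]; omega

/-- Two induced paths between the same two vertices with disjoint and anticomplete interiors form
a hole. -/
theorem exists_indCycle_of_indPaths {G : SimpleGraph V} {p q : ℕ → V} {r s : ℕ}
    (hp : IndPath G p r) (hq : IndPath G q s) (hr : 2 ≤ r) (hs : 2 ≤ s) (h0 : q 0 = p 0)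
    (h1 : q s = p r)
    (hpq : ∀ a, a ≤ r → ∀ b, 0 < b → b < s →
      p a ≠ q b ∧ (0 < a → a < r → ¬ G.Adj (p a) (q b))) :
    ∃ c : ℤ → V, IndCycle G c (r + s) ∧ (∀ t : ℕ, t ≤ r → c t = p t) ∧
      (∀ t : ℕ, t ≤ s → c (-t) = q t) ∧
      Set.range c = p '' Set.Icc 0 r ∪ q '' Set.Ioo 0 s := by
  -- The cycle runs along `p` and returns along `q` backwards, so negative indices read off `q` from
  -- its start.
  have hcyc := indCycle_of_nat (G := G) (F := fun t => if t ≤ r then p t else q (r + s - t))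
    (N := r + s) (by omega) (by
      intro a b hab hb
      split_ifs with h2 h3 h3
      · intro h; have := (hp a h2 b h3).1 h; omega
      · exact (hpq a h2 _ (by omega) (by omega)).1
      · omega
      · intro h; have := (hq _ (by omega) _ (by omega)).1 h; omega) (by
      intro a b hab hb
      split_ifs with h2 h3 h3
      · rw [(hp a h2 b h3).2]; omega
      · rcases Nat.eq_zero_or_pos a with h4 | h4
        · rw [h4, ← h0, (hq _ (by omega) _ (by omega)).2]; omega
        · rcases Nat.lt_or_ge a r with h5 | h5
          · have := (hpq a h2 (r + s - b) (by omega) (by omega)).2 h4 h5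
            simp only [this, false_iff]; omega
          · rw [show a = r by omega, ← h1, (hq _ (by omega) _ (by omega)).2]; omega
      · omega
      · rw [(hq _ (by omega) _ (by omega)).2]; omega)
  push_cast at hcyc
  refine ⟨_, hcyc, ?_, ?_, ?_⟩
  · intro t ht
    have : ((t : ℤ) % (r + s)).toNat = t := by
      rw [Int.emod_eq_of_lt (by omega) (by omega)]; omega
    simp only [this, ht, if_true]
  · intro t ht
    rcases Nat.eq_zero_or_pos t with h2 | h2
    · subst h2; simp [h0]
    · have : ((-(t : ℤ)) % (r + s)).toNat = r + s - t := by
        rw [← Int.add_emod_right, Int.emod_eq_of_lt (by omega) (by omega)]; omega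
      simp only [this]
      split_ifs with h3
      · obtain rfl : t = s := by omega
        rw [h1]; congr 1; omega
      · congr 1; omega
  · ext x
    simp only [Set.mem_range, Set.mem_union, Set.mem_image, Set.mem_Icc, Set.mem_Ioo]
    constructor
    · rintro ⟨t, rfl⟩
      have h2 := Int.emod_nonneg t (b := (r + s : ℤ)) (by omega)
      have h3 := Int.emod_lt_of_pos t (b := (r + s : ℤ)) (by omega)
      split_ifs with h
      · exact Or.inl ⟨_, ⟨by omega, h⟩, rfl⟩
      · exact Or.inr ⟨_, ⟨by omega, by omega⟩, rfl⟩
    · rintro (⟨t, ht, rfl⟩ | ⟨t, ht, rfl⟩)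
      · refine ⟨t, ?_⟩
        have : ((t : ℤ) % (r + s)).toNat = t := by
          rw [Int.emod_eq_of_lt (by omega) (by omega)]; omega
        simp only [this, ht.2, if_true]
      · refine ⟨r + s - t, ?_⟩
        have : (((r : ℤ) + s - t) % (r + s)).toNat = r + s - t := by
          rw [Int.emod_eq_of_lt (by omega) (by omega)]; omega
        simp only [this]
        rw [if_neg (by omega)]
        congr 1; omega

theorem cycleGraph_adj_iff_dvd {n : ℕ} (u v : Fin n) : (SimpleGraph.cycleGraph n).Adj u v ↔
    1 < n ∧ ((n : ℤ) ∣ (v : ℤ) - u - 1 ∨ (n : ℤ) ∣ (u : ℤ) - v - 1) := by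
  have key : ∀ u v : Fin n, (v - u).val = 1 ↔ 1 < n ∧ (n : ℤ) ∣ (v : ℤ) - u - 1 := by
    intro u v
    have hu := u.isLt
    have hv := v.isLt
    rw [Fin.val_sub]
    rcases Nat.lt_or_ge 1 n with hn | hn
    swap
    · have := Nat.mod_lt (n - u.val + v.val) (y := n) (by omega)
      omega
    simp only [hn, true_and]
    have h1 : ((n - u.val + v.val : ℕ) : ℤ) = n + (v - u) := by omega
    have h2 : (1 : ℤ) % n = 1 := Int.emod_eq_of_lt (by omega) (by omega)
    constructor
    · intro h
      have h3 : ((n - u.val + v.val : ℕ) : ℤ) % n = 1 := by exact_mod_cast h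
      rw [h1, Int.add_emod_left, ← h2] at h3
      exact Int.ModEq.dvd (Eq.symm h3)
    · intro h
      have h3 : ((n - u.val + v.val : ℕ) : ℤ) % n = 1 := by
        rw [h1, Int.add_emod_left, ← h2]
        exact (Int.modEq_iff_dvd.2 h).symm
      exact_mod_cast h3
  rw [SimpleGraph.cycleGraph_adj', key, key]
  tauto

theorem IndCycle.isHole {G : SimpleGraph V} {c : ℤ → V} {n : ℕ} (hc : IndCycle G c n) :
    IsHole G (Set.range c) n := by
  have h4 := hc.1
  refine ⟨by omega, ⟨⟨fun i => c i.val, ?_⟩, ?_⟩, ?_⟩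
  · intro i j h
    have := hc.eq_of_lt h (by omega) (by omega)
    exact Fin.ext (by omega)
  · intro i j
    rw [cycleGraph_adj_iff_dvd]
    have : 1 < n := by omega
    simp only [this, true_and]
    exact hc.2.2 _ _
  · ext x
    simp only [Set.mem_range]
    constructor
    · rintro ⟨i, rfl⟩; exact ⟨i, rfl⟩
    · rintro ⟨i, rfl⟩
      obtain ⟨j, h1, h2, h3⟩ := hc.exists_rep i 0
      refine ⟨⟨j.toNat, by omega⟩, ?_⟩
      change c (j.toNat : ℤ) = c i
      rw [Int.toNat_of_nonneg h1, h3]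

theorem IsHole.exists_indCycle {G : SimpleGraph V} {W : Set V} {n : ℕ} (h : IsHole G W n) :
    ∃ c : ℤ → V, IndCycle G c n ∧ W = Set.range c := by
  obtain ⟨h4, f, rfl⟩ := h
  have hcyc := indCycle_of_nat (G := G) (F := fun t => f ⟨t % n, Nat.mod_lt _ (by omega)⟩)
    (N := n) h4 (by
      intro a b hab hb h
      have := congrArg Fin.val (f.injective h)
      simp only [Nat.mod_eq_of_lt hb, Nat.mod_eq_of_lt (hab.trans hb)] at this
      omega) (by
      intro a b hab hb
      rw [f.map_adj_iff, cycleGraph_adj_iff_dvd]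
      simp only [Nat.mod_eq_of_lt hb, Nat.mod_eq_of_lt (hab.trans hb)]
      constructor
      · rintro ⟨-, h | h⟩
        · have := eq_zero_of_dvd_of_lt h (by omega) (by omega); omega
        · by_cases h5 : (a : ℤ) - b - 1 = -n
          · omega
          · have := eq_zero_of_dvd_of_lt h (by omega) (by omega); omega
      · rintro (rfl | ⟨rfl, h⟩)
        · exact ⟨by omega, Or.inl (by simp)⟩
        · exact ⟨by omega, Or.inr ⟨-1, by omega⟩⟩)
  refine ⟨_, hcyc, ?_⟩
  ext x
  simp only [Set.mem_range]
  constructor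
  · rintro ⟨i, rfl⟩
    refine ⟨i, ?_⟩
    congr 1; ext
    simp only
    rw [Int.emod_eq_of_lt (by omega) (by omega)]
    simp [Nat.mod_eq_of_lt i.isLt]
  · rintro ⟨i, rfl⟩; exact ⟨_, rfl⟩

end

section

variable {V : Type*}

/-! ### Holes with two arcs outside the neighbourhood of a vertex -/

theorem exists_last_le {p : ℤ → Prop} {e i : ℤ} (hei : e ≤ i) (he : p e) :
    ∃ x, e ≤ x ∧ x ≤ i ∧ p x ∧ ∀ y, x < y → y ≤ i → ¬ p y := by
  induction i, hei using Int.leInduction with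
  | base => exact ⟨e, le_rfl, le_rfl, he, fun y h1 h2 => by omega⟩
  | succ i hi ih =>
    by_cases h : p (i + 1)
    · exact ⟨i + 1, by omega, le_rfl, h, fun y h1 h2 => by omega⟩
    · obtain ⟨x, h1, h2, h3, h4⟩ := ih
      refine ⟨x, h1, by omega, h3, fun y h5 h6 => ?_⟩
      rcases eq_or_lt_of_le h6 with rfl | h7
      · exact h
      · exact h4 y h5 (by omega)

theorem exists_first_ge {p : ℤ → Prop} {e i : ℤ} (hei : i ≤ e) (he : p e) :
    ∃ x, i ≤ x ∧ x ≤ e ∧ p x ∧ ∀ y, i ≤ y → y < x → ¬ p y := by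
  obtain ⟨x, h1, h2, h3, h4⟩ := exists_last_le (p := fun t => p (-t)) (e := -e) (i := -i)
    (by omega) (by simpa using he)
  refine ⟨-x, by omega, by omega, h3, fun y h5 h6 => ?_⟩
  have := h4 (-y) (by omega) (by omega)
  simpa using this

/-- A hole in `D` and the attachment of `D` to `N(v)` such that the vertices of the hole that are
not adjacent to `v` do not form a path. -/
structure SplitHole (G : SimpleGraph V) (v : V) (D : Set V) (c : ℤ → V) (n : ℤ) : Prop where
  cyc : IndCycle G c n
  mem : ∀ t, c t ∈ D ∨ (G.Adj v (c t) ∧ Sees G (c t) D)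
  split : ∃ i k j l, i < k ∧ k < j ∧ j < l ∧ l < i + n ∧ G.Adj v (c i) ∧ G.Adj v (c j) ∧
    c k ∈ D ∧ c l ∈ D

/-- A split hole with as few neighbours of `v` as possible. -/
structure MinSplitHole (G : SimpleGraph V) (v : V) (D : Set V) (c : ℤ → V) (n : ℤ) : Prop
    extends SplitHole G v D c n where
  conn : Conn G D
  center_notMem : v ∉ D
  anti : ∀ x ∈ D, ¬ G.Adj v x
  le_card : ∀ c' n', SplitHole G v D c' n' →
    (Set.range c ∩ G.neighborSet v).ncard ≤ (Set.range c' ∩ G.neighborSet v).ncard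

/-- The part of the hole `c` strictly between the neighbours `c i` and `c j` of `v` is nonempty
and lies in `D`. -/
def IsArc (G : SimpleGraph V) (v : V) (D : Set V) (c : ℤ → V) (i j : ℤ) : Prop :=
  i + 1 < j ∧ G.Adj v (c i) ∧ G.Adj v (c j) ∧ ∀ x, i < x → x < j → c x ∈ D

variable {G : SimpleGraph V} {v : V} {D : Set V} {c : ℤ → V} {n : ℤ}

theorem MinSplitHole.ne_center (h : MinSplitHole G v D c n) (t : ℤ) : v ≠ c t := by
  intro hv
  rcases h.mem t with h1 | h1
  · exact h.center_notMem (hv ▸ h1)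
  · exact h1.1.ne hv

theorem MinSplitHole.notMem_of_adj (h : MinSplitHole G v D c n) {t : ℤ} (ht : G.Adj v (c t)) :
    c t ∉ D := fun hD => h.anti _ hD ht

/-- If `U` missed the interior of the arc, the hole could be rerouted: keep the stretch from the
last vertex before the arc that sees `U` to the first such vertex after it, and close it up through
`U`. The new hole is still split, with vertices of `U` in its second gap, but it has lost the
neighbour `c w` of `v`. This contradicts minimality. -/
theorem MinSplitHole.exists_sees_arc [Finite V] (h : MinSplitHole G v D c n) {U : Set V}
    (hU : Conn G U) (hUD : U ⊆ D) (hUc : ∀ t, c t ∉ U) {w e i j e' : ℤ} (hwe : w < e)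
    (hei : e ≤ i) (hij : IsArc G v D c i j) (hje : j ≤ e') (hew : e' < w + n)
    (hw : G.Adj v (c w)) (he : Sees G (c e) U) (he' : Sees G (c e') U) :
    ∃ x, i < x ∧ x < j ∧ Sees G (c x) U := by
  by_contra! hcon
  obtain ⟨hij', hi, hj, hD⟩ := hij
  obtain ⟨a, ha1, ha2, ha3, ha4⟩ := exists_last_le (p := fun t => Sees G (c t) U) hei he
  obtain ⟨b, hb1, hb2, hb3, hb4⟩ := exists_first_ge (p := fun t => Sees G (c t) U) hje he'
  have hne : c a ≠ c b := fun hab => by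
    have := h.cyc.eq_of_lt hab (by omega) (by omega); omega
  have hnadj : ¬ G.Adj (c a) (c b) := fun hab => by
    have := h.cyc.adj_of_lt hab (by omega) (by omega); omega
  obtain ⟨q, s, hs, hq, hq0, hqs, hqU⟩ := hU.exists_indPath_between (hUc a) (hUc b) ha3 hb3 hne
    hnadj
  obtain ⟨r, hr⟩ : ∃ r : ℕ, (r : ℤ) = b - a := ⟨(b - a).toNat, by omega⟩
  have hp := h.cyc.indPath a (l := r) (by omega)
  have hbr : c (a + r) = c b := by congr 1; omega
  obtain ⟨c', hc', hc1, hc2, hc3⟩ := exists_indCycle_of_indPaths hp hq (by omega) hs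
    (by simpa using hq0) (by rw [hqs, hbr]) (by
      intro t ht y hy hy'
      refine ⟨fun heq => hUc (a + t) (heq ▸ hqU y hy' hy), fun h1 h2 hadj => ?_⟩
      have hsee : Sees G (c (a + t)) U := ⟨q y, hqU y hy' hy, hadj⟩
      by_cases h3 : a + t ≤ i
      · exact ha4 _ (by omega) h3 hsee
      · by_cases h4 : a + t < j
        · exact hcon _ (by omega) h4 hsee
        · exact hb4 _ (by omega) (by omega) hsee)
  have hsub : Set.range c' ⊆ Set.range c ∪ U := by
    rw [hc3]
    rintro x (⟨t, ht, rfl⟩ | ⟨t, ht, rfl⟩)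
    · exact Or.inl ⟨_, rfl⟩
    · exact Or.inr (hqU t ht.2 ht.1)
  have hval : ∀ x, a ≤ x → x ≤ b → c' (x - a) = c x := by
    intro x h1 h2
    have := hc1 (x - a).toNat (by omega)
    rw [Int.toNat_of_nonneg (by omega)] at this
    rw [this]; congr 1; omega
  -- The new hole is indexed from `c a`. The arc supplies the first three witnesses, and the last
  -- index, congruent to `-1`, is the first vertex of the detour through `U`.
  have hsplit : SplitHole G v D c' (r + s) := by
    refine ⟨hc', fun t => ?_, i - a, i + 1 - a, j - a, -1 + (r + s), by omega, by omega, by omega,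
      by omega, ?_, ?_, ?_, ?_⟩
    · rcases hsub ⟨t, rfl⟩ with ⟨x, hx⟩ | hx
      · rw [← hx]; exact h.mem x
      · exact Or.inl (hUD hx)
    · rwa [hval i ha2 (by omega)]
    · rwa [hval j (by omega) (by omega)]
    · rw [hval _ (by omega) (by omega)]; exact hD _ (by omega) (by omega)
    · rw [hc'.add_period]
      have := hc2 1 (by omega)
      simp only [Nat.cast_one] at this
      rw [this]
      exact hUD (hqU 1 (by omega) (by omega))
  -- The detour lies in `D` and brings no neighbour of `v`, while `c w` lies outside the stretch
  -- that was kept; hence the count drops strictly.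
  refine absurd (h.le_card c' _ hsplit) (not_le.2 (Set.ncard_lt_ncard ?_ (Set.toFinite _)))
  refine ⟨?_, fun hsup => ?_⟩
  · rintro x ⟨hx, hxv⟩
    rcases hsub hx with hx' | hx'
    · exact ⟨hx', hxv⟩
    · exact absurd hxv (h.anti x (hUD hx'))
  · obtain ⟨hx, -⟩ := hsup ⟨⟨w, rfl⟩, hw⟩
    rw [hc3] at hx
    rcases hx with ⟨t, ht, hx⟩ | ⟨t, ht, hx⟩
    · have ht' := ht.2
      have := h.cyc.eq_of_lt hx (by omega) (by omega)
      omega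
    · exact hUc w (hx ▸ hqU t ht.2 ht.1)

theorem MinSplitHole.exists_arc (h : MinSplitHole G v D c n) {a x b : ℤ} (hax : a < x)
    (hxb : x < b) (ha : G.Adj v (c a)) (hb : G.Adj v (c b)) (hx : c x ∈ D) :
    ∃ i j, a ≤ i ∧ i < x ∧ x < j ∧ j ≤ b ∧ IsArc G v D c i j := by
  obtain ⟨i, h1, h2, h3, h4⟩ := exists_last_le (p := fun t => G.Adj v (c t)) hax.le ha
  obtain ⟨j, h5, h6, h7, h8⟩ := exists_first_ge (p := fun t => G.Adj v (c t)) hxb.le hb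
  have hix : i ≠ x := by rintro rfl; exact h.anti _ hx h3
  have hjx : j ≠ x := by rintro rfl; exact h.anti _ hx h7
  refine ⟨i, j, h1, by omega, by omega, h6, by omega, h3, h7, fun y hy hy' => ?_⟩
  rcases h.mem y with h9 | h9
  · exact h9
  · rcases le_total y x with h10 | h10
    · exact absurd h9.1 (h4 y hy h10)
    · exact absurd h9.1 (h8 y h10 hy')

theorem IsArc.shift (hc : IndCycle G c n) {i j : ℤ} (h : IsArc G v D c i j) :
    IsArc G v D c (i + n) (j + n) := by
  refine ⟨by have := h.1; omega, ?_, ?_, fun x hx hx' => ?_⟩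
  · rw [hc.add_period]; exact h.2.1
  · rw [hc.add_period]; exact h.2.2.1
  · have := h.2.2.2 (x - n) (by omega) (by omega)
    rwa [← hc.add_period, sub_add_cancel] at this

theorem IsArc.neg {i j : ℤ} (h : IsArc G v D c i j) : IsArc G v D (fun t => c (-t)) (-j) (-i) := by
  refine ⟨by have := h.1; omega, ?_, ?_, fun x hx hx' => h.2.2.2 _ (by omega) (by omega)⟩
  · simpa using h.2.2.1
  · simpa using h.2.1

/-- The path `c i, …, c j` of an arc, together with the adjacencies of the centre. -/
theorem MinSplitHole.arc_path (h : MinSplitHole G v D c n) {i j : ℤ} (hij : IsArc G v D c i j)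
    (hjn : j + 2 ≤ i + n) :
    ∃ m : ℕ, (m : ℤ) = j - i ∧ 2 ≤ m ∧ IndPath G (fun t : ℕ => c (i + t)) m ∧
      ∀ t : ℕ, t ≤ m → (G.Adj v (c (i + t)) ↔ t = 0 ∨ t = m) := by
  obtain ⟨h1, h2, h3, h4⟩ := hij
  obtain ⟨m, hm⟩ : ∃ m : ℕ, (m : ℤ) = j - i := ⟨(j - i).toNat, by omega⟩
  refine ⟨m, hm, by omega, h.cyc.indPath i (by omega), fun t ht => ⟨fun hadj => ?_, ?_⟩⟩
  · by_contra hcon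
    exact h.anti _ (h4 (i + t) (by omega) (by omega)) hadj
  · rintro (rfl | rfl)
    · simpa using h2
    · rwa [hm, add_sub_cancel]

/-- A vertex `q` of `D` off the hole that sees an arc cannot be joined to `v` by a part of the hole
far from that arc. -/
theorem MinSplitHole.false_of_hits (h : MinSplitHole G v D c n) (hT : ¬ ContainsTheta G)
    (hP : ¬ ContainsPyramid G) {q : V} (hq : q ∈ D) (hqc : ∀ t, c t ≠ q) {i j x y z : ℤ}
    (hij : IsArc G v D c i j) (hix : i < x) (hxj : x < j) (hx : G.Adj q (c x))
    (hy : G.Adj v (c y)) (hz : G.Adj q (c z)) (hy1 : j + 1 < y) (hy2 : y + 1 < i + n)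
    (hz1 : j + 1 < z) (hz2 : z + 1 < i + n) : False := by
  obtain ⟨m, hm, hm2, hg, hv⟩ := h.arc_path hij (by omega)
  -- The stretch of the hole between `c y` and `c z` links `v` to `q`. The strict bounds keep it
  -- anticomplete to the arc and its ends.
  have key := not_adj_of_connection hT hP (K := c '' Set.Icc (min y z) (max y z)) (q := q) hg hm2
    (fun t _ => h.ne_center _) hv (h.cyc.conn (by omega)) ?_ ?_
    ⟨_, ⟨y, ⟨by omega, by omega⟩, rfl⟩, hy⟩ ?_ ⟨_, ⟨z, ⟨by omega, by omega⟩, rfl⟩, hz⟩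
    (fun hqv => h.center_notMem (hqv ▸ hq)) (fun hqv => h.anti q hq hqv.symm)
    (fun t _ => (hqc _).symm)
  · refine key.1 (x - i).toNat (by omega) (by omega) ?_
    rw [Int.toNat_of_nonneg (by omega), add_sub_cancel]; exact hx
  · rintro ⟨t, -, ht⟩; exact h.ne_center t ht.symm
  · rintro _ ⟨t, ⟨ht1, ht2⟩, rfl⟩ s hs
    refine ⟨fun heq => ?_, fun hadj => ?_⟩
    · have := h.cyc.eq_of_lt heq (by omega) (by omega); omega
    · have := h.cyc.adj_of_lt hadj (by omega) (by omega); omega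
  · rintro ⟨t, -, ht⟩; exact hqc t ht

end

section

variable {V : Type*} {G : SimpleGraph V} {v : V} {D : Set V} {c : ℤ → V} {n : ℤ}

/-! ### Minimal split holes with exactly two arcs -/

/-- A neighbour `c m` of `v` on the hole cannot be joined to an arc by a path whose vertices, up to
the last one, do not see the arc or its ends. -/
theorem MinSplitHole.false_of_path (h : MinSplitHole G v D c n) (hT : ¬ ContainsTheta G)
    (hP : ¬ ContainsPyramid G) (hR : ¬ ContainsPrism G) {i j m : ℤ} (hij : IsArc G v D c i j)
    (hjm : j + 1 < m) (hmi : m < i + n) (hm : G.Adj v (c m)) {u : ℕ → V} {l : ℕ}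
    (hu : IndPath G u l) (huD : ∀ s ≤ l, u s ∈ D) (huc : ∀ s ≤ l, ∀ t, c t ≠ u s)
    (h0 : G.Adj (u 0) (c m)) (hmiss : ∀ s < l, ∀ t, i ≤ t → t ≤ j → ¬ G.Adj (u s) (c t))
    (hqi : ¬ G.Adj (u l) (c i)) {x : ℤ} (hix : i < x) (hxj : x < j) (hx : G.Adj (u l) (c x)) :
    False := by
  obtain ⟨a, ha, ha2, hg, hv⟩ := h.arc_path hij (by omega)
  have hvU : ∀ s ≤ l, u s ≠ v := fun s hs hvs => h.center_notMem (hvs ▸ huD s hs)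
  -- The connection from `v` to `u l` is `c m` followed by all vertices of the path except its last;
  -- for `l = 0` it is `c m` alone.
  have hK : Conn G (insert (c m) (u '' Set.Iio l)) ∧ Sees G (u l) (insert (c m) (u '' Set.Iio l)) := by
    rcases Nat.eq_zero_or_pos l with rfl | hl
    · refine ⟨?_, _, Set.mem_insert _ _, h0⟩
      rw [show u '' Set.Iio 0 = ∅ by ext; simp]
      simpa using conn_singleton G (c m)
    · have : u '' Set.Iio l = u '' Set.Icc 0 (l - 1) := by
        congr 1; ext t; simp only [Set.mem_Iio, Set.mem_Icc]; omega
      refine ⟨?_, u (l - 1), Or.inr ⟨l - 1, by simp only [Set.mem_Iio]; omega, rfl⟩,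
        (hu l le_rfl (l - 1) (by omega)).2.2 (by omega)⟩
      rw [this]
      exact (hu.conn_seg (by omega) (by omega)).insert_of_sees
        ⟨u 0, ⟨0, ⟨le_rfl, by omega⟩, rfl⟩, h0.symm⟩
  have hvK : v ∉ insert (c m) (u '' Set.Iio l) := by
    rintro (hvm | ⟨s, hs, hvs⟩)
    · exact h.ne_center m hvm
    · exact hvU s (le_of_lt hs) hvs
  have hqK : u l ∉ insert (c m) (u '' Set.Iio l) := by
    rintro (hqm | ⟨s, hs, hqs⟩)
    · exact huc l le_rfl m hqm.symm
    · have := (hu s (le_of_lt hs) l le_rfl).1 hqs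
      exact absurd hs (by simp [this])
  have hqx : G.Adj (u l) (c (i + ((x - i).toNat : ℤ))) := by
    rw [Int.toNat_of_nonneg (by omega), add_sub_cancel]; exact hx
  have hKm : ∀ t : ℕ, t ≤ a → c m ≠ c (i + t) ∧
      (G.Adj (c m) (c (i + t)) → m + 1 = i + n ∧ t = 0) := by
    intro t ht
    refine ⟨fun heq => ?_, fun hadj => ?_⟩
    · have := h.cyc.eq_of_lt heq (by omega) (by omega); omega
    · have := h.cyc.adj_of_lt hadj (by omega) (by omega); omega
  have hKu : ∀ s < l, ∀ t : ℕ, t ≤ a → u s ≠ c (i + t) ∧ ¬ G.Adj (u s) (c (i + t)) :=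
    fun s hs t ht => ⟨(huc s hs.le _).symm, hmiss s hs _ (by omega) (by omega)⟩
  -- In this case `c m` is adjacent to the end `c i`, so `v`, `c i`, `c m` is a triangle and the
  -- edge version is needed. Otherwise the connection is anticomplete to the arc and its ends.
  by_cases hadj : m + 1 = i + n
  · refine not_adj_of_edge_connection hP hR hg ha2 (fun t _ => h.ne_center _) hv hK.1 hvK
      (Set.mem_insert _ _) hm ?_ ?_ ?_ hqK hK.2 (hvU l le_rfl)
      (fun hqv => h.anti _ (huD l le_rfl) hqv.symm) (fun t _ => (huc l le_rfl _).symm)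
      (by simpa using hqi) (x - i).toNat (by omega) hqx
    · have := h.cyc.adj_succ m
      rw [hadj, h.cyc.add_period] at this
      simpa using this.symm
    · rintro _ (rfl | ⟨s, hs, rfl⟩) t ht
      · exact ⟨(hKm t ht).1, fun h1 => ⟨rfl, ((hKm t ht).2 h1).2⟩⟩
      · exact ⟨(hKu s hs t ht).1, fun h1 => absurd h1 (hKu s hs t ht).2⟩
    · rintro _ (rfl | ⟨s, hs, rfl⟩) h1
      · rfl
      · exact absurd h1 (h.anti _ (huD s (le_of_lt hs)))
  · refine (not_adj_of_connection hT hP hg ha2 (fun t _ => h.ne_center _) hv hK.1 hvK ?_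
      ⟨_, Set.mem_insert _ _, hm⟩ hqK hK.2 (hvU l le_rfl)
      (fun hqv => h.anti _ (huD l le_rfl) hqv.symm) (fun t _ => (huc l le_rfl _).symm)).1
      (x - i).toNat (by omega) (by omega) hqx
    rintro _ (rfl | ⟨s, hs, rfl⟩) t ht
    · exact ⟨(hKm t ht).1, fun h1 => hadj ((hKm t ht).2 h1).1⟩
    · exact hKu s hs t ht

/-- Reflection interchanges the two ends of an arc, which `MinSplitHole.false_of_path` treats
asymmetrically. -/
theorem MinSplitHole.neg (h : MinSplitHole G v D c n) :
    MinSplitHole G v D (fun t => c (-t)) n := by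
  refine ⟨⟨h.cyc.neg, fun t => h.mem _, ?_⟩, h.conn, h.center_notMem, h.anti, ?_⟩
  · obtain ⟨i, k, j, l, h1, h2, h3, h4, h5, h6, h7, h8⟩ := h.split
    exact ⟨-j, -k, -i, -l + n, by omega, by omega, by omega, by omega, by simpa, by simpa,
      by simpa, by rw [show -(-l + n) = l - n by ring, ← h.cyc.add_period]; simpa⟩
  · have : Set.range (fun t => c (-t)) = Set.range c := (Equiv.neg ℤ).surjective.range_comp c
    rw [this]
    exact h.le_card

/-- If a minimal split hole has exactly two arcs then no side between them has an interior. -/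
theorem MinSplitHole.false_of_long_side [Finite V] (h : MinSplitHole G v D c n)
    (hT : ¬ ContainsTheta G) (hP : ¬ ContainsPyramid G) (hR : ¬ ContainsPrism G)
    {i₁ j₁ i₂ j₂ : ℤ} (h1 : IsArc G v D c i₁ j₁) (h2 : IsArc G v D c i₂ j₂) (h12 : j₁ ≤ i₂)
    (hS2 : ∀ t, j₂ ≤ t → t ≤ i₁ + n → G.Adj v (c t)) (hS1 : ∀ t, j₁ ≤ t → t ≤ i₂ → G.Adj v (c t))
    (hlong : j₂ + 2 ≤ i₁ + n) : False := by
  have hl1 := h1.1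
  have hl2 := h2.1
  -- every vertex of `D` on the hole lies in one of the arcs
  have hloc : ∀ t, c t ∈ D → ∃ x, c x = c t ∧ ((i₁ < x ∧ x < j₁) ∨ (i₂ < x ∧ x < j₂)) := by
    intro t ht
    obtain ⟨x, hx1, hx2, hx3⟩ := h.cyc.exists_rep t i₁
    refine ⟨x, hx3, ?_⟩
    by_contra hcon
    have hadj : G.Adj v (c x) := by
      rcases eq_or_lt_of_le hx1 with rfl | hx4
      · exact h1.2.1
      · by_cases hx5 : x ≤ i₂
        · exact hS1 x (by omega) hx5
        · exact hS2 x (by omega) (by omega)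
    exact h.notMem_of_adj hadj (hx3 ▸ ht)
  obtain ⟨z, hzD, hz⟩ : Sees G (c (j₂ + 1)) D := by
    rcases h.mem (j₂ + 1) with h3 | h3
    · exact absurd h3 (h.notMem_of_adj (hS2 _ (by omega) (by omega)))
    · exact h3.2
  have hMc : ∀ m t, j₂ < m → m < i₁ + n → G.Adj (c t) (c m) → c t ∉ D := by
    intro m t hm hm' hadj hD
    obtain ⟨x, hx1, hx2⟩ := hloc t hD
    rw [← hx1] at hadj
    have := h.cyc.adj_of_lt hadj (by omega) (by omega)
    omega
  have hzc : z ∉ Set.range c := by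
    rintro ⟨t, rfl⟩
    exact hMc (j₂ + 1) t (by omega) (by omega) hz.symm hzD
  have hk1 : c (i₁ + 1) ∈ D := h1.2.2.2 _ (by omega) (by omega)
  -- A shortest path in `D` from a vertex seeing the interior of the long side to a vertex off the
  -- hole that sees an arc. The target exists: otherwise `D` would lie entirely on the hole, by
  -- connectedness, whereas `z` does not.
  obtain ⟨u, l, hu, hu0, hul, huD, hnA, hnB⟩ := h.conn.exists_indPath
    (A := {w | ∃ m, j₂ < m ∧ m < i₁ + n ∧ G.Adj w (c m)})
    (B := {w | w ∉ Set.range c ∧ ∃ t, c t ∈ D ∧ G.Adj w (c t)})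
    ⟨z, hzD, j₂ + 1, by omega, by omega, hz.symm⟩ (by
      by_contra hcon
      refine hzc ((h.conn.2 (D ∩ Set.range c) Set.inter_subset_left ⟨_, hk1, _, rfl⟩ ?_ hzD).2)
      rintro _ ⟨hx, t, rfl⟩ y hy hadj
      refine ⟨hy, ?_⟩
      by_contra hyc
      exact hcon ⟨y, hy, hyc, t, hx, hadj.symm⟩)
  obtain ⟨m, hm1, hm2, hm⟩ := hu0
  -- A first vertex of the path on the hole would have a predecessor already qualifying as the end
  -- of the path; the start is excluded by `hMc`.
  have huc : ∀ s ≤ l, u s ∉ Set.range c := by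
    intro s
    induction s with
    | zero =>
      rintro - ⟨t, ht⟩
      rw [← ht] at hm
      exact hMc m t hm1 hm2 hm (ht ▸ huD 0 (by omega))
    | succ s ih =>
      rintro hs ⟨t, ht⟩
      refine hnB s (by omega) ⟨ih (by omega), t, ht ▸ huD _ hs, ?_⟩
      rw [ht]
      exact (hu s (by omega) (s + 1) hs).2.2 (Or.inl rfl)
  have huc' : ∀ s ≤ l, ∀ t, c t ≠ u s := fun s hs t ht => huc s hs ⟨t, ht⟩
  have hmiss : ∀ s < l, ∀ t, c t ∈ D → ¬ G.Adj (u s) (c t) := fun s hs t ht hadj =>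
    hnB s hs ⟨huc s hs.le, t, ht, hadj⟩
  have hsees : ∀ a b s t, a ≤ s → s ≤ b → b ≤ l → G.Adj (u s) (c t) →
      Sees G (c t) (u '' Set.Icc a b) :=
    fun a b s t h3 h4 _ h5 => ⟨u s, ⟨s, ⟨h3, h4⟩, rfl⟩, h5.symm⟩
  have hUD : ∀ a b, b ≤ l → u '' Set.Icc a b ⊆ D := by
    rintro a b hb _ ⟨s, hs, rfl⟩
    exact huD s (hs.2.trans hb)
  have hUc : ∀ a b, b ≤ l → ∀ t, c t ∉ u '' Set.Icc a b := by
    rintro a b hb t ⟨s, hs, hst⟩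
    exact huc' s (hs.2.trans hb) t hst.symm
  have hlast : ∀ t, c t ∈ D → Sees G (c t) (u '' Set.Icc 0 l) → G.Adj (u l) (c t) := by
    rintro t ht ⟨_, ⟨s, hs, rfl⟩, hadj⟩
    rcases eq_or_lt_of_le hs.2 with rfl | hs'
    · exact hadj.symm
    · exact absurd hadj.symm (hmiss s hs' t ht)
  have hconn := hu.conn_seg (Nat.zero_le l) le_rfl
  have hmS : Sees G (c m) (u '' Set.Icc 0 l) := hsees 0 l 0 m le_rfl (by omega) le_rfl hm
  have hmS' : Sees G (c (m - n)) (u '' Set.Icc 0 l) := by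
    rwa [← h.cyc.add_period, sub_add_cancel]
  have hvj₂ : G.Adj v (c (j₂ - n)) := by
    rw [← h.cyc.add_period, sub_add_cancel]; exact h2.2.2.1
  -- the last vertex of the path sees both arcs
  obtain ⟨⟨x₁, hx1, hx1', hqx1⟩, ⟨x₂, hx2, hx2', hqx2⟩⟩ :
      (∃ x, i₁ < x ∧ x < j₁ ∧ G.Adj (u l) (c x)) ∧ ∃ x, i₂ < x ∧ x < j₂ ∧ G.Adj (u l) (c x) := by
    obtain ⟨-, t, ht, hqt⟩ := hul
    obtain ⟨x, hx, hx'⟩ := hloc t ht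
    rw [← hx] at hqt
    have hqS := hsees 0 l l x (by omega) le_rfl le_rfl hqt
    rcases hx' with hx' | hx'
    · refine ⟨⟨x, hx'.1, hx'.2, hqt⟩, ?_⟩
      obtain ⟨y, hy1, hy2, hy3⟩ := h.exists_sees_arc hconn (hUD 0 l le_rfl) (hUc 0 l le_rfl)
        (w := i₁) (e := x) (e' := m) hx'.1 (by omega) h2 hm1.le hm2 h1.2.1 hqS hmS
      exact ⟨y, hy1, hy2, hlast y (h2.2.2.2 y hy1 hy2) hy3⟩
    · refine ⟨?_, ⟨x, hx'.1, hx'.2, hqt⟩⟩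
      obtain ⟨y, hy1, hy2, hy3⟩ := h.exists_sees_arc hconn (hUD 0 l le_rfl) (hUc 0 l le_rfl)
        (w := j₂ - n) (e := m - n) (e' := x) (by omega) (by omega) h1 (by omega) (by omega) hvj₂
        hmS' hqS
      exact ⟨y, hy1, hy2, hlast y (h1.2.2.2 y hy1 hy2) hy3⟩
  have hqD := huD l le_rfl
  have hqc := huc' l le_rfl
  have hper : ∀ t, c (t + n) = c t := h.cyc.add_period
  -- Since `u l` sees both arcs, `MinSplitHole.false_of_hits` confines its neighbours in each arc to
  -- the vertex next to the other one, and makes the two arcs share an end.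
  have hA1 : ∀ x, i₁ ≤ x → x < j₁ → G.Adj (u l) (c x) → x + 1 = j₁ ∧ j₁ = i₂ := by
    intro x hx hx' hadj
    by_contra hcon
    exact h.false_of_hits hT hP hqD hqc h2 hx2 hx2' hqx2 (y := i₁ + n) (z := x + n)
      (by rw [hper]; exact h1.2.1) (by rwa [hper]) (by omega) (by omega) (by omega) (by omega)
  have hA2 : ∀ x, i₂ < x → x ≤ j₂ → G.Adj (u l) (c x) → x = i₂ + 1 := by
    intro x hx hx' hadj
    by_contra hcon
    have h3 := hA1 x₁ (by omega) hx1' hqx1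
    exact h.false_of_hits hT hP hqD hqc h1 hx1 hx1' hqx1 (y := j₂) (z := x)
      h2.2.2.1 hadj (by omega) (by omega) (by omega) (by omega)
  have hji := (hA1 x₁ (by omega) hx1' hqx1).2
  have hqi1 : ¬ G.Adj (u l) (c i₁) := fun hadj => by
    have := hA1 i₁ le_rfl (by omega) hadj; omega
  have hqj2 : ¬ G.Adj (u l) (c j₂) := fun hadj => by
    have := hA2 j₂ (by omega) le_rfl hadj; omega
  have hno : ∀ b, b < l → ∀ x, i₁ < x → x < j₁ → ¬ Sees G (c x) (u '' Set.Icc 0 b) := by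
    rintro b hb x hx hx' ⟨_, ⟨s, hs, rfl⟩, hadj⟩
    exact hmiss s (lt_of_le_of_lt hs.2 hb) x (h1.2.2.2 x hx hx') hadj.symm
  -- An earlier vertex seeing the shared end would give a connected set, seeing also `c m`, that
  -- allows rerouting around the first arc without seeing its interior.
  have hmid : ∀ s < l, ¬ G.Adj (u s) (c j₁) := by
    intro s hs hadj
    obtain ⟨x, hx, hx', hsee⟩ := h.exists_sees_arc (hu.conn_seg (Nat.zero_le s) hs.le)
      (hUD 0 s hs.le) (hUc 0 s hs.le) (w := j₂ - n) (e := m - n) (e' := j₁) (by omega) (by omega)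
      h1 le_rfl (by omega) hvj₂
      (by rw [← h.cyc.add_period, sub_add_cancel]
          exact hsees 0 s 0 m le_rfl (by omega) hs.le hm)
      (hsees 0 s s j₁ (by omega) le_rfl hs.le hadj)
    exact hno s hs x hx hx' hsee
  -- If the earlier vertices saw both outer ends, they would allow a rerouting that drops `c m`. So
  -- one outer end is missed, and its arc satisfies the hypotheses of `MinSplitHole.false_of_path`,
  -- after a reflection if it is the second arc.
  have hends : (∀ s < l, ¬ G.Adj (u s) (c i₁)) ∨ ∀ s < l, ¬ G.Adj (u s) (c j₂) := by
    by_contra! hcon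
    obtain ⟨⟨s, hs, hadj⟩, ⟨s', hs', hadj'⟩⟩ := hcon
    obtain ⟨x, hx, hx', hsee⟩ := h.exists_sees_arc
      (hu.conn_seg (Nat.zero_le (max s s')) (max_lt hs hs').le)
      (hUD 0 _ (max_lt hs hs').le) (hUc 0 _ (max_lt hs hs').le) (w := m - n) (e := i₁) (e' := j₂)
      (by omega) (by omega) h1 (by omega) (by omega)
      (by rw [← h.cyc.add_period, sub_add_cancel]; exact hS2 m hm1.le hm2.le)
      (hsees 0 _ s i₁ (by omega) (le_max_left _ _) (max_lt hs hs').le hadj)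
      (hsees 0 _ s' j₂ (by omega) (le_max_right _ _) (max_lt hs hs').le hadj')
    exact hno _ (max_lt hs hs') x hx hx' hsee
  have hvm := hS2 m hm1.le hm2.le
  rcases hends with hend | hend
  · refine h.false_of_path hT hP hR h1 (by omega) hm2 hvm hu huD huc' hm ?_ hqi1 hx1 hx1' hqx1
    intro s hs t ht ht'
    rcases eq_or_lt_of_le ht with rfl | ht
    · exact hend s hs
    · rcases eq_or_lt_of_le ht' with rfl | ht'
      · exact hmid s hs
      · exact hmiss s hs t (h1.2.2.2 t ht ht')
  · have hmm : c (-(-m + n)) = c m := by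
      rw [← h.cyc.add_period]; congr 1; ring
    refine h.neg.false_of_path hT hP hR h2.neg (m := -m + n) (by omega) (by omega)
      (by rwa [hmm]) hu huD (fun s hs t => huc' s hs _) (by rwa [hmm]) ?_ (by simpa using hqj2)
      (x := -x₂) (by omega) (by omega) (by simpa using hqx2)
    intro s hs t ht ht'
    rcases eq_or_lt_of_le ht with rfl | ht
    · simpa using hend s hs
    · rcases eq_or_lt_of_le ht' with rfl | ht'
      · simpa [← hji] using hmid s hs
      · exact hmiss s hs _ (h2.2.2.2 _ (by omega) (by omega))

theorem MinSplitHole.false_of_two_arcs [Finite V] (h : MinSplitHole G v D c n)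
    (hT : ¬ ContainsTheta G) (hP : ¬ ContainsPyramid G) (hR : ¬ ContainsPrism G)
    (hPP : ¬ ContainsPinchedPrism G) {i₁ j₁ i₂ j₂ : ℤ} (h1 : IsArc G v D c i₁ j₁)
    (h2 : IsArc G v D c i₂ j₂) (h12 : j₁ ≤ i₂) (h21 : j₂ ≤ i₁ + n)
    (hS2 : ∀ t, j₂ ≤ t → t ≤ i₁ + n → G.Adj v (c t))
    (hS1 : ∀ t, j₁ ≤ t → t ≤ i₂ → G.Adj v (c t)) : False := by
  have hper := h.cyc.add_period
  have hl1 := h1.1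
  have hl2 := h2.1
  have hnot : ∀ {i j}, IsArc G v D c i j → ∀ x, i < x → x < j → ¬ G.Adj v (c x) :=
    fun hij x hx hx' => h.anti _ (hij.2.2.2 x hx hx')
  have hend : i₁ + n ≤ j₂ + 1 := by
    by_contra hcon
    exact h.false_of_long_side hT hP hR h1 h2 h12 hS2 hS1 (by omega)
  -- The two sides are interchanged by shifting the first arc by one period.
  have hmid : i₂ ≤ j₁ + 1 := by
    by_contra hcon
    refine h.false_of_long_side hT hP hR h2 (h1.shift h.cyc) h21 (fun t ht ht' => ?_) hS2 (by omega)
    have := hS1 (t - n) (by omega) (by omega)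
    rwa [← hper, sub_add_cancel] at this
  have hvnot : ∀ a b, v ∉ c '' Set.Icc a b := by
    rintro a b ⟨t, -, ht⟩; exact h.ne_center t ht.symm
  have hnmem : ∀ a b x, b < x → x < a + n → c x ∉ c '' Set.Icc a b := by
    rintro a b x hb ha ⟨t, ⟨ht1, ht2⟩, ht⟩
    have := h.cyc.eq_of_lt ht (by omega) (by omega); omega
  -- one side is a single vertex and the other one an edge
  have pyr : ∀ i₁ j₁ i₂ j₂, IsArc G v D c i₁ j₁ → IsArc G v D c i₂ j₂ → j₁ = i₂ →
      j₂ + 1 = i₁ + n → False := by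
    intro i₁ j₁ i₂ j₂ h1 h2 h3 h4
    subst h3
    have hl1 := h1.1
    have hl2 := h2.1
    have hadj : G.Adj (c j₂) (c i₁) := by
      have := h.cyc.adj_succ j₂
      rwa [h4, hper] at this
    refine hP (containsPyramid_of_three (a := c j₁) (b := v) (c := c j₂) (d := c i₁) (X := {v})
      (Y := c '' Set.Icc (j₁ + 1) j₂) (Z := c '' Set.Icc i₁ (j₁ - 1)) h2.2.2.1 h1.2.1 hadj
      ⟨conn_singleton _ _, fun hv => h.ne_center j₁ (Set.mem_singleton_iff.1 hv).symm, rfl,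
        v, rfl, h1.2.2.1.symm⟩
      ⟨h.cyc.conn (by omega), ?_, ⟨j₂, ⟨by omega, le_rfl⟩, rfl⟩,
        _, ⟨j₁ + 1, ⟨le_rfl, by omega⟩, rfl⟩, h.cyc.adj_succ _⟩
      ⟨h.cyc.conn (by omega), hnmem _ _ _ (by omega) (by omega), ⟨i₁, ⟨le_rfl, by omega⟩, rfl⟩,
        _, ⟨j₁ - 1, ⟨by omega, le_rfl⟩, rfl⟩, ?_⟩ ?_ ?_ ?_ ?_ ?_ ?_)
    · rw [← hper]
      exact hnmem _ _ _ (by omega) (by omega)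
    · have := h.cyc.adj_succ (j₁ - 1)
      rw [sub_add_cancel] at this
      exact this.symm
    · rintro ⟨-, h5⟩
      have := h.cyc.adj_of_lt h5 (by omega) (by omega); omega
    · rintro ⟨-, h5⟩
      have := h.cyc.adj_of_lt h5 (by omega) (by omega); omega
    · rintro ⟨h5, -⟩
      have := h.cyc.adj_of_lt h5 (by omega) (by omega); omega
    · rintro _ rfl _ ⟨t, ⟨ht1, ht2⟩, rfl⟩
      refine ⟨h.ne_center t, fun h5 => ⟨rfl, ?_⟩⟩
      rcases eq_or_lt_of_le ht2 with rfl | ht2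
      · rfl
      · exact absurd h5 (hnot h2 t (by omega) ht2)
    · rintro _ rfl _ ⟨t, ⟨ht1, ht2⟩, rfl⟩
      refine ⟨h.ne_center t, fun h5 => ⟨rfl, ?_⟩⟩
      rcases eq_or_lt_of_le ht1 with rfl | ht1
      · rfl
      · exact absurd h5 (hnot h1 t ht1 (by omega))
    · rintro _ ⟨t, ⟨ht1, ht2⟩, rfl⟩ _ ⟨s, ⟨hs1, hs2⟩, rfl⟩
      refine ⟨fun h5 => ?_, fun h5 => ?_⟩
      · have := h.cyc.eq_of_lt h5 (by omega) (by omega); omega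
      · have := h.cyc.adj_of_lt h5 (by omega) (by omega)
        constructor <;> congr 1 <;> omega
  -- Each side is now a vertex or an edge. Two vertices give a theta between them, one path of which
  -- is through `v`; a vertex and an edge give a pyramid; two edges make `v` the centre of a pinched
  -- prism, whose hole has at least six vertices since both arcs have interiors.
  rcases eq_or_lt_of_le h12 with h3 | h3 <;> rcases eq_or_lt_of_le h21 with h4 | h4
  · subst h3
    have hvj := h2.2.2.1
    rw [h4, hper] at hvj
    refine hT (containsTheta_of_three (a := c i₁) (b := c j₁) (X := {v})
      (Y := c '' Set.Icc (i₁ + 1) (j₁ - 1)) (Z := c '' Set.Icc (j₁ + 1) (j₂ - 1)) ?_ ?_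
      ⟨conn_singleton _ _, fun hv => h.ne_center i₁ (Set.mem_singleton_iff.1 hv).symm,
        fun hv => h.ne_center j₁ (Set.mem_singleton_iff.1 hv).symm, ⟨v, rfl, h1.2.1.symm⟩,
        ⟨v, rfl, h1.2.2.1.symm⟩⟩
      ⟨h.cyc.conn (by omega), ?_, hnmem _ _ _ (by omega) (by omega),
        ⟨_, ⟨i₁ + 1, ⟨le_rfl, by omega⟩, rfl⟩, h.cyc.adj_succ _⟩,
        ⟨_, ⟨j₁ - 1, ⟨by omega, le_rfl⟩, rfl⟩, ?_⟩⟩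
      ⟨h.cyc.conn (by omega), ?_, ?_, ⟨_, ⟨j₂ - 1, ⟨by omega, le_rfl⟩, rfl⟩, ?_⟩,
        ⟨_, ⟨j₁ + 1, ⟨le_rfl, by omega⟩, rfl⟩, h.cyc.adj_succ _⟩⟩ ?_ ?_ ?_)
    · intro h5
      have := h.cyc.eq_of_lt h5 (by omega) (by omega); omega
    · intro h5
      have := h.cyc.adj_of_lt h5 (by omega) (by omega); omega
    · rw [← hper]; exact hnmem _ _ _ (by omega) (by omega)
    · have := h.cyc.adj_succ (j₁ - 1)
      rw [sub_add_cancel] at this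
      exact this.symm
    · rw [← hper]; exact hnmem _ _ _ (by omega) (by omega)
    · rw [← hper]; exact hnmem _ _ _ (by omega) (by omega)
    · have := h.cyc.adj_succ (j₂ - 1)
      rw [sub_add_cancel, h4, hper, ← h4] at this
      exact this.symm
    · rintro _ rfl _ ⟨t, ⟨ht1, ht2⟩, rfl⟩
      exact ⟨h.ne_center t, hnot h1 t (by omega) (by omega)⟩
    · rintro _ rfl _ ⟨t, ⟨ht1, ht2⟩, rfl⟩
      exact ⟨h.ne_center t, hnot h2 t (by omega) (by omega)⟩
    · rintro _ ⟨t, ⟨ht1, ht2⟩, rfl⟩ _ ⟨s, ⟨hs1, hs2⟩, rfl⟩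
      refine ⟨fun h5 => ?_, fun h5 => ?_⟩
      · have := h.cyc.eq_of_lt h5 (by omega) (by omega); omega
      · have := h.cyc.adj_of_lt h5 (by omega) (by omega); omega
  · exact pyr i₁ j₁ i₂ j₂ h1 h2 h3 (by omega)
  · exact pyr i₂ j₂ (i₁ + n) (j₁ + n) h2 (h1.shift h.cyc) h4 (by omega)
  · obtain ⟨N, rfl⟩ : ∃ N : ℕ, (N : ℤ) = n := ⟨n.toNat, by have := h.cyc.1; omega⟩
    obtain rfl : i₂ = j₁ + 1 := by omega
    have hij : i₁ + N = j₂ + 1 := by omega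
    have hdisj : ∀ a b, (a = j₁ ∨ a = j₁ + 1) → (b = j₂ ∨ b = j₂ + 1) →
        c a ≠ c b ∧ ¬ G.Adj (c a) (c b) := by
      intro a b ha hb
      refine ⟨fun h5 => ?_, fun h5 => ?_⟩
      · have := h.cyc.eq_of_lt h5 (by omega) (by omega); omega
      · have := h.cyc.adj_of_lt h5 (by omega) (by omega); omega
    refine hPP ⟨Set.range c, N, v, h.cyc.isHole, by omega, ?_, c j₁, c (j₁ + 1), c j₂, c (j₂ + 1),
      ?_, ?_, h.cyc.adj_succ _, h.cyc.adj_succ _, ?_⟩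
    · rintro ⟨t, ht⟩; exact h.ne_center t ht.symm
    · ext w
      simp only [Set.mem_inter_iff, SimpleGraph.mem_neighborSet, Set.mem_insert_iff,
        Set.mem_singleton_iff]
      constructor
      · rintro ⟨hw, t, rfl⟩
        obtain ⟨x, hx1, hx2, hx3⟩ := h.cyc.exists_rep t (i₁ + 1)
        rw [← hx3] at hw ⊢
        by_cases h5 : x < j₁
        · exact absurd hw (hnot h1 x (by omega) h5)
        · by_cases h6 : j₁ + 1 < x ∧ x < j₂
          · exact absurd hw (hnot h2 x h6.1 h6.2)
          · have : x = j₁ ∨ x = j₁ + 1 ∨ x = j₂ ∨ x = j₂ + 1 := by omega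
            rcases this with rfl | rfl | rfl | rfl <;> simp
      · rintro (rfl | rfl | rfl | rfl)
        · exact ⟨h1.2.2.1, _, rfl⟩
        · exact ⟨h2.2.1, _, rfl⟩
        · exact ⟨h2.2.2.1, _, rfl⟩
        · refine ⟨?_, _, rfl⟩
          rw [← hij, hper]; exact h1.2.1
    · rw [Set.disjoint_left]
      simp only [Set.mem_insert_iff, Set.mem_singleton_iff]
      rintro w (rfl | rfl) (h5 | h5)
      · exact (hdisj _ _ (by omega) (by omega)).1 h5
      · exact (hdisj _ _ (by omega) (by omega)).1 h5
      · exact (hdisj _ _ (by omega) (by omega)).1 h5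
      · exact (hdisj _ _ (by omega) (by omega)).1 h5
    · intro x hx y hy
      simp only [Set.mem_insert_iff, Set.mem_singleton_iff] at hx hy
      rcases hx with rfl | rfl <;> rcases hy with rfl | rfl
      · exact (hdisj _ _ (by omega) (by omega)).2
      · exact (hdisj _ _ (by omega) (by omega)).2
      · exact (hdisj _ _ (by omega) (by omega)).2
      · exact (hdisj _ _ (by omega) (by omega)).2

end

section

variable {V : Type*} {G : SimpleGraph V} {v : V} {D : Set V} {c : ℤ → V} {n : ℤ}

/-! ### Minimal split holes with at least three arcs -/

/-- Three consecutive arcs around a hole. -/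
structure ThreeArcs (G : SimpleGraph V) (v : V) (D : Set V) (c : ℤ → V) (n : ℤ)
    (i₁ j₁ i₂ j₂ i₃ j₃ : ℤ) : Prop where
  fst : IsArc G v D c i₁ j₁
  snd : IsArc G v D c i₂ j₂
  trd : IsArc G v D c i₃ j₃
  le₁₂ : j₁ ≤ i₂
  le₂₃ : j₂ ≤ i₃
  le₃₁ : j₃ ≤ i₁ + n

theorem ThreeArcs.rotate {i₁ j₁ i₂ j₂ i₃ j₃ : ℤ} (hc : IndCycle G c n)
    (h : ThreeArcs G v D c n i₁ j₁ i₂ j₂ i₃ j₃) :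
    ThreeArcs G v D c n i₂ j₂ i₃ j₃ (i₁ + n) (j₁ + n) :=
  ⟨h.snd, h.trd, h.fst.shift hc, h.le₂₃, h.le₃₁, by have := h.le₁₂; omega⟩

/-- Some vertex strictly between `c i` and `c j` has a neighbour in `U`. -/
def HitsBetween (G : SimpleGraph V) (c : ℤ → V) (U : Set V) (i j : ℤ) : Prop :=
  ∃ x, i < x ∧ x < j ∧ Sees G (c x) U

theorem hitsBetween_shift (hc : IndCycle G c n) {U : Set V} {i j : ℤ} :
    HitsBetween G c U (i + n) (j + n) ↔ HitsBetween G c U i j := by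
  constructor
  · rintro ⟨x, h1, h2, h3⟩
    refine ⟨x - n, by omega, by omega, ?_⟩
    rwa [← hc.add_period, sub_add_cancel]
  · rintro ⟨x, h1, h2, h3⟩
    exact ⟨x + n, by omega, by omega, by rwa [hc.add_period]⟩

/-- Going from the second arc past the third to the first, the hole skips the neighbour `c j₁` of
`v`, so minimality forces `U` to see the third arc as well. -/
theorem MinSplitHole.hits_third [Finite V] (h : MinSplitHole G v D c n)
    {i₁ j₁ i₂ j₂ i₃ j₃ : ℤ} (ha : ThreeArcs G v D c n i₁ j₁ i₂ j₂ i₃ j₃) {U : Set V}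
    (hU : Conn G U) (hUD : U ⊆ D) (hUc : ∀ t, c t ∉ U) (h1 : HitsBetween G c U i₁ j₁)
    (h2 : HitsBetween G c U i₂ j₂) : HitsBetween G c U i₃ j₃ := by
  obtain ⟨x, hx1, hx2, hx3⟩ := h1
  obtain ⟨y, hy1, hy2, hy3⟩ := h2
  have := ha.le₁₂
  have := ha.le₂₃
  have := ha.le₃₁
  exact h.exists_sees_arc hU hUD hUc (w := j₁) (e := y) (e' := x + n) (by omega) (by omega) ha.trd
    (by omega) (by omega) ha.fst.2.2.1 hy3 (by rwa [h.cyc.add_period])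

/-- At least two of the three arcs are hit by `U`. -/
def HitsTwo (G : SimpleGraph V) (c : ℤ → V) (i₁ j₁ i₂ j₂ i₃ j₃ : ℤ) (U : Set V) : Prop :=
  (HitsBetween G c U i₁ j₁ ∧ HitsBetween G c U i₂ j₂) ∨
    (HitsBetween G c U i₂ j₂ ∧ HitsBetween G c U i₃ j₃) ∨
    (HitsBetween G c U i₃ j₃ ∧ HitsBetween G c U i₁ j₁)

theorem MinSplitHole.hits_all [Finite V] (h : MinSplitHole G v D c n)
    {i₁ j₁ i₂ j₂ i₃ j₃ : ℤ} (ha : ThreeArcs G v D c n i₁ j₁ i₂ j₂ i₃ j₃) {U : Set V}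
    (hU : Conn G U) (hUD : U ⊆ D) (hUc : ∀ t, c t ∉ U) (h2 : HitsTwo G c i₁ j₁ i₂ j₂ i₃ j₃ U) :
    HitsBetween G c U i₁ j₁ ∧ HitsBetween G c U i₂ j₂ ∧ HitsBetween G c U i₃ j₃ := by
  rcases h2 with ⟨h1, h2⟩ | ⟨h1, h2⟩ | ⟨h1, h2⟩
  · exact ⟨h1, h2, h.hits_third ha hU hUD hUc h1 h2⟩
  · have := h.hits_third (ha.rotate h.cyc) hU hUD hUc h1 h2
    exact ⟨(hitsBetween_shift h.cyc).1 this, h1, h2⟩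
  · have := h.hits_third ((ha.rotate h.cyc).rotate h.cyc) hU hUD hUc h1
      ((hitsBetween_shift h.cyc).2 h2)
    exact ⟨h2, (hitsBetween_shift h.cyc).1 this, h1⟩

/-- The set `U` is the interior of a shortest path in `D` from the first arc to the rest of the
hole. Its length is at least two, because the hole edges leaving an arc lead to neighbours of `v`,
which are not in `D`. If the path ends outside the second arc, minimality still makes `U` see that
arc. -/
theorem MinSplitHole.exists_conn_hitsTwo [Finite V] (h : MinSplitHole G v D c n)
    {i₁ j₁ i₂ j₂ i₃ j₃ : ℤ} (ha : ThreeArcs G v D c n i₁ j₁ i₂ j₂ i₃ j₃) :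
    ∃ U, Conn G U ∧ U ⊆ D ∧ (∀ t, c t ∉ U) ∧ HitsTwo G c i₁ j₁ i₂ j₂ i₃ j₃ U := by
  have h12 := ha.le₁₂
  have h23 := ha.le₂₃
  have h31 := ha.le₃₁
  have hl1 := ha.fst.1
  have hl2 := ha.snd.1
  have hl3 := ha.trd.1
  have hper := h.cyc.add_period
  obtain ⟨u, l, hu, hu0, hul, huD, hnA, hnB⟩ := h.conn.exists_indPath
    (A := c '' Set.Ioo i₁ j₁) (B := Set.range c \ c '' Set.Ioo i₁ j₁)
    ⟨c (i₁ + 1), ha.fst.2.2.2 _ (by omega) (by omega), i₁ + 1, ⟨by omega, by omega⟩, rfl⟩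
    ⟨c (i₂ + 1), ha.snd.2.2.2 _ (by omega) (by omega), ⟨_, rfl⟩, by
      rintro ⟨t, ⟨ht1, ht2⟩, ht⟩
      have := h.cyc.eq_of_lt ht (by omega) (by omega)
      omega⟩
  obtain ⟨x, ⟨hx1, hx2⟩, hx⟩ := hu0
  obtain ⟨⟨y', hy'⟩, hy2⟩ := hul
  obtain ⟨y, hy3, hy4, hy5⟩ := h.cyc.exists_rep y' i₁
  have hyl : c y = u l := hy5.trans hy'
  have hynot : ¬ (i₁ < y ∧ y < j₁) := fun h3 => hy2 ⟨y, h3, hyl⟩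
  have hyD : ¬ G.Adj v (c y) := h.anti _ (hyl ▸ huD l le_rfl)
  have hyi : y ≠ i₁ := by rintro rfl; exact hyD ha.fst.2.1
  have hyj : y ≠ j₁ := by rintro rfl; exact hyD ha.fst.2.2.1
  have hl0 : l ≠ 0 := by
    rintro rfl
    have := h.cyc.eq_of_lt (hx.trans hyl.symm) (by omega) (by omega)
    omega
  have hl1 : l ≠ 1 := by
    rintro rfl
    have hadj := (hu 0 (by omega) 1 le_rfl).2.2 (Or.inl rfl)
    rw [← hx, ← hyl] at hadj
    have := h.cyc.adj_of_lt hadj (by omega) (by omega)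
    omega
  have hUc : ∀ t, c t ∉ u '' Set.Icc 1 (l - 1) := by
    rintro t ⟨s, ⟨hs1, hs2⟩, hs⟩
    refine hnB s (by omega) ⟨⟨t, hs.symm⟩, hnA s (by omega) (by omega)⟩
  have hUD : u '' Set.Icc 1 (l - 1) ⊆ D := by
    rintro _ ⟨s, ⟨hs1, hs2⟩, rfl⟩
    exact huD s (by omega)
  have hU := hu.conn_seg (i := 1) (j := l - 1) (by omega) (by omega)
  have hsx : Sees G (c x) (u '' Set.Icc 1 (l - 1)) := by
    rw [hx]
    exact ⟨_, ⟨1, ⟨le_rfl, by omega⟩, rfl⟩, (hu 0 (by omega) 1 (by omega)).2.2 (Or.inl rfl)⟩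
  have hsy : Sees G (c y) (u '' Set.Icc 1 (l - 1)) := by
    rw [hyl]
    exact ⟨_, ⟨l - 1, ⟨by omega, le_rfl⟩, rfl⟩,
      (hu l le_rfl (l - 1) (by omega)).2.2 (Or.inr (by omega))⟩
  refine ⟨_, hU, hUD, hUc, Or.inl ⟨⟨x, hx1, hx2, hsx⟩, ?_⟩⟩
  rcases le_or_gt y i₂ with h3 | h3
  · exact h.exists_sees_arc hU hUD hUc (w := j₁) (e := y) (e' := x + n) (by omega) h3 ha.snd
      (by omega) (by omega) ha.fst.2.2.1 hsy (by rwa [hper])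
  rcases lt_or_ge y j₂ with h4 | h4
  · exact ⟨y, h3, h4, hsy⟩
  · exact h.exists_sees_arc hU hUD hUc (w := i₁) (e := x) (e' := y) (by omega) (by omega) ha.snd
      h4 (by omega) ha.fst.2.1 hsx hsy

/-- A single vertex of `D` off the hole has neighbours in all three arcs. -/
theorem MinSplitHole.exists_hits_three [Finite V] (h : MinSplitHole G v D c n)
    {i₁ j₁ i₂ j₂ i₃ j₃ : ℤ} (ha : ThreeArcs G v D c n i₁ j₁ i₂ j₂ i₃ j₃) :
    ∃ p ∈ D, (∀ t, c t ≠ p) ∧ (∃ x, i₁ < x ∧ x < j₁ ∧ G.Adj p (c x)) ∧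
      (∃ x, i₂ < x ∧ x < j₂ ∧ G.Adj p (c x)) ∧ ∃ x, i₃ < x ∧ x < j₃ ∧ G.Adj p (c x) := by
  classical
  have hex : ∃ l, ∃ u : ℕ → V, IndPath G u l ∧ (∀ s ≤ l, u s ∈ D) ∧ (∀ s ≤ l, ∀ t, c t ≠ u s) ∧
      HitsTwo G c i₁ j₁ i₂ j₂ i₃ j₃ (u '' Set.Icc 0 l) := by
    obtain ⟨U, hU, hUD, hUc, h2⟩ := h.exists_conn_hitsTwo ha
    obtain ⟨⟨x, hx1, hx2, a, haU, hxa⟩, ⟨y, hy1, hy2, b, hbU, hyb⟩, -⟩ := h.hits_all ha hU hUD hUc h2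
    obtain ⟨u, l, hu, hu0, hul, huU, -⟩ := hU.exists_indPath (A := {a}) (B := {b}) ⟨a, haU, rfl⟩
      ⟨b, hbU, rfl⟩
    refine ⟨l, u, hu, fun s hs => hUD (huU s hs), fun s hs t ht => hUc t (ht ▸ huU s hs),
      Or.inl ⟨⟨x, hx1, hx2, u 0, ⟨0, ⟨le_rfl, by omega⟩, rfl⟩, ?_⟩,
        ⟨y, hy1, hy2, u l, ⟨l, ⟨by omega, le_rfl⟩, rfl⟩, ?_⟩⟩⟩
    · rwa [Set.mem_singleton_iff.1 hu0]
    · rwa [Set.mem_singleton_iff.1 hul]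
  obtain ⟨u, hu, huD, huc, h2⟩ := Nat.find_spec hex
  have hmin := fun m (hm : m < Nat.find hex) => Nat.find_min hex hm
  set l := Nat.find hex
  have hall := h.hits_all ha (hu.conn_seg (Nat.zero_le l) le_rfl)
    (by rintro _ ⟨s, hs, rfl⟩; exact huD s hs.2)
    (by rintro t ⟨s, hs, hst⟩; exact huc s hs.2 t hst.symm) h2
  rcases Nat.eq_zero_or_pos l with hl | hl
  · have key : ∀ i j, HitsBetween G c (u '' Set.Icc 0 l) i j →
        ∃ x, i < x ∧ x < j ∧ G.Adj (u 0) (c x) := by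
      rintro i j ⟨x, hx1, hx2, _, ⟨s, hs, rfl⟩, hadj⟩
      obtain rfl : s = 0 := by have := hs.2; omega
      exact ⟨x, hx1, hx2, hadj.symm⟩
    exact ⟨u 0, huD 0 (by omega), huc 0 (by omega), key _ _ hall.1, key _ _ hall.2.1,
      key _ _ hall.2.2⟩
  -- Split off the last vertex. By minimality of the length, neither it nor the rest of the path
  -- hits two arcs, so together they hit at most two; but the whole path hits all three.
  · exfalso
    have h0 := hmin (l - 1) (by omega)
    have h1 := hmin 0 hl
    have key : ∀ i j, HitsBetween G c (u '' Set.Icc 0 l) i j →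
        HitsBetween G c (u '' Set.Icc 0 (l - 1)) i j ∨
          HitsBetween G c ((fun t => u (l + t)) '' Set.Icc 0 0) i j := by
      rintro i j ⟨x, hx1, hx2, _, ⟨s, hs, rfl⟩, hadj⟩
      rcases eq_or_lt_of_le hs.2 with rfl | hs'
      · exact Or.inr ⟨x, hx1, hx2, _, ⟨0, by simp, rfl⟩, hadj⟩
      · exact Or.inl ⟨x, hx1, hx2, _, ⟨s, ⟨hs.1, by omega⟩, rfl⟩, hadj⟩
    have n0 : ¬ HitsTwo G c i₁ j₁ i₂ j₂ i₃ j₃ (u '' Set.Icc 0 (l - 1)) := fun h3 =>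
      h0 ⟨u, fun a ha b hb => hu a (by omega) b (by omega), fun s hs => huD s (by omega),
        fun s hs => huc s (by omega), h3⟩
    have n1 : ¬ HitsTwo G c i₁ j₁ i₂ j₂ i₃ j₃ ((fun t => u (l + t)) '' Set.Icc 0 0) := fun h3 =>
      h1 ⟨_, indPath_zero G _, fun s hs => huD _ (by omega), fun s hs => huc _ (by omega), h3⟩
    have k1 := key _ _ hall.1
    have k2 := key _ _ hall.2.1
    have k3 := key _ _ hall.2.2
    unfold HitsTwo at n0 n1
    tauto

/-- Two opposite vertices over a hole of length six, each adjacent to every second vertex. -/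
theorem isIndContained_cubeGraph (hc : IndCycle G c 6) {p : V} (hp : ∀ t, c t ≠ p)
    (hv : ∀ t, c t ≠ v) (hpv : p ≠ v) (hnadj : ¬ G.Adj p v)
    (hpc : ∀ t : Fin 6, G.Adj p (c t) ↔ t.val % 2 = 0)
    (hvc : ∀ t : Fin 6, G.Adj v (c t) ↔ t.val % 2 = 1) :
    SimpleGraph.IsIndContained cubeGraph G := by
  let f : Fin 6 ⊕ Fin 2 → V := Sum.elim (fun t => c (t.val : ℤ)) ![p, v]
  have hinj : Function.Injective f := by
    rintro (a | a) (b | b) hab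
    · have := hc.eq_of_lt (i := (a.val : ℤ)) (j := (b.val : ℤ)) hab (by omega) (by omega)
      congr 1; ext; omega
    · exfalso; fin_cases b
      · exact hp _ hab
      · exact hv _ hab
    · exfalso; fin_cases a
      · exact hp _ hab.symm
      · exact hv _ hab.symm
    · fin_cases a <;> fin_cases b
      · rfl
      · exact absurd hab hpv
      · exact absurd hab.symm hpv
      · rfl
  have hcyc : ∀ a b : Fin 6, G.Adj (c (a.val : ℤ)) (c (b.val : ℤ)) ↔
      (SimpleGraph.cycleGraph 6).Adj a b := by
    intro a b
    rw [cycleGraph_adj_iff_dvd, hc.2.2]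
    norm_num
  refine ⟨⟨⟨f, hinj⟩, ?_⟩⟩
  rintro (a | a) (b | b)
  · change G.Adj (c (a.val : ℤ)) (c (b.val : ℤ)) ↔ _
    rw [hcyc]
    simp only [cubeGraph, SimpleGraph.fromRel_adj]
    constructor
    · intro hab
      exact ⟨fun h => hab.ne (Sum.inl_injective h), Or.inl hab⟩
    · rintro ⟨-, hab | hab⟩
      · exact hab
      · exact hab.symm
  · have hlt := b.isLt
    have h2 : cubeGraph.Adj (Sum.inl a) (Sum.inr b) ↔ a.val % 2 = b.val := by
      simp [cubeGraph, SimpleGraph.fromRel_adj]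
    rw [h2]
    change G.Adj (c (a.val : ℤ)) (f (Sum.inr b)) ↔ _
    rw [G.adj_comm]
    fin_cases b
    · exact hpc a
    · exact hvc a
  · have hlt := a.isLt
    have h2 : cubeGraph.Adj (Sum.inr a) (Sum.inl b) ↔ b.val % 2 = a.val := by
      simp [cubeGraph, SimpleGraph.fromRel_adj]
    rw [h2]
    change G.Adj (f (Sum.inr a)) (c (b.val : ℤ)) ↔ _
    fin_cases a
    · exact hpc b
    · exact hvc b
  · have h2 : ¬ cubeGraph.Adj (Sum.inr a) (Sum.inr b) := by
      simp [cubeGraph, SimpleGraph.fromRel_adj]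
    refine iff_of_false ?_ h2
    change ¬ G.Adj (f (Sum.inr a)) (f (Sum.inr b))
    fin_cases a <;> fin_cases b
    · exact G.loopless.irrefl _
    · exact hnadj
    · exact fun h => hnadj h.symm
    · exact G.loopless.irrefl _

/-- The vertex `p` hitting three arcs is held against each pair of arcs through
`MinSplitHole.false_of_hits`. This leaves three arcs of length two sharing their ends, hence a hole
of length six on which `p` and `v` see complementary alternate vertices. -/
theorem MinSplitHole.cube_of_three_arcs [Finite V] (h : MinSplitHole G v D c n)
    (hT : ¬ ContainsTheta G) (hP : ¬ ContainsPyramid G)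
    {i₁ j₁ i₂ j₂ i₃ j₃ : ℤ} (ha : ThreeArcs G v D c n i₁ j₁ i₂ j₂ i₃ j₃) :
    SimpleGraph.IsIndContained cubeGraph G := by
  obtain ⟨p, hpD, hpc, h1, h2, h3⟩ := h.exists_hits_three ha
  have hper := h.cyc.add_period
  -- an arc that is hit has a single vertex and touches the next arc
  have key : ∀ i₁ j₁ i₂ j₂ i₃ j₃, ThreeArcs G v D c n i₁ j₁ i₂ j₂ i₃ j₃ →
      (∃ x, i₁ < x ∧ x < j₁ ∧ G.Adj p (c x)) → (∃ x, i₂ < x ∧ x < j₂ ∧ G.Adj p (c x)) →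
      (∃ x, i₃ < x ∧ x < j₃ ∧ G.Adj p (c x)) →
      j₁ = i₁ + 2 ∧ i₂ = j₁ ∧ j₃ = i₁ + n ∧ G.Adj p (c (i₁ + 1)) ∧
        (n = 6 → j₂ = i₁ + 4 → i₃ = i₁ + 4 → ¬ G.Adj p (c (i₁ + 2))) := by
    rintro i₁ j₁ i₂ j₂ i₃ j₃ ha ⟨x₁, hx1, hx1', hpx1⟩ ⟨x₂, hx2, hx2', hpx2⟩ ⟨x₃, hx3, hx3', hpx3⟩
    have h12 := ha.le₁₂
    have h23 := ha.le₂₃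
    have h31 := ha.le₃₁
    have hl1 := ha.fst.1
    have hl2 := ha.snd.1
    have hl3 := ha.trd.1
    have e1 : i₂ ≤ x₁ + 1 := by
      by_contra hcon
      exact h.false_of_hits hT hP hpD hpc ha.snd hx2 hx2' hpx2 (y := i₁ + n) (z := x₁ + n)
        (by rw [hper]; exact ha.fst.2.1) (by rwa [hper]) (by omega) (by omega) (by omega) (by omega)
    have e2 : x₁ + n ≤ j₃ + 1 := by
      by_contra hcon
      exact h.false_of_hits hT hP hpD hpc ha.trd hx3 hx3' hpx3 (y := j₁ + n) (z := x₁ + n)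
        (by rw [hper]; exact ha.fst.2.2.1) (by rwa [hper]) (by omega) (by omega) (by omega)
        (by omega)
    obtain rfl : x₁ = i₁ + 1 := by omega
    refine ⟨by omega, by omega, by omega, hpx1, fun hn6 hj2 hi3 hadj => ?_⟩
    have hvj := ha.fst.2.2.1
    rw [show j₁ = i₁ + 2 by omega] at hvj
    -- A common neighbour of `p` and `v` opposite to the third arc would by itself be a forbidden
    -- connection.
    exact h.false_of_hits hT hP hpD hpc ha.trd hx3 hx3' hpx3 (y := i₁ + 2 + n) (z := i₁ + 2 + n)
      (by rwa [hper]) (by rwa [hper]) (by omega) (by omega) (by omega) (by omega)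
  have hsh : ∀ {i j : ℤ}, (∃ x, i < x ∧ x < j ∧ G.Adj p (c x)) →
      ∃ x, i + n < x ∧ x < j + n ∧ G.Adj p (c x) := by
    rintro i j ⟨x, hx, hx', hadj⟩
    exact ⟨x + n, by omega, by omega, by rwa [hper]⟩
  have hr := ha.rotate h.cyc
  have k1 := key _ _ _ _ _ _ ha h1 h2 h3
  have k2 := key _ _ _ _ _ _ hr h2 h3 (hsh h1)
  have k3 := key _ _ _ _ _ _ (hr.rotate h.cyc) h3 (hsh h1) (hsh h2)
  obtain rfl : j₁ = i₁ + 2 := k1.1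
  obtain rfl : i₂ = i₁ + 2 := k1.2.1
  obtain rfl : j₂ = i₁ + 2 + 2 := k2.1
  obtain rfl : i₃ = i₁ + 2 + 2 := k2.2.1
  have hj3 := k3.1
  have hj3' := k1.2.2.1
  obtain rfl : n = 6 := by omega
  obtain rfl : j₃ = i₁ + 6 := hj3'
  have a1 := k1.2.2.2.1
  have a2 := k2.2.2.2.1
  have a3 := k3.2.2.2.1
  have b1 := k1.2.2.2.2 rfl (by ring) (by ring)
  have b2 := k2.2.2.2.2 rfl (by ring) (by ring)
  have b3 := k3.2.2.2.2 rfl (by ring) (by ring)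
  have c1 := ha.fst.2.2.1
  have c2 := ha.snd.2.2.1
  have c3 := ha.trd.2.2.1
  have d1 := h.anti _ (ha.fst.2.2.2 (i₁ + 1) (by omega) (by omega))
  have d2 := h.anti _ (ha.snd.2.2.2 (i₁ + 2 + 1) (by omega) (by omega))
  have d3 := h.anti _ (ha.trd.2.2.2 (i₁ + 2 + 2 + 1) (by omega) (by omega))
  refine isIndContained_cubeGraph (c := fun t => c (i₁ + 1 + t)) (p := p) (v := v)
    (h.cyc.shift (i₁ + 1)) (fun t => hpc _) (fun t => (h.ne_center _).symm)
    (fun hpv => h.center_notMem (hpv ▸ hpD)) (fun hadj => h.anti p hpD hadj.symm) ?_ ?_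
  · intro t
    fin_cases t
    · simpa using a1
    · simpa [add_assoc] using b1
    · simpa [add_assoc] using a2
    · simpa [add_assoc] using b2
    · simpa [add_assoc] using a3
    · simpa [add_assoc] using b3
  · intro t
    fin_cases t
    · simpa using d1
    · simpa [add_assoc] using c1
    · simpa [add_assoc] using d2
    · simpa [add_assoc] using c2
    · simpa [add_assoc] using d3
    · simpa [add_assoc] using c3

/-- No hole in `D` and its attachment to `N(v)` is split by `N(v)`. -/
theorem false_of_splitHole [Finite V] (hT : ¬ ContainsTheta G) (hP : ¬ ContainsPyramid G)
    (hR : ¬ ContainsPrism G) (hPP : ¬ ContainsPinchedPrism G) (hQ : CubeFree G) (hD : Conn G D)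
    (hvD : v ∉ D) (hanti : ∀ x ∈ D, ¬ G.Adj v x) (hs : SplitHole G v D c n) : False := by
  classical
  have hex : ∃ m, ∃ c n, SplitHole G v D c n ∧ (Set.range c ∩ G.neighborSet v).ncard = m :=
    ⟨_, c, n, hs, rfl⟩
  obtain ⟨c, n, hs, hm⟩ := Nat.find_spec hex
  have h : MinSplitHole G v D c n := ⟨hs, hD, hvD, hanti, fun c' n' hs' => by
    rw [hm]; exact Nat.find_min' hex ⟨c', n', hs', rfl⟩⟩
  have hper := h.cyc.add_period
  obtain ⟨i, k, j, l, hik, hkj, hjl, hln, hi, hj, hk, hl⟩ := h.split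
  obtain ⟨i₁, j₁, g1, g2, g3, g4, h1⟩ := h.exists_arc hik hkj hi hj hk
  obtain ⟨i₂, j₂, g5, g6, g7, g8, h2⟩ := h.exists_arc hjl hln hj (by rwa [hper]) hl
  -- Either both sides between the two arcs consist of neighbours of `v`, or a vertex of `D` on a
  -- side lies in a third arc.
  have hall : ∀ t, G.Adj v (c t) ∨ c t ∈ D := fun t => (h.mem t).symm.imp And.left id
  refine h.false_of_two_arcs hT hP hR hPP h1 h2 (by omega) (by omega) (fun t ht ht' => ?_)
    fun t ht ht' => ?_
  · refine (hall t).resolve_right fun htD => ?_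
    have n1 : t ≠ j₂ := by rintro rfl; exact h.anti _ htD h2.2.2.1
    have n2 : t ≠ i₁ + n := by rintro rfl; rw [hper] at htD; exact h.anti _ htD h1.2.1
    obtain ⟨i₃, j₃, g9, g10, g11, g12, h3⟩ := h.exists_arc (a := j₂) (b := i₁ + n) (by omega)
      (by omega) h2.2.2.1 (by rw [hper]; exact h1.2.1) htD
    exact hQ (h.cube_of_three_arcs hT hP ⟨h1, h2, h3, by omega, by omega, by omega⟩)
  · refine (hall t).resolve_right fun htD => ?_
    have n1 : t ≠ j₁ := by rintro rfl; exact h.anti _ htD h1.2.2.1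
    have n2 : t ≠ i₂ := by rintro rfl; exact h.anti _ htD h2.2.1
    obtain ⟨i₃, j₃, g9, g10, g11, g12, h3⟩ := h.exists_arc (a := j₁) (b := i₂) (by omega)
      (by omega) h1.2.2.1 h2.2.1 htD
    exact hQ (h.cube_of_three_arcs hT hP ⟨h1, h3, h2, by omega, by omega, by omega⟩)

end

section

variable {V : Type*} {G : SimpleGraph V}

/-! ### Three pairwise non-adjacent neighbours of a vertex -/

/-- An induced path between `x` and `y` with interior `u` extended by its two ends. -/
theorem IndPath.extend {u : ℕ → V} {l : ℕ} (hu : IndPath G u l) {x y : V} (hxy : x ≠ y)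
    (hnxy : ¬ G.Adj x y) (hxu : ∀ s ≤ l, x ≠ u s) (hyu : ∀ s ≤ l, y ≠ u s)
    (hx : ∀ s ≤ l, (G.Adj x (u s) ↔ s = 0)) (hy : ∀ s ≤ l, (G.Adj y (u s) ↔ s = l)) :
    ∃ w : ℕ → V, IndPath G w (l + 2) ∧ w 0 = x ∧ w (l + 2) = y ∧ ∀ s ≤ l, w (s + 1) = u s := by
  have h1 := hu.cons hxu hx
  have h2 := h1.append (w := fun _ => y) (m := 0) (indPath_zero G _) (by
      intro a ha b hb
      split_ifs
      · exact hxy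
      · exact (hyu _ (by omega)).symm) (by
      intro a ha b hb
      split_ifs with h
      · simp only [hnxy, false_iff]; omega
      · rw [G.adj_comm, hy _ (by omega)]; omega)
  refine ⟨_, h2, by simp, by simp, fun s hs => ?_⟩
  simp only [show s + 1 ≤ l + 1 by omega, if_true, show s + 1 ≠ 0 by omega, if_false]
  rfl

/-- The path `x`, `u`, `y` and the vertex `v` form a hole. If `z` has only one neighbour `u i` on
`u`, there is a theta from `v` to `u i` through `x`, `y` and `z`. Otherwise `z` is the hub of a
wheel: the two sectors leaving `v` through `x` and through `y` are long. -/
theorem mem_hub_of_path [Finite V] (hT : ¬ ContainsTheta G) {v x y z : V} {u : ℕ → V} {l : ℕ}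
    (hu : IndPath G u l) (hvu : ∀ s ≤ l, v ≠ u s ∧ ¬ G.Adj v (u s)) (hvx : G.Adj v x)
    (hvy : G.Adj v y) (hvz : G.Adj v z) (hxy : x ≠ y) (hxz : x ≠ z) (hyz : y ≠ z)
    (nxy : ¬ G.Adj x y) (nxz : ¬ G.Adj x z) (nyz : ¬ G.Adj y z)
    (hx : ∀ s ≤ l, (G.Adj x (u s) ↔ s = 0)) (hy : ∀ s ≤ l, (G.Adj y (u s) ↔ s = l))
    (hz : ∃ s ≤ l, G.Adj z (u s)) : z ∈ Hub G := by
  have hne : ∀ w, G.Adj v w → ∀ s ≤ l, w ≠ u s := fun w hw s hs h => (hvu s hs).2 (h ▸ hw)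
  obtain ⟨g, hg, hg0, hgl, hgu⟩ := hu.extend hxy nxy (hne x hvx) (hne y hvy) hx hy
  have hcase : ∀ t ≤ l + 2, t = 0 ∨ t = l + 2 ∨ ∃ s ≤ l, t = s + 1 := by
    intro t ht
    by_cases h1 : t = 0
    · exact Or.inl h1
    · by_cases h2 : t = l + 2
      · exact Or.inr (Or.inl h2)
      · exact Or.inr (Or.inr ⟨t - 1, by omega, by omega⟩)
  have hvg : ∀ t ≤ l + 2, v ≠ g t ∧ z ≠ g t ∧ (0 < t → t < l + 2 → ¬ G.Adj v (g t)) := by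
    intro t ht
    rcases hcase t ht with rfl | rfl | ⟨s, hs, rfl⟩
    · rw [hg0]; exact ⟨hvx.ne, hxz.symm, by omega⟩
    · rw [hgl]; exact ⟨hvy.ne, hyz.symm, by omega⟩
    · rw [hgu s hs]; exact ⟨(hvu s hs).1, hne z hvz s hs, fun _ _ => (hvu s hs).2⟩
  obtain ⟨i, j, hij, hjl, hi, hj, hmm⟩ := exists_min_max hz
  have hzg : ∀ t ≤ l + 2, G.Adj z (g t) → i + 1 ≤ t ∧ t ≤ j + 1 := by
    intro t ht hadj
    rcases hcase t ht with rfl | rfl | ⟨s, hs, rfl⟩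
    · rw [hg0] at hadj; exact absurd hadj.symm nxz
    · rw [hgl] at hadj; exact absurd hadj.symm nyz
    · rw [hgu s hs] at hadj
      have := hmm s hs hadj; omega
  have hvg0 : G.Adj v (g 0) := by rwa [hg0]
  have hvgl : G.Adj v (g (l + 2)) := by rwa [hgl]
  rcases eq_or_lt_of_le hij with rfl | hlt
  · exfalso
    have hgi := hgu i hjl
    have hnot : ∀ a b, (b < i + 1 ∨ i + 1 < a) → b ≤ l + 2 → v ∉ g '' Set.Icc a b ∧
        u i ∉ g '' Set.Icc a b := by
      intro a b hab hb
      constructor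
      · rintro ⟨t, ht, h⟩
        exact (hvg t (ht.2.trans hb)).1 h.symm
      · rintro ⟨t, ht, h⟩
        rw [← hgi] at h
        have := (hg t (ht.2.trans hb) (i + 1) (by omega)).1 h
        have := ht.1; have := ht.2; omega
    refine hT (containsTheta_of_three (a := v) (b := u i) (X := g '' Set.Icc 0 i)
      (Y := g '' Set.Icc (i + 2) (l + 2)) (Z := {z}) (hvu i hjl).1 (hvu i hjl).2
      ⟨hg.conn_seg (by omega) (by omega), (hnot _ _ (by omega) (by omega)).1,
        (hnot _ _ (by omega) (by omega)).2, ⟨_, ⟨0, ⟨le_rfl, by omega⟩, rfl⟩, hvg0⟩,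
        ⟨_, ⟨i, ⟨by omega, le_rfl⟩, rfl⟩, ?_⟩⟩
      ⟨hg.conn_seg (by omega) (by omega), (hnot _ _ (by omega) (by omega)).1,
        (hnot _ _ (by omega) (by omega)).2, ⟨_, ⟨l + 2, ⟨by omega, le_rfl⟩, rfl⟩, hvgl⟩,
        ⟨_, ⟨i + 2, ⟨le_rfl, by omega⟩, rfl⟩, ?_⟩⟩
      ⟨conn_singleton G z, fun h => hvz.ne h, fun h => hne z hvz i hjl (Set.mem_singleton_iff.1 h).symm,
        ⟨z, rfl, hvz⟩, ⟨z, rfl, hi.symm⟩⟩ ?_ ?_ ?_)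
    · rw [← hgi]; exact (hg _ (by omega) _ (by omega)).2.2 (by omega)
    · rw [← hgi]; exact (hg _ (by omega) _ (by omega)).2.2 (by omega)
    · rintro _ ⟨t, ⟨-, ht⟩, rfl⟩ _ ⟨s, ⟨hs, hs'⟩, rfl⟩
      have := hg t (by omega) s (by omega)
      exact ⟨fun h => by have := this.1 h; omega, fun h => by have := this.2.1 h; omega⟩
    · rintro _ ⟨t, ⟨-, ht⟩, rfl⟩ _ rfl
      exact ⟨(hvg t (by omega)).2.1.symm, fun h => by have := hzg t (by omega) h.symm; omega⟩
    · rintro _ ⟨t, ⟨ht', ht⟩, rfl⟩ _ rfl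
      exact ⟨(hvg t (by omega)).2.1.symm, fun h => by have := hzg t (by omega) h.symm; omega⟩
  · have hq : IndPath G (fun t : ℕ => if t = 0 then x else if t = 1 then v else y) 2 := by
      intro a ha b hb
      interval_cases a <;> interval_cases b <;>
        simp [hvx, hvy, hvx.symm, hvy.symm, hvx.ne, hvy.ne, hvx.ne.symm, hvy.ne.symm, hxy, hxy.symm,
          nxy, G.adj_comm y x]
    obtain ⟨c, hc, hc1, hc2, hc3⟩ := exists_indCycle_of_indPaths hg hq (by omega) (by omega)
      (by simp [hg0]) (by simp [hgl]) (by
        intro a ha b hb hb'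
        obtain rfl : b = 1 := by omega
        simp only [one_ne_zero, if_false, if_true]
        exact ⟨(hvg a ha).1.symm, fun h1 h2 h3 => (hvg a ha).2.2 h1 h2 h3.symm⟩)
    have hcyc : IndCycle G c ((l + 4 : ℕ) : ℤ) := by
      have : ((l + 2 : ℕ) : ℤ) + (2 : ℕ) = ((l + 4 : ℕ) : ℤ) := by push_cast; ring
      rwa [this] at hc
    have hcv : c (-1) = v := by simpa using hc2 1 (by omega)
    have hcv' : c (l + 3) = v := by
      rw [← hcv, ← hcyc.add_period (-1)]; congr 1; push_cast; ring
    have hci : c (i + 1 : ℕ) = u i := by rw [hc1 _ (by omega), hgu i (by omega)]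
    have hcj : c (j + 1 : ℕ) = u j := by rw [hc1 _ (by omega), hgu j (by omega)]
    have hmem : ∀ s : ℤ, -1 < s → s < l + 3 → ∃ t : ℕ, (t : ℤ) = s ∧ t ≤ l + 2 ∧ c s = g t :=
      fun s hs hs' => ⟨s.toNat, by omega, by omega, by
        rw [← hc1 _ (by omega)]; congr 1; omega⟩
    -- the two long sectors run from `v` to the first and to the last neighbour of `z`
    have hP := hcyc.indPath (-1) (l := i + 2) (by push_cast; omega)
    have hQ := hcyc.indPath (j + 1) (l := l + 2 - j) (by push_cast; omega)
    refine ⟨Set.range c, ⟨l + 4, by omega, hcyc.isHole⟩, ?_, ?_, _, _, ?_,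
      ⟨?_, _, _, _, by omega, hP.isPathFromTo, ?_, ?_, ?_⟩,
      ⟨?_, _, _, _, by omega, hQ.isPathFromTo, ?_, ?_, ?_⟩⟩
    · rw [hc3]
      rintro (⟨t, ht, h⟩ | ⟨t, ht, h⟩)
      · exact (hvg t ht.2).2.1 h.symm
      · obtain rfl : t = 1 := by have := ht.1; have := ht.2; omega
        simp only [one_ne_zero, if_false, if_true] at h
        exact hvz.ne h
    · have h3 : ({v, u i, u j} : Set V).ncard = 3 := by
        rw [Set.ncard_eq_three]
        exact ⟨v, u i, u j, (hvu i (by omega)).1, (hvu j hjl).1,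
          fun h => by have := (hu i (by omega) j hjl).1 h; omega, rfl⟩
      rw [degIn, ← h3]
      refine Set.ncard_le_ncard ?_ (Set.toFinite _)
      rintro w (rfl | rfl | rfl)
      · exact ⟨hvz.symm, _, hcv⟩
      · exact ⟨hi, _, hci⟩
      · exact ⟨hj, _, hcj⟩
    · intro h
      have : c 0 ∈ (fun t : ℕ => c (-1 + t)) '' Set.Icc 0 (i + 2) := ⟨1, ⟨by omega, by omega⟩, by simp⟩
      rw [h] at this
      obtain ⟨t, ht, h'⟩ := this
      have ht2 := ht.2
      have := hcyc.eq_of_lt h' (by push_cast; omega) (by push_cast; omega)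
      omega
    · rintro _ ⟨t, -, rfl⟩; exact ⟨_, rfl⟩
    · simpa [hcv] using hvz.symm
    · rw [show (-1 : ℤ) + ((i + 2 : ℕ) : ℤ) = ((i + 1 : ℕ) : ℤ) by push_cast; ring, hci]; exact hi
    · rintro _ ⟨⟨t, ht, rfl⟩, hne⟩ hadj
      simp only [Set.mem_insert_iff, Set.mem_singleton_iff, not_or] at hne
      have h1 : t ≠ 0 := by rintro rfl; exact hne.1 rfl
      have h2 : t ≠ i + 2 := by rintro rfl; exact hne.2 rfl
      have ht2 := ht.2
      change G.Adj z (c (-1 + t)) at hadj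
      obtain ⟨t', ht', hle, heq⟩ := hmem (-1 + t) (by omega) (by omega)
      rw [heq] at hadj
      have := hzg t' hle hadj
      omega
    · rintro _ ⟨t, -, rfl⟩; exact ⟨_, rfl⟩
    · have : c ((j : ℤ) + 1 + ((0 : ℕ) : ℤ)) = u j := by rw [← hcj]; congr 1
      rw [this]; exact hj
    · have : (j : ℤ) + 1 + ((l + 2 - j : ℕ) : ℤ) = l + 3 := by omega
      rw [this, hcv']; exact hvz.symm
    · rintro _ ⟨⟨t, ht, rfl⟩, hne⟩ hadj
      simp only [Set.mem_insert_iff, Set.mem_singleton_iff, not_or] at hne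
      have h1 : t ≠ 0 := by rintro rfl; exact hne.1 rfl
      have h2 : t ≠ l + 2 - j := by rintro rfl; exact hne.2 rfl
      have ht2 := ht.2
      change G.Adj z (c (j + 1 + t)) at hadj
      obtain ⟨t', ht', hle, heq⟩ := hmem (j + 1 + t) (by omega) (by omega)
      rw [heq] at hadj
      have := hzg t' hle hadj
      omega

/-- Following `w` from `z` and then `u` from the last neighbour of `w r` gives an induced path
towards `y`. As `x` sees `w`, `mem_hub_of_path` applies with `x` as the middle vertex. -/
theorem mem_hub_of_branch [Finite V] (hT : ¬ ContainsTheta G) {v x y z : V} {u w : ℕ → V}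
    {l r : ℕ} (hu : IndPath G u l) (hw : IndPath G w r)
    (hvu : ∀ s ≤ l, v ≠ u s ∧ ¬ G.Adj v (u s)) (hvw : ∀ s ≤ r, v ≠ w s ∧ ¬ G.Adj v (w s))
    (hvx : G.Adj v x) (hvy : G.Adj v y) (hvz : G.Adj v z) (hxy : x ≠ y) (hxz : x ≠ z) (hyz : y ≠ z)
    (nxy : ¬ G.Adj x y) (nxz : ¬ G.Adj x z) (nyz : ¬ G.Adj y z)
    (hy : ∀ s ≤ l, (G.Adj y (u s) ↔ s = l)) (hz : ∀ s ≤ l, ¬ G.Adj z (u s))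
    (hzw : ∀ s ≤ r, (G.Adj z (w s) ↔ s = 0)) (hwu : ∀ s ≤ r, ∀ t ≤ l, w s ≠ u t)
    (hmiss : ∀ s < r, ∀ t ≤ l, ¬ G.Adj (w s) (u t)) (hlast : ∃ t ≤ l, G.Adj (w r) (u t))
    (hxw : ∃ s ≤ r, G.Adj x (w s)) (hyw : ∀ s ≤ r, ¬ G.Adj y (w s)) : x ∈ Hub G := by
  obtain ⟨_, j, _, hjl, _, hj, hmm⟩ := exists_min_max hlast
  have hp := hw.append (hu.shift j (m := l - j) (by omega))
    (fun a ha b hb => hwu a ha _ (by omega)) (by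
      intro a ha b hb
      rcases eq_or_lt_of_le ha with rfl | ha'
      · constructor
        · intro h
          have := hmm (j + b) (by omega) h
          omega
        · rintro ⟨-, rfl⟩
          exact hj
      · exact iff_of_false (hmiss a ha' _ (by omega)) (by omega))
  refine mem_hub_of_path hT hp ?_ hvz hvy hvx hyz.symm hxz.symm hxy.symm (fun h => nyz h.symm)
    (fun h => nxz h.symm) (fun h => nxy h.symm) ?_ ?_ ?_
  · intro s hs
    split_ifs with h
    · exact hvw s h
    · exact hvu _ (by omega)
  · intro s hs
    split_ifs with h
    · exact hzw s h
    · exact iff_of_false (hz _ (by omega)) (by omega)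
  · intro s hs
    split_ifs with h
    · exact iff_of_false (hyw s h) (by omega)
    · rw [hy _ (by omega)]; omega
  · obtain ⟨s, hs, hadj⟩ := hxw
    refine ⟨s, by omega, ?_⟩
    simpa only [hs, if_true] using hadj

/-- Of three pairwise non-adjacent neighbours of `v`, all attaching to the same connected set
anticomplete to `v`, one is a hub. -/
theorem mem_hub_of_three [Finite V] (hT : ¬ ContainsTheta G) (hP : ¬ ContainsPyramid G)
    {v x y z : V} {B : Set V} (hB : Conn G B) (hvB : v ∉ B) (hanti : ∀ b ∈ B, ¬ G.Adj v b)
    (hvx : G.Adj v x) (hvy : G.Adj v y) (hvz : G.Adj v z) (hxy : x ≠ y) (hxz : x ≠ z) (hyz : y ≠ z)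
    (nxy : ¬ G.Adj x y) (nxz : ¬ G.Adj x z) (nyz : ¬ G.Adj y z)
    (hxB : Sees G x B) (hyB : Sees G y B) (hzB : Sees G z B) :
    x ∈ Hub G ∨ y ∈ Hub G ∨ z ∈ Hub G := by
  obtain ⟨bx, hbx, hbx'⟩ := hxB
  obtain ⟨cy, hby, hby'⟩ := hyB
  obtain ⟨bz, hbz, hbz'⟩ := hzB
  obtain ⟨u, l, hu, hu0, hul, huB, hnx, hny⟩ := hB.exists_indPath (A := G.neighborSet x)
    (B := G.neighborSet y) ⟨bx, hbx, hbx'⟩ ⟨cy, hby, hby'⟩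
  have hBv : ∀ b ∈ B, v ≠ b ∧ ¬ G.Adj v b := fun b hb => ⟨fun h => hvB (h ▸ hb), hanti b hb⟩
  have hne : ∀ w, G.Adj v w → ∀ b ∈ B, w ≠ b := fun w hw b hb h => hanti b hb (h ▸ hw)
  have hx : ∀ s ≤ l, (G.Adj x (u s) ↔ s = 0) := fun s hs =>
    ⟨fun h => by by_contra h0; exact hnx s hs (by omega) h, by rintro rfl; exact hu0⟩
  have hy : ∀ s ≤ l, (G.Adj y (u s) ↔ s = l) := fun s hs =>
    ⟨fun h => by by_contra h0; exact hny s (by omega) h, by rintro rfl; exact hul⟩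
  by_cases hzu : ∃ s ≤ l, G.Adj z (u s)
  · exact Or.inr (Or.inr (mem_hub_of_path hT hu (fun s hs => hBv _ (huB s hs)) hvx hvy hvz hxy hxz
      hyz nxy nxz nyz hx hy hzu))
  push Not at hzu
  have hbzu : bz ∉ u '' Set.Icc 0 l := by
    rintro ⟨s, hs, rfl⟩; exact hzu s hs.2 hbz'
  -- When `z` misses the path `u`, a second shortest path in `B` joins `z` to it, stopping just
  -- before it meets `u`.
  obtain ⟨w, r, hw, hw0, hwr, hwB, hnz, hnu⟩ := hB.exists_indPath (A := G.neighborSet z)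
    (B := {b | b ∉ u '' Set.Icc 0 l ∧ ∃ t ≤ l, G.Adj b (u t)}) ⟨bz, hbz, hbz'⟩ (by
      by_contra hcon
      refine hbzu ((hB.2 (B ∩ u '' Set.Icc 0 l) Set.inter_subset_left
        ⟨u 0, huB 0 (by omega), 0, ⟨le_rfl, by omega⟩, rfl⟩ ?_ hbz).2)
      rintro _ ⟨hb, t, ht, rfl⟩ b hb' hadj
      refine ⟨hb', ?_⟩
      by_contra hbu
      exact hcon ⟨b, hb', hbu, t, ht.2, hadj.symm⟩)
  have hwu' : ∀ s ≤ r, w s ∉ u '' Set.Icc 0 l := by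
    intro s
    induction s with
    | zero =>
      rintro - ⟨t, ht, h⟩
      rw [← h] at hw0
      exact hzu t ht.2 hw0
    | succ s ih =>
      rintro hs ⟨t, ht, h⟩
      refine hnu s (by omega) ⟨ih (by omega), t, ht.2, ?_⟩
      rw [h]
      exact (hw s (by omega) (s + 1) hs).2.2 (Or.inl rfl)
  have hwu : ∀ s ≤ r, ∀ t ≤ l, w s ≠ u t := fun s hs t ht h =>
    hwu' s hs ⟨t, ⟨by omega, ht⟩, h.symm⟩
  have hmiss : ∀ s < r, ∀ t ≤ l, ¬ G.Adj (w s) (u t) := fun s hs t ht h =>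
    hnu s hs ⟨hwu' s hs.le, t, ht, h⟩
  have hlast := hwr.2
  have hzw : ∀ s ≤ r, (G.Adj z (w s) ↔ s = 0) := fun s hs =>
    ⟨fun h => by by_contra h0; exact hnz s hs (by omega) h, by rintro rfl; exact hw0⟩
  have hvu := fun s hs => hBv _ (huB s hs)
  have hvw := fun s hs => hBv _ (hwB s hs)
  -- If `x` and `y` both see `w`, the one seen first from `z` is a hub, by cutting `w` at the first
  -- neighbour of the other. If only one sees `w`, it is a hub by the branch at `u`. If neither
  -- does, `z` and `w` attach `v` to an interior vertex of the path `x`, `u`, `y`, giving a theta or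
  -- a pyramid.
  by_cases hxw : ∃ s ≤ r, G.Adj x (w s) <;> by_cases hyw : ∃ s ≤ r, G.Adj y (w s)
  · obtain ⟨i, _, _, _, hi, _, hi'⟩ := exists_min_max hxw
    obtain ⟨j, _, _, _, hj, _, hj'⟩ := exists_min_max hyw
    obtain ⟨s, hs, hxs⟩ := hxw
    obtain ⟨s', hs', hys⟩ := hyw
    have hir := (hi' s hs hxs).1
    have hjr := (hj' s' hs' hys).1
    rcases le_total i j with hij | hij
    · refine Or.inl (mem_hub_of_path hT (hw.shift 0 (m := j) (by omega)) (fun s hs => ?_)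
        hvz hvy hvx hyz.symm hxz.symm hxy.symm (fun h => nyz h.symm)
        (fun h => nxz h.symm) (fun h => nxy h.symm) (fun s hs => ?_) (fun s hs => ?_)
        ⟨i, hij, by simpa using hi⟩)
      · simpa using hvw s (by omega)
      · simpa using hzw s (by omega)
      · simp only [zero_add]
        constructor
        · intro h; have := hj' s (by omega) h; omega
        · rintro rfl; exact hj
    · refine Or.inr (Or.inl (mem_hub_of_path hT (hw.shift 0 (m := i) (by omega)) (fun s hs => ?_)
        hvz hvx hvy hxz.symm hyz.symm hxy (fun h => nxz h.symm)
        (fun h => nyz h.symm) nxy (fun s hs => ?_) (fun s hs => ?_)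
        ⟨j, hij, by simpa using hj⟩))
      · simpa using hvw s (by omega)
      · simpa using hzw s (by omega)
      · simp only [zero_add]
        constructor
        · intro h; have := hi' s (by omega) h; omega
        · rintro rfl; exact hi
  · push Not at hyw
    exact Or.inl (mem_hub_of_branch hT hu hw hvu hvw hvx hvy hvz hxy hxz hyz nxy nxz nyz hy hzu hzw
      hwu hmiss hlast hxw hyw)
  · push Not at hxw
    refine Or.inr (Or.inl (mem_hub_of_branch hT hu.reverse hw (fun s hs => hvu _ (by omega)) hvw hvy
      hvx hvz hxy.symm hyz hxz (fun h => nxy h.symm) nyz nxz ?_ (fun s hs => hzu _ (by omega)) hzw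
      (fun s hs t ht => hwu s hs _ (by omega)) (fun s hs t ht => hmiss s hs _ (by omega)) ?_ hyw hxw))
    · intro s hs
      rw [hx _ (by omega)]; omega
    · obtain ⟨t, ht, h⟩ := hlast
      exact ⟨l - t, by omega, by simpa only [show l - (l - t) = t by omega] using h⟩
  · exfalso
    push Not at hxw hyw
    obtain ⟨g, hg, hg0, hgl, hgu⟩ := hu.extend hxy nxy (fun s hs => hne x hvx _ (huB s hs))
      (fun s hs => hne y hvy _ (huB s hs)) hx hy
    have hcase : ∀ t ≤ l + 2, t = 0 ∨ t = l + 2 ∨ ∃ s ≤ l, t = s + 1 := by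
      intro t ht
      by_cases h1 : t = 0
      · exact Or.inl h1
      · by_cases h2 : t = l + 2
        · exact Or.inr (Or.inl h2)
        · exact Or.inr (Or.inr ⟨t - 1, by omega, by omega⟩)
    have hK : Conn G (insert z (w '' Set.Iio r)) ∧ Sees G (w r) (insert z (w '' Set.Iio r)) := by
      rcases Nat.eq_zero_or_pos r with rfl | hr
      · refine ⟨?_, _, Set.mem_insert _ _, G.adj_symm hw0⟩
        rw [show w '' Set.Iio 0 = ∅ by ext; simp]
        simpa using conn_singleton G z
      · have : w '' Set.Iio r = w '' Set.Icc 0 (r - 1) := by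
          congr 1; ext t; simp only [Set.mem_Iio, Set.mem_Icc]; omega
        refine ⟨?_, w (r - 1), Or.inr ⟨r - 1, by simp only [Set.mem_Iio]; omega, rfl⟩,
          (hw r le_rfl (r - 1) (by omega)).2.2 (by omega)⟩
        rw [this]
        exact (hw.conn_seg (by omega) (by omega)).insert_of_sees
          ⟨w 0, ⟨0, ⟨le_rfl, by omega⟩, rfl⟩, hw0⟩
    obtain ⟨t, ht, hadj⟩ := hlast
    refine (not_adj_of_connection hT hP (q := w r) hg (by omega) ?_ ?_ hK.1 ?_ ?_
      ⟨z, Set.mem_insert _ _, hvz⟩ ?_ hK.2 (hvw r le_rfl).1.symm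
      (fun h => (hvw r le_rfl).2 h.symm) ?_).1 (t + 1) (by omega) (by omega) ?_
    · intro s hs
      rcases hcase s hs with rfl | rfl | ⟨a, ha, rfl⟩
      · rw [hg0]; exact hvx.ne
      · rw [hgl]; exact hvy.ne
      · rw [hgu a ha]; exact (hvu a ha).1
    · intro s hs
      rcases hcase s hs with rfl | rfl | ⟨a, ha, rfl⟩
      · rw [hg0]; simpa using hvx
      · rw [hgl]; simpa using hvy
      · rw [hgu a ha]
        exact iff_of_false (hvu a ha).2 (by omega)
    · rintro (h | ⟨s, hs, h⟩)
      · exact hvz.ne h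
      · exact (hvw s (le_of_lt hs)).1 h.symm
    · rintro _ (rfl | ⟨s, hs, rfl⟩) t ht
      · rcases hcase t ht with rfl | rfl | ⟨a, ha, rfl⟩
        · rw [hg0]; exact ⟨hxz.symm, fun h => nxz h.symm⟩
        · rw [hgl]; exact ⟨hyz.symm, fun h => nyz h.symm⟩
        · rw [hgu a ha]; exact ⟨hne _ hvz _ (huB a ha), hzu a ha⟩
      · have hs' : s ≤ r := le_of_lt hs
        rcases hcase t ht with rfl | rfl | ⟨a, ha, rfl⟩
        · rw [hg0]; exact ⟨(hne x hvx _ (hwB s hs')).symm, fun h => hxw s hs' h.symm⟩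
        · rw [hgl]; exact ⟨(hne y hvy _ (hwB s hs')).symm, fun h => hyw s hs' h.symm⟩
        · rw [hgu a ha]; exact ⟨hwu s hs' a ha, hmiss s hs a ha⟩
    · rintro (h | ⟨s, hs, h⟩)
      · exact hne z hvz _ (hwB r le_rfl) h.symm
      · have := (hw s (le_of_lt hs) r le_rfl).1 h
        exact absurd hs (by simp [this])
    · intro s hs
      rcases hcase s hs with rfl | rfl | ⟨a, ha, rfl⟩
      · rw [hg0]; exact (hne x hvx _ (hwB r le_rfl)).symm
      · rw [hgl]; exact (hne y hvy _ (hwB r le_rfl)).symm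
      · rw [hgu a ha]; exact hwu r le_rfl a ha
    · rw [hgu t ht]; exact hadj

end

section

variable {V : Type*}

/-! ### Wheels -/

theorem IndCycle.eq_of_adj {G : SimpleGraph V} {c : ℤ → V} {n : ℤ} (hc : IndCycle G c n)
    {s m : ℤ} (h : G.Adj (c s) (c m)) : c m = c (s + 1) ∨ c m = c (s - 1) := by
  rcases (hc.2.2 _ _).1 h with h | h
  · left
    exact ((hc.2.1 _ _).2 (by convert h using 1; ring)).symm
  · right
    exact (hc.2.1 _ _).2 (by convert h using 1; ring)

/-- A path on the hole that has started forwards cannot turn, since a step back would repeat a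
vertex. -/
theorem IndCycle.follow {G : SimpleGraph V} {c : ℤ → V} {n : ℤ} (hc : IndCycle G c n)
    {u : ℕ → V} {k : ℕ} (hu : IndPath G u k) (hmem : ∀ t ≤ k, u t ∈ Set.range c) {s : ℤ}
    (h0 : u 0 = c s) (h1 : u 1 = c (s + 1)) : ∀ t ≤ k, u t = c (s + t) := by
  intro t
  induction t using Nat.twoStepInduction with
  | zero => intro _; simpa using h0
  | one => intro _; simpa using h1
  | more t ih1 ih2 =>
    intro ht
    have e1 := ih1 (by omega)
    have e2 := ih2 (by omega)
    obtain ⟨m, hm⟩ := hmem (t + 2) ht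
    have hadj := (hu (t + 1) (by omega) (t + 2) ht).2.2 (Or.inl rfl)
    rw [e2, ← hm] at hadj
    rcases hc.eq_of_adj hadj with h | h
    · rw [← hm, h]; congr 1; push_cast; ring
    · exfalso
      have : u (t + 2) = u t := by
        rw [← hm, h, e1]; congr 1; push_cast; ring
      have := (hu _ ht _ (by omega)).1 this
      omega

/-- A path around all `n` vertices would have the closing edge of the hole as a chord. -/
theorem IndCycle.add_two_le {G : SimpleGraph V} {c : ℤ → V} {n : ℤ} (hc : IndCycle G c n)
    {u : ℕ → V} {k : ℕ} (hu : IndPath G u k) {s : ℤ} (h : ∀ t ≤ k, u t = c (s + t)) :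
    (k : ℤ) + 2 ≤ n := by
  have h4 := hc.1
  by_contra hlt
  have hk : (n - 1).toNat ≤ k := by omega
  have hadj := hc.adj_succ (s + (n - 1))
  rw [show s + (n - 1) + 1 = s + n by ring, hc.add_period] at hadj
  have e0 := h 0 (by omega)
  have e1 := h _ hk
  rw [Int.toNat_of_nonneg (by omega)] at e1
  simp only [Nat.cast_zero, add_zero] at e0
  rw [← e0, ← e1] at hadj
  have := (hu _ hk 0 (by omega)).2.1 hadj
  omega

theorem IsLongSector.exists_arc {G : SimpleGraph V} {c : ℤ → V} {n : ℤ} (hc : IndCycle G c n)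
    {v : V} {P : Set V} (h : IsLongSector G (Set.range c) v P) :
    ∃ s e : ℤ, s + 1 < e ∧ e + 1 < s + n ∧ P = c '' Set.Icc s e ∧ G.Adj v (c s) ∧
      G.Adj v (c e) ∧ ∀ t, s < t → t < e → ¬ G.Adj v (c t) := by
  obtain ⟨hPW, a, b, k, hk, hP, hva, hvb, hint⟩ := h
  obtain ⟨u, hu, hPu, rfl, rfl⟩ := hP.exists_indPath
  have hmem : ∀ t ≤ k, u t ∈ P := fun t ht => hPu ▸ ⟨t, ⟨by omega, ht⟩, rfl⟩
  have hint' : ∀ t, 0 < t → t < k → ¬ G.Adj v (u t) := by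
    intro t h0 ht
    refine hint _ ⟨hmem t (by omega), ?_⟩
    rintro (h | h)
    · have := (hu _ (by omega) _ (by omega)).1 h; omega
    · have := (hu _ (by omega) _ (by omega)).1 h; omega
  have key : ∃ s : ℤ, (∀ t ≤ k, u t = c (s + t)) ∨ ∀ t ≤ k, u t = c (s - t) := by
    obtain ⟨s, hs⟩ := hPW (hmem 0 (by omega))
    obtain ⟨m, hm⟩ := hPW (hmem 1 (by omega))
    have hadj := (hu 0 (by omega) 1 (by omega)).2.2 (Or.inl rfl)
    rw [← hs, ← hm] at hadj
    refine ⟨s, ?_⟩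
    rcases hc.eq_of_adj hadj with h | h
    · exact Or.inl (hc.follow hu (fun t ht => hPW (hmem t ht)) hs.symm (hm.symm.trans h))
    · right
      have := hc.neg.follow hu (s := -s) (fun t ht => by
        obtain ⟨x, hx⟩ := hPW (hmem t ht)
        exact ⟨-x, by simpa using hx⟩) (by simpa using hs.symm)
        (by rw [← hm, h]; congr 1; ring)
      intro t ht
      rw [this t ht]; congr 1; ring
  obtain ⟨s, h | h⟩ := key
  · have hkn := hc.add_two_le hu h
    have e0 := h 0 (by omega)
    simp only [Nat.cast_zero, add_zero] at e0
    refine ⟨s, s + k, by omega, by omega, ?_, by rwa [← e0], by rwa [← h k le_rfl], ?_⟩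
    · rw [hPu]
      ext x
      simp only [Set.mem_image, Set.mem_Icc]
      constructor
      · rintro ⟨t, ht, rfl⟩
        exact ⟨s + t, by omega, (h t ht.2).symm⟩
      · rintro ⟨t, ht, rfl⟩
        refine ⟨(t - s).toNat, by omega, ?_⟩
        rw [h _ (by omega), Int.toNat_of_nonneg (by omega)]; congr 1; ring
    · intro t h1 h2
      have := hint' (t - s).toNat (by omega) (by omega)
      rwa [h _ (by omega), Int.toNat_of_nonneg (by omega), add_sub_cancel] at this
  · have hkn := hc.neg.add_two_le hu (s := -s) fun t ht => by rw [h t ht]; congr 1; ring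
    have e0 := h 0 (by omega)
    simp only [Nat.cast_zero, sub_zero] at e0
    refine ⟨s - k, s, by omega, by omega, ?_, by rwa [← h k le_rfl], by rwa [← e0], ?_⟩
    · rw [hPu]
      ext x
      simp only [Set.mem_image, Set.mem_Icc]
      constructor
      · rintro ⟨t, ht, rfl⟩
        exact ⟨s - t, by omega, (h t ht.2).symm⟩
      · rintro ⟨t, ht, rfl⟩
        refine ⟨(s - t).toNat, by omega, ?_⟩
        rw [h _ (by omega), Int.toNat_of_nonneg (by omega)]; congr 1; ring
    · intro t h1 h2
      have := hint' (s - t).toNat (by omega) (by omega)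
      rwa [h _ (by omega), Int.toNat_of_nonneg (by omega), sub_sub_cancel] at this

/-- The hole of a wheel with hub `v` splits over a set containing its nonneighbours of `v`. -/
theorem IsWheel.exists_splitHole {G : SimpleGraph V} {W D : Set V} {v : V} (h : IsWheel G W v)
    (hD : ∀ w ∈ W, w ∈ D ∨ (G.Adj v w ∧ Sees G w D)) : ∃ c n, SplitHole G v D c n := by
  obtain ⟨⟨n, -, hW⟩, -, -, P, Q, hPQ, hP, hQ⟩ := h
  obtain ⟨c, hc, rfl⟩ := hW.exists_indCycle
  obtain ⟨s, e, hse, hen, hPc, hvs, hve, hns⟩ := hP.exists_arc hc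
  obtain ⟨r, d, hrd, hdn, hQc, hvr, hvd, hnr⟩ := hQ.exists_arc hc
  have hDn : ∀ t, ¬ G.Adj v (c t) → c t ∈ D := fun t ht =>
    (hD _ ⟨t, rfl⟩).resolve_right fun h => ht h.1
  -- The second sector is moved into the period starting at `s`. If both sectors then start at `s`,
  -- they also end together, at the next neighbour of `v`, and coincide; otherwise their interiors
  -- are disjoint and split the hole.
  obtain ⟨r', h1, h2, h3⟩ := hc.exists_rep r s
  have hr' : ∀ x, c (r' + x) = c (r + x) := by
    intro x
    have := (hc.2.1 _ _).1 h3
    exact (hc.2.1 _ _).2 (by convert this using 1; ring)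
  have hnr' : ∀ t, r' < t → t < d - r + r' → ¬ G.Adj v (c t) := by
    intro t h4 h5
    have := hr' (t - r')
    rw [add_sub_cancel] at this
    rw [this]
    exact hnr _ (by omega) (by omega)
  have hvd' : G.Adj v (c (r' + (d - r))) := by
    rw [hr', add_sub_cancel]; exact hvd
  rcases eq_or_lt_of_le h1 with rfl | h1
  · exfalso
    rcases lt_trichotomy e (s + (d - r)) with h5 | h5 | h5
    · exact hnr' e (by omega) (by omega) hve
    · apply hPQ
      rw [hPc, hQc]
      ext x
      simp only [Set.mem_image, Set.mem_Icc]
      constructor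
      · rintro ⟨t, ht, rfl⟩
        refine ⟨r + (t - s), by omega, ?_⟩
        rw [← hr', add_sub_cancel]
      · rintro ⟨t, ht, rfl⟩
        refine ⟨s + (t - r), by omega, ?_⟩
        rw [hr', add_sub_cancel]
    · exact hns _ (by omega) h5 hvd'
  · have her : e ≤ r' := by
      by_contra hlt
      exact hns r' h1 (by omega) (h3 ▸ hvr)
    have hds : r' + (d - r) ≤ s + n := by
      by_contra hlt
      refine hnr' (s + n) (by omega) (by omega) ?_
      rwa [hc.add_period]
    exact ⟨c, n, hc, fun t => hD _ ⟨t, rfl⟩, s, s + 1, r', r' + 1, by omega, by omega, by omega,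
      by omega, hvs, h3 ▸ hvr, hDn _ (hns _ (by omega) (by omega)),
      hDn _ (hnr' _ (by omega) (by omega))⟩

/-! ### Wheels of an induced subgraph as wheels of the whole graph -/

theorem IsPathFromTo.image_val {G : SimpleGraph V} {X : Set V} {P : Set X} {a b : X} {k : ℕ}
    (h : IsPathFromTo (G.induce X) P a b k) :
    IsPathFromTo G (Subtype.val '' P) (a : V) b k := by
  obtain ⟨f, rfl, rfl, rfl⟩ := h
  refine ⟨f.trans (SimpleGraph.Embedding.induce X), ?_, rfl, rfl⟩
  rw [← Set.range_comp]; rfl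

theorem IsHole.image_val {G : SimpleGraph V} {X : Set V} {W : Set X} {n : ℕ}
    (h : IsHole (G.induce X) W n) : IsHole G (Subtype.val '' W) n := by
  obtain ⟨h4, f, rfl⟩ := h
  refine ⟨h4, f.trans (SimpleGraph.Embedding.induce X), ?_⟩
  rw [← Set.range_comp]; rfl

theorem IsLongSector.image_val {G : SimpleGraph V} {X : Set V} {W P : Set X} {v : X}
    (h : IsLongSector (G.induce X) W v P) :
    IsLongSector G (Subtype.val '' W) (v : V) (Subtype.val '' P) := by
  obtain ⟨hPW, a, b, k, hk, hP, hva, hvb, hint⟩ := h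
  refine ⟨Set.image_mono hPW, a, b, k, hk, hP.image_val, hva, hvb, ?_⟩
  rintro _ ⟨⟨x, hx, rfl⟩, hne⟩
  refine hint x ⟨hx, ?_⟩
  rintro (rfl | rfl)
  · exact hne (Or.inl rfl)
  · exact hne (Or.inr rfl)

theorem IsWheel.image_val {G : SimpleGraph V} {X : Set V} {W : Set X} {v : X}
    (h : IsWheel (G.induce X) W v) : IsWheel G (Subtype.val '' W) (v : V) := by
  obtain ⟨⟨n, hn, hW⟩, hv, hdeg, P, Q, hPQ, hP, hQ⟩ := h
  refine ⟨⟨n, hn, hW.image_val⟩, ?_, ?_, _, _, ?_, hP.image_val, hQ.image_val⟩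
  · rintro ⟨x, hx, hxv⟩
    exact hv (Subtype.ext hxv ▸ hx)
  · have : G.neighborSet (v : V) ∩ Subtype.val '' W =
        Subtype.val '' ((G.induce X).neighborSet v ∩ W) := by
      ext x
      constructor
      · rintro ⟨h1, y, hy, rfl⟩
        exact ⟨y, ⟨h1, hy⟩, rfl⟩
      · rintro ⟨y, ⟨h1, hy⟩, rfl⟩
        exact ⟨h1, y, hy, rfl⟩
    unfold degIn at hdeg ⊢
    rwa [this, Set.ncard_image_of_injective _ Subtype.val_injective]
  · exact fun h => hPQ (Set.image_injective.2 Subtype.val_injective h)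

end

section

variable {V : Type*}

/-! ### Components -/

theorem IsComponentOfDiff.conn {G : SimpleGraph V} {X D : Set V} (h : IsComponentOfDiff G X D) :
    Conn G D := by
  obtain ⟨c, rfl⟩ := h
  obtain ⟨a, ha⟩ := c.nonempty_supp
  refine ⟨⟨a, a, ha, rfl⟩, ?_⟩
  rintro T hT ⟨_, hx⟩ hcl
  obtain ⟨x, hxc, rfl⟩ := hT hx
  rintro _ ⟨y, hyc, rfl⟩
  have hreach : (G.induce Xᶜ).Reachable x y := by
    rw [SimpleGraph.ConnectedComponent.mem_supp_iff] at hxc hyc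
    exact SimpleGraph.ConnectedComponent.exact (hxc.trans hyc.symm)
  rw [SimpleGraph.reachable_iff_reflTransGen] at hreach
  induction hreach with
  | refl => exact hx
  | tail hxz hzy ih =>
    rename_i z y
    have hz : z ∈ c.supp := by
      rw [SimpleGraph.ConnectedComponent.mem_supp_iff] at hxc ⊢
      rw [← hxc]
      exact SimpleGraph.ConnectedComponent.sound
        ((SimpleGraph.reachable_iff_reflTransGen _ _).2 hxz).symm
    exact hcl _ (ih hz) _ ⟨y, hyc, rfl⟩ hzy

theorem IsComponentOfDiff.notMem {G : SimpleGraph V} {X D : Set V} (h : IsComponentOfDiff G X D)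
    {x : V} (hx : x ∈ D) : x ∉ X := by
  obtain ⟨c, rfl⟩ := h
  obtain ⟨y, -, rfl⟩ := hx
  exact y.2

theorem IsComponentOfDiff.mem_of_adj {G : SimpleGraph V} {X D : Set V}
    (h : IsComponentOfDiff G X D) {x y : V} (hx : x ∈ D) (hxy : G.Adj x y) (hy : y ∉ X) :
    y ∈ D := by
  obtain ⟨c, rfl⟩ := h
  obtain ⟨x, hx, rfl⟩ := hx
  refine ⟨⟨y, hy⟩, ?_, rfl⟩
  rw [SimpleGraph.ConnectedComponent.mem_supp_iff] at hx ⊢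
  rw [← hx]
  have hadj : (G.induce Xᶜ).Adj ⟨y, hy⟩ x := hxy.symm
  exact SimpleGraph.ConnectedComponent.sound hadj.reachable

theorem Conn.subset_component {G : SimpleGraph V} {X D E : Set V} (hE : Conn G E)
    (hD : IsComponentOfDiff G X D) (hEX : ∀ x ∈ E, x ∉ X) (hne : (E ∩ D).Nonempty) : E ⊆ D :=
  fun _ hx => (hE.2 (E ∩ D) Set.inter_subset_left hne
    (fun _ hx y hy hxy => ⟨hy, hD.mem_of_adj hx.2 hxy (hEX y hy)⟩) hx).2

/-! ### Canonical star separations -/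

section

variable {G : SimpleGraph V} {u v w : V}

theorem mem_sideA : w ∈ sideA G v ↔ w ∉ sideB G v ∧ w ≠ v ∧ ¬ Sees G w (sideB G v) := by
  simp only [sideA, sideC, nbhd, Sees, Set.mem_compl_iff, Set.mem_union, Set.mem_singleton_iff,
    Set.mem_ofPred_eq, G.adj_comm w]
  by_cases h1 : w ∈ sideB G v <;> by_cases h2 : w = v <;> simp [h1, h2]

theorem not_mem_sideA : w ∉ sideA G v ↔ w ∈ sideB G v ∨ w ∈ sideC G v :=
  Set.notMem_compl_iff

variable {S : Set V} {O : LinearOrder S}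

/-- The strict part of `leA` on unbalanced vertices. -/
def ltA (G : SimpleGraph V) (S : Set V) (O : LinearOrder S) (x y : S) : Prop :=
  (y : V) ∈ sideA G x ∧ sideB G x ⊆ sideB G y ∧ (sideB G x = sideB G y → O.lt x y)

theorem ltA_irrefl (x : S) : ¬ ltA G S O x x := fun h => (mem_sideA.1 h.1).2.1 rfl

theorem core_subset : core G S O ⊆ S := fun _ ⟨h, _⟩ => h

theorem mem_centralBag : w ∈ centralBag G S O ↔ ∀ v ∈ core G S O, w ∉ sideA G v := by
  simp only [centralBag, Set.mem_iInter, not_mem_sideA, Set.mem_union]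

theorem nbhd_component_subset_sideC {D : Set V}
    (hD : IsComponentOfDiff G (centralBag G S O) D) (hv : v ∈ core G S O)
    (hDv : D ⊆ sideA G v) : nbhd G D ⊆ sideC G v := by
  rintro w ⟨hw, x, hx, hxw⟩
  have hwb : w ∈ centralBag G S O := by
    by_contra h
    exact hw (hD.mem_of_adj hx hxw h)
  rcases not_mem_sideA.1 (mem_centralBag.1 hwb v hv) with h | h
  · exact absurd ⟨w, h, hxw⟩ (mem_sideA.1 (hDv hx)).2.2
  · exact h

/-! ### Separations of unbalanced vertices and the order on `S` -/

variable [Finite V]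

theorem Unbalanced.sideB_spec (hv : Unbalanced G v) :
    IsComponentOfDiff G (closedNbhd G v) (sideB G v) ∧
      (Nat.card V : ℚ) / 2 < ((sideB G v).ncard : ℚ) := by
  unfold Unbalanced at hv
  push Not at hv
  obtain ⟨D, hD, hcard⟩ := hv
  rw [sideB_eq G v D hD hcard]
  exact ⟨hD, hcard⟩

theorem Unbalanced.not_adj (hv : Unbalanced G v) (hw : w ∈ sideB G v) : ¬ G.Adj v w :=
  fun h => hv.sideB_spec.1.notMem hw (Or.inr h)

theorem Unbalanced.notMem_sideB (hv : Unbalanced G v) : v ∉ sideB G v :=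
  fun h => hv.sideB_spec.1.notMem h (Or.inl rfl)

theorem Unbalanced.not_sees (hv : Unbalanced G v) : ¬ Sees G v (sideB G v) := by
  rintro ⟨x, hx, hvx⟩
  exact hv.not_adj hx hvx

theorem mem_sideC (hv : Unbalanced G v) :
    w ∈ sideC G v ↔ w = v ∨ (G.Adj v w ∧ Sees G w (sideB G v)) := by
  simp only [sideC, nbhd, Sees, Set.mem_union, Set.mem_singleton_iff, Set.mem_ofPred_eq,
    G.adj_comm w]
  constructor
  · rintro (h | ⟨h1, x, hx, hxw⟩)
    · exact Or.inl h
    · by_contra hcon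
      push Not at hcon
      refine h1 (hv.sideB_spec.1.mem_of_adj hx hxw ?_)
      rintro (h2 | h2)
      · exact hcon.1 h2
      · exact hcon.2 h2 x hx hxw
  · rintro (h | ⟨h1, h2⟩)
    · exact Or.inl h
    · exact Or.inr ⟨fun h3 => hv.not_adj h3 h1, h2⟩

theorem Unbalanced.adj_sees_of_mem (hv : Unbalanced G v) (hw : w ∈ sideB G v ∪ sideC G v)
    (hne : w ≠ v) : w ∈ sideB G v ∨ (G.Adj v w ∧ Sees G w (sideB G v)) :=
  hw.imp_right fun h => ((mem_sideC hv).1 h).resolve_left hne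

theorem Unbalanced.inter_nonempty (hu : Unbalanced G u) (hv : Unbalanced G v) :
    (sideB G u ∩ sideB G v).Nonempty := by
  by_contra hcon
  have hdis := Set.disjoint_iff_inter_eq_empty.2 (Set.not_nonempty_iff_eq_empty.1 hcon)
  have h1 := Set.ncard_union_eq hdis (Set.toFinite _) (Set.toFinite _)
  have h2 : (sideB G u ∪ sideB G v).ncard ≤ Nat.card V := by
    rw [← Set.ncard_univ]
    exact Set.ncard_le_ncard (Set.subset_univ _) (Set.toFinite _)
  rw [h1] at h2
  have h3 : (((sideB G u).ncard + (sideB G v).ncard : ℕ) : ℚ) ≤ (Nat.card V : ℚ) := by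
    exact_mod_cast h2
  push_cast at h3
  linarith [hu.sideB_spec.2, hv.sideB_spec.2]

/-- Since `v` neither lies in B(u) nor sees it, B(u) is a connected set avoiding N[v]. It meets
B(v), both having more than half of the vertices, so it lies inside that component. -/
theorem Unbalanced.sideB_subset (hu : Unbalanced G u) (hv : Unbalanced G v)
    (h : v ∈ sideA G u) : sideB G u ⊆ sideB G v := by
  obtain ⟨h1, -, h2⟩ := mem_sideA.1 h
  refine hu.sideB_spec.1.conn.subset_component hv.sideB_spec.1 ?_ (hu.inter_nonempty hv)
  rintro x hx (rfl | hvx)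
  · exact h1 hx
  · exact h2 ⟨x, hx, hvx⟩

theorem mem_sideA_of_sideB_subset (hv : Unbalanced G v) (h : sideB G u ⊆ sideB G v)
    (hne : v ≠ u) : v ∈ sideA G u :=
  mem_sideA.2 ⟨fun h1 => hv.notMem_sideB (h h1), hne, fun h1 => hv.not_sees (h1.mono h)⟩

theorem Unbalanced.sideC_diff (hv : Unbalanced G v) :
    sideC G v \ {v} = nbhd G (sideB G v) := by
  have : v ∉ nbhd G (sideB G v) := fun ⟨_, x, hx, hxv⟩ => hv.not_adj hx hxv.symm
  simp [sideC, this]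

theorem Unbalanced.sideA_union (hv : Unbalanced G v) :
    sideA G v ∪ {v} = {w | w ∉ sideB G v ∧ ¬ Sees G w (sideB G v)} := by
  ext w
  simp only [Set.mem_union, mem_sideA, Set.mem_singleton_iff, Set.mem_ofPred_eq]
  by_cases h : w = v
  · subst h
    simp [hv.notMem_sideB, hv.not_sees]
  · simp [h]

/-- Both C(v) without v and A(v) together with v are determined by B(v). -/
theorem starTwins_iff (hu : Unbalanced G u) (hv : Unbalanced G v) :
    StarTwins G u v ↔ sideB G u = sideB G v := by
  refine ⟨fun h => h.1, fun h => ⟨h, ?_, ?_⟩⟩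
  · rw [hu.sideC_diff, hv.sideC_diff, h]
  · rw [hu.sideA_union, hv.sideA_union, h]

/-- In the form `ltA` the relation compares the sets B by inclusion and breaks ties by `O`, which
makes transitivity visible. -/
theorem leA_iff (hU : ∀ v ∈ S, Unbalanced G v) (x y : S) :
    leA G S O x y ↔ x = y ∨ ltA G S O x y := by
  have hx := hU x x.2
  have hy := hU y y.2
  unfold leA ltA
  rw [starTwins_iff hx hy]
  constructor
  · rintro (h | ⟨h1, h2⟩ | ⟨h1, h2⟩)
    · exact Or.inl h
    · refine Or.inr ⟨mem_sideA_of_sideB_subset hy h1.subset ?_, h1.subset, fun _ => h2⟩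
      intro h
      exact (Subtype.ext h ▸ h2 : O.lt x x).ne rfl
    · exact Or.inr ⟨h2, hx.sideB_subset hy h2, fun h => absurd h h1⟩
  · rintro (h | ⟨h1, -, h3⟩)
    · exact Or.inl h
    · by_cases h4 : sideB G x = sideB G y
      · exact Or.inr (Or.inl ⟨h4, h3 h4⟩)
      · exact Or.inr (Or.inr ⟨h4, h1⟩)

theorem ltA_trans (hU : ∀ v ∈ S, Unbalanced G v) {x y z : S} (hxy : ltA G S O x y)
    (hyz : ltA G S O y z) : ltA G S O x z := by
  have hsub := hxy.2.1.trans hyz.2.1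
  have hlt : sideB G x = sideB G z → O.lt x z := by
    intro h
    have h1 : sideB G x = sideB G y := hxy.2.1.antisymm (h ▸ hyz.2.1)
    exact @lt_trans _ O.toPreorder _ _ _ (hxy.2.2 h1) (hyz.2.2 (h1 ▸ h))
  refine ⟨mem_sideA_of_sideB_subset (hU z z.2) hsub ?_, hsub, hlt⟩
  intro h
  obtain rfl : z = x := Subtype.ext h
  exact (hlt rfl).ne rfl

theorem mem_core_iff (hU : ∀ v ∈ S, Unbalanced G v) :
    v ∈ core G S O ↔ ∃ hv : v ∈ S, ∀ u : S, ¬ ltA G S O u ⟨v, hv⟩ := by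
  refine exists_congr fun hv => forall_congr' fun u => ?_
  rw [leA_iff hU]
  constructor
  · intro h h1
    have := h (Or.inr h1)
    subst this
    exact ltA_irrefl _ h1
  · rintro h (h1 | h1)
    · exact h1
    · exact absurd h1 h

theorem mem_core_or_exists (hU : ∀ v ∈ S, Unbalanced G v) (v : S) :
    (v : V) ∈ core G S O ∨ ∃ u : S, (u : V) ∈ core G S O ∧ ltA G S O u v := by
  have : IsTrans S (ltA G S O) := ⟨fun _ _ _ => ltA_trans hU⟩
  have : Std.Irrefl (ltA G S O) := ⟨ltA_irrefl⟩
  have hwf : WellFounded (ltA G S O) := Finite.wellFounded_of_trans_of_irrefl _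
  induction v using hwf.induction with
  | _ v ih =>
    by_cases h : ∃ u, ltA G S O u v
    · obtain ⟨u, hu⟩ := h
      rcases ih u hu with h1 | ⟨w, hw, hwu⟩
      · exact Or.inr ⟨u, h1, hu⟩
      · exact Or.inr ⟨w, hw, ltA_trans hU hwu hu⟩
    · exact Or.inl ((mem_core_iff hU).2 ⟨v.2, fun u hu => h ⟨u, hu⟩⟩)

/-- If `v` were in A(u), then B(u) ⊆ B(v). A strict inclusion puts `u` below `v`, and for star twins
`O` puts one below the other; either contradicts minimality. Membership in C(u) would make `v`
adjacent to `u`. -/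
theorem mem_sideB_of_mem_core (hS : G.IsIndepSet S) (hU : ∀ v ∈ S, Unbalanced G v)
    (hu : u ∈ core G S O) (hv : v ∈ core G S O) (hne : v ≠ u) : v ∈ sideB G u := by
  obtain ⟨huS, hmu⟩ := (mem_core_iff hU).1 hu
  obtain ⟨hvS, hmv⟩ := (mem_core_iff hU).1 hv
  have hA : v ∉ sideA G u := by
    intro h
    have hsub := (hU u huS).sideB_subset (hU v hvS) h
    by_cases heq : sideB G u = sideB G v
    · rcases @lt_trichotomy _ O (⟨u, huS⟩ : S) ⟨v, hvS⟩ with h1 | h1 | h1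
      · exact hmv ⟨u, huS⟩ ⟨h, hsub, fun _ => h1⟩
      · exact hne (congrArg Subtype.val h1).symm
      · exact hmu ⟨v, hvS⟩ ⟨mem_sideA_of_sideB_subset (hU u huS) heq.symm.subset hne.symm,
          heq.symm.subset, fun _ => h1⟩
    · exact hmv ⟨u, huS⟩ ⟨h, hsub, fun h1 => absurd h1 heq⟩
  rcases (hU u huS).adj_sees_of_mem (not_mem_sideA.1 hA) hne with h | h
  · exact h
  · exact absurd h.1 (hS huS hvS hne.symm)

/-- For another core vertex `u`, the vertex `v` lies in B(u), so `v` and its neighbours avoid A(u).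
-/
theorem sideC_subset_centralBag (hS : G.IsIndepSet S) (hU : ∀ v ∈ S, Unbalanced G v)
    (hv : v ∈ core G S O) : sideC G v ⊆ centralBag G S O := by
  intro z hz
  refine mem_centralBag.2 fun u hu => ?_
  by_cases hne : v = u
  · subst hne
    exact not_mem_sideA.2 (Or.inr hz)
  · have hvu := mem_sideB_of_mem_core hS hU hu hv hne
    intro hzA
    obtain ⟨h1, -, h2⟩ := mem_sideA.1 hzA
    rcases (mem_sideC (hU v (core_subset hv))).1 hz with rfl | ⟨h, -⟩
    · exact h1 hvu
    · exact h2 ⟨v, hvu, h.symm⟩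

/-- A connected set can leave A(v) only through C(v), which lies in the central bag and hence misses
`D`. -/
theorem exists_component_subset_sideA (hS : G.IsIndepSet S) (hU : ∀ v ∈ S, Unbalanced G v)
    {D : Set V} (hD : IsComponentOfDiff G (centralBag G S O) D) :
    ∃ v ∈ core G S O, D ⊆ sideA G v := by
  obtain ⟨x, hx⟩ := hD.conn.1
  have hxb := hD.notMem hx
  rw [mem_centralBag] at hxb
  push Not at hxb
  obtain ⟨v, hv, hxv⟩ := hxb
  refine ⟨v, hv, fun y hy => ?_⟩
  refine (hD.conn.2 (D ∩ sideA G v) Set.inter_subset_left ⟨x, hx, hxv⟩ ?_ hy).2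
  intro y hy z hz hyz
  refine ⟨hz, ?_⟩
  by_contra hzA
  rcases not_mem_sideA.1 hzA with h | h
  · exact (mem_sideA.1 hy.2).2.2 ⟨z, h, hyz⟩
  · exact hD.notMem hz (sideC_subset_centralBag hS hU hv h)

end

/-! ### Ramsey numbers -/

/-- Needed so that the infimum defining `ramsey` is over a nonempty set. A vertex `x` has either
many neighbours in `X`, to which induction applies, or `t + 1` non-neighbours, which form a clique
or contain a non-adjacent pair making a stable triple with `x`. -/
theorem exists_ramsey_bound (t : ℕ) : ∃ N, ∀ n, ∀ H : SimpleGraph (Fin n), ∀ X : Finset (Fin n),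
    N ≤ X.card → (∃ K ⊆ X, H.IsNClique t K) ∨ ∃ K ⊆ X, H.IsNIndepSet 3 K := by
  classical
  induction t with
  | zero =>
    refine ⟨0, fun n H X _ => Or.inl ⟨∅, by simp, ?_⟩⟩
    simp [SimpleGraph.isNClique_iff]
  | succ t ih =>
    obtain ⟨N, hN⟩ := ih
    refine ⟨N + t + 2, fun n H X hX => ?_⟩
    obtain ⟨x, hx⟩ : X.Nonempty := Finset.card_pos.1 (by omega)
    set A := (X.erase x).filter (fun y => H.Adj x y) with hA
    set B := (X.erase x).filter (fun y => ¬ H.Adj x y) with hB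
    have hcard : A.card + B.card = X.card - 1 := by
      rw [hA, hB, Finset.card_filter_add_card_filter_not, Finset.card_erase_of_mem hx]
    have hAX : ∀ y ∈ A, y ∈ X ∧ H.Adj x y := fun y hy => by
      have := Finset.mem_filter.1 hy
      exact ⟨Finset.mem_of_mem_erase this.1, this.2⟩
    have hBX : ∀ y ∈ B, y ∈ X ∧ x ≠ y ∧ ¬ H.Adj x y := fun y hy => by
      have := Finset.mem_filter.1 hy
      exact ⟨Finset.mem_of_mem_erase this.1, (Finset.ne_of_mem_erase this.1).symm, this.2⟩
    by_cases hNA : N ≤ A.card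
    · rcases hN n H A hNA with ⟨K, hK, hcl⟩ | ⟨K, hK, hst⟩
      · refine Or.inl ⟨insert x K, ?_, hcl.insert fun y hy => (hAX y (hK hy)).2⟩
        exact Finset.insert_subset hx fun y hy => (hAX y (hK hy)).1
      · exact Or.inr ⟨K, fun y hy => (hAX y (hK hy)).1, hst⟩
    · obtain ⟨K, hK, hKc⟩ := Finset.exists_subset_card_eq (s := B) (n := t + 1) (by omega)
      by_cases hcl : H.IsNClique (t + 1) K
      · exact Or.inl ⟨K, fun y hy => (hBX y (hK hy)).1, hcl⟩
      · right
        have : ∃ y ∈ K, ∃ z ∈ K, y ≠ z ∧ ¬ H.Adj y z := by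
          by_contra hcon
          push Not at hcon
          exact hcl (SimpleGraph.isNClique_iff _ |>.2 ⟨fun y hy z hz hne => hcon y hy z hz hne, hKc⟩)
        obtain ⟨y, hy, z, hz, hyz, hnyz⟩ := this
        obtain ⟨hyX, hxy, hnxy⟩ := hBX y (hK hy)
        obtain ⟨hzX, hxz, hnxz⟩ := hBX z (hK hz)
        refine ⟨{x, y, z}, ?_, ?_, Finset.card_eq_three.2 ⟨x, y, z, hxy, hxz, hyz, rfl⟩⟩
        · intro a ha
          simp only [Finset.mem_insert, Finset.mem_singleton] at ha
          rcases ha with rfl | rfl | rfl <;> assumption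
        · intro a ha b hb hab
          simp only [Finset.coe_insert, Finset.coe_singleton, Set.mem_insert_iff,
            Set.mem_singleton_iff] at ha hb
          rcases ha with rfl | rfl | rfl <;> rcases hb with rfl | rfl | rfl <;>
            first
              | exact absurd rfl hab
              | assumption
              | (rw [H.adj_comm]; assumption)

theorem ramsey_spec (t : ℕ) : ∀ n, ramsey t 3 ≤ n → ∀ H : SimpleGraph (Fin n),
    (∃ K : Finset (Fin n), H.IsNClique t K) ∨ ∃ K : Finset (Fin n), H.IsNIndepSet 3 K := by
  refine Nat.sInf_mem (s := {N | ∀ n, N ≤ n → ∀ H : SimpleGraph (Fin n),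
    (∃ K : Finset (Fin n), H.IsNClique t K) ∨ ∃ K : Finset (Fin n), H.IsNIndepSet 3 K}) ?_
  obtain ⟨N, hN⟩ := exists_ramsey_bound t
  refine ⟨N, fun n hn H => ?_⟩
  rcases hN n H Finset.univ (by simpa using hn) with ⟨K, -, hK⟩ | ⟨K, -, hK⟩
  · exact Or.inl ⟨K, hK⟩
  · exact Or.inr ⟨K, hK⟩

theorem ncard_lt_ramsey [Finite V] {G : SimpleGraph V} {t : ℕ} (hG : G.CliqueFree t) {X : Set V}
    (hX : ∀ x ∈ X, ∀ y ∈ X, ∀ z ∈ X, x ≠ y → x ≠ z → y ≠ z → ¬ G.Adj x y → ¬ G.Adj x z →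
      G.Adj y z) : X.ncard < ramsey t 3 := by
  by_contra hcon
  let e : Fin X.ncard ≃ X := (Finite.equivFinOfCardEq rfl).symm
  let f : Fin X.ncard ↪ V := e.toEmbedding.trans (Function.Embedding.subtype _)
  have hf : ∀ i, f i ∈ X := fun i => (e i).2
  rcases ramsey_spec t X.ncard (by omega) (G.comap f) with ⟨K, hK⟩ | ⟨K, hK⟩
  · exact hG.comap ⟨(SimpleGraph.Embedding.comap f G).toCopy⟩ K hK
  · obtain ⟨x, y, z, hxy, hxz, hyz, rfl⟩ := Finset.card_eq_three.1 hK.card_eq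
    have hst := hK.isIndepSet
    exact hst (by simp) (by simp) hyz (hX _ (hf x) _ (hf y) _ (hf z) (f.injective.ne hxy)
      (f.injective.ne hxz) (f.injective.ne hyz) (hst (by simp) (by simp) hxy)
      (hst (by simp) (by simp) hxz))

/-! ### The central bag -/

/-- The neighbours of `v` in the bag split into hubs and non-hubs. All of them see B(v), so the
non-hubs contain no stable triple. -/
theorem degIn_centralBag_lt [Finite V] {G : SimpleGraph V} {t : ℕ} (hG : InClassC t G) {S : Set V}
    {O : LinearOrder S} (hU : ∀ v ∈ S, Unbalanced G v) {v : V} (hv : v ∈ core G S O) :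
    degIn G (centralBag G S O) v < ramsey t 3 + degIn G (Hub G) v := by
  have hvU := hU v (core_subset hv)
  have hcov : G.neighborSet v ∩ centralBag G S O ⊆
      ((G.neighborSet v ∩ centralBag G S O) \ Hub G) ∪ (G.neighborSet v ∩ Hub G) := by
    rintro x ⟨h1, h2⟩
    by_cases h3 : x ∈ Hub G
    · exact Or.inr ⟨h1, h3⟩
    · exact Or.inl ⟨⟨h1, h2⟩, h3⟩
  have hsees : ∀ x ∈ (G.neighborSet v ∩ centralBag G S O) \ Hub G, Sees G x (sideB G v) := by
    rintro x ⟨⟨h1, h2⟩, -⟩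
    rcases hvU.adj_sees_of_mem (not_mem_sideA.1 (mem_centralBag.1 h2 v hv)) (G.ne_of_adj h1).symm
      with h | h
    · exact absurd h1 (hvU.not_adj h)
    · exact h.2
  have hlt := ncard_lt_ramsey hG.clique_free
    (X := (G.neighborSet v ∩ centralBag G S O) \ Hub G) (by
      intro x hx y hy z hz hxy hxz hyz nxy nxz
      by_contra nyz
      rcases mem_hub_of_three hG.theta_free hG.pyramid_free hvU.sideB_spec.1.conn
        hvU.notMem_sideB (fun b hb => hvU.not_adj hb) hx.1.1 hy.1.1 hz.1.1 hxy hxz hyz nxy nxz nyz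
        (hsees x hx) (hsees y hy) (hsees z hz) with h | h | h
      · exact hx.2 h
      · exact hy.2 h
      · exact hz.2 h)
  have h1 := Set.ncard_le_ncard hcov (Set.toFinite _)
  have h2 := Set.ncard_union_le ((G.neighborSet v ∩ centralBag G S O) \ Hub G)
    (G.neighborSet v ∩ Hub G)
  unfold degIn
  omega

/-- A vertex of `S` outside the core is cut off by a core vertex below it. For a core vertex, a
wheel in the bag would yield a split hole over B(v). -/
theorem inter_hubOn_centralBag [Finite V] {G : SimpleGraph V} {t : ℕ} (hG : InClassC t G)
    {S : Set V} {O : LinearOrder S} (hU : ∀ v ∈ S, Unbalanced G v) (hQ : CubeFree G) :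
    S ∩ HubOn G (centralBag G S O) = ∅ := by
  rw [Set.eq_empty_iff_forall_notMem]
  rintro _ ⟨hvS, v, ⟨W, hW⟩, rfl⟩
  have hvU := hU v hvS
  rcases mem_core_or_exists (O := O) hU ⟨v, hvS⟩ with hv | ⟨u, hu, huv⟩
  · obtain ⟨c, n, hs⟩ := hW.image_val.exists_splitHole (D := sideB G v) (by
      rintro _ ⟨w, hw, rfl⟩
      refine hvU.adj_sees_of_mem (not_mem_sideA.1 (mem_centralBag.1 w.2 v hv)) ?_
      intro h
      exact hW.2.1 (Subtype.ext h ▸ hw))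
    exact false_of_splitHole hG.theta_free hG.pyramid_free hG.prism_free hG.pinchedPrism_free hQ
      hvU.sideB_spec.1.conn hvU.notMem_sideB (fun x hx => hvU.not_adj hx) hs
  · exact mem_centralBag.1 v.2 u hu huv.1

end

end CentralBag

theorem theorem6p4 {V : Type*} [Finite V] (G : SimpleGraph V) (t : ℕ) (ht : 1 ≤ t)
    (hG : CentralBag.InClassC t G) (S : Set V) (hS : G.IsIndepSet S)
    (hU : ∀ v ∈ S, CentralBag.Unbalanced G v) (O : LinearOrder S) :
    (∀ v ∈ CentralBag.core G S O, CentralBag.sideC G v ⊆ CentralBag.centralBag G S O) ∧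
    (∀ v ∈ CentralBag.core G S O,
      CentralBag.degIn G (CentralBag.centralBag G S O) v <
        CentralBag.ramsey t 3 + CentralBag.degIn G (CentralBag.Hub G) v) ∧
    (∀ D : Set V, CentralBag.IsComponentOfDiff G (CentralBag.centralBag G S O) D →
      (∃ v ∈ CentralBag.core G S O, D ⊆ CentralBag.sideA G v) ∧
      ∀ v ∈ CentralBag.core G S O, D ⊆ CentralBag.sideA G v →
        CentralBag.nbhd G D ⊆ CentralBag.sideC G v) ∧
    (CentralBag.CubeFree G →
      S ∩ CentralBag.HubOn G (CentralBag.centralBag G S O) = ∅) :=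
  ⟨fun _ hv => CentralBag.sideC_subset_centralBag hS hU hv,
    fun _ hv => CentralBag.degIn_centralBag_lt hG hU hv,
    fun _ hD => ⟨CentralBag.exists_component_subset_sideA hS hU hD,
      fun _ hv hDv => CentralBag.nbhd_component_subset_sideC hD hv hDv⟩,
    fun hQ => CentralBag.inter_hubOn_centralBag hG hU hQ⟩
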